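/- **Setting.** Let $\mathcal M=(\mathcal S,\mathcal A,H,p_0,p,R)$ be a stationary episodic MDP with finite $\mathcal S,\mathcal A$, $S=|\mathcal S|$, $A=|\mathcal A|$, horizon $H$, $M:=SAH\ge 2$, initial distribution $p_0$, transition probabilities $p(\cdot\mid x,a)$, and random rewards $R(x,a)\in[0,1]$ with mean $r(x,a)$. Write $[H]=\{1,\dots,H\}$, $\wedge=\min$, $q^\top V=\sum_y q(y)V(y)$, $\mathrm{Var}_q[V]=\sum_y q(y)(V(y)-q^\top V)^2$ and $\|V\|_{2,q}=(\sum_y q(y)V(y)^2)^{1/2}$. For a policy $\pi=(\pi_h)$ let $\mathbf V^\pi_h(x)=\mathbb E^\pi[\sum_{t=h}^H r(x_t,a_t)\mid x_h=x]$ (so $\mathbf V^\pi_{H+1}=0$), $\mathbf V^\star_h(x)=\sup_\pi\mathbf V^\pi_h(x)$, $\mathrm{Var}^\pi_{h,x,a}=\mathrm{Var}[R(x,a)]+\mathrm{Var}_{p(x,a)}[\mathbf V^\pi_{h+1}]$, and let $\mathrm{Var}^\star_{h,x,a}$ be the same with $\mathbf V^\star_{h+1}$ in place of $\mathbf V^\pi_{h+1}$.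 Here $\mathbb E^\pi[\,\cdot\mid(x_h,a_h)=(x,a)]$ is expectation over the process that starts at stage $h$ from the pair $(x,a)$ and then follows $x_{t+1}\sim p(x_t,a_t)$, $a_{t+1}=\pi_{t+1}(x_{t+1})$. **StrongEuler.** Let $\delta\in(0,1)$. In episodes $k=1,2,\dots$ the algorithm plays a policy $\pi_k$: $x_1\sim p_0$, and for $h\in[H]$, $a_h=\pi_{k,h}(x_h)$, a reward distributed as $R(x_h,a_h)$ is received and $x_{h+1}\sim p(x_h,a_h)$ is observed. Let $n=n_k(x,a)$ be the number of visits to $(x,a)$ before episode $k$; let $\hat r=\hat r_k(x,a)$, $\hat p=\hat p_k(x,a)$, $\widehat{\mathrm{Var}}=\widehat{\mathrm{Var}}_k[R(x,a)]$ be the empirical mean reward, empirical next-state frequencies and empirical reward variance (mean of squares minus squared mean) over those visits, all $0$ if $n=0$. Put $\mathbf L=\mathbf L(n)$ with $\mathbf L(u)=2\log(10M^2\max\{u,1\}/\delta)$. Starting from $\overline V_{k,H+1}=\underline V_{k,H+1}=0$, for $h=H,\dots,1$ let $$b^{\rm rew}_k=1\wedge\Big(\sqrt{\tfrac{2\widehat{\mathrm{Var}}\,\mathbf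 L}{n}}+\tfrac{8\mathbf L}{3(n-1)}\Big),$$ $$b^{\rm prob}_{k,h}=H\wedge\Big(\sqrt{\tfrac{2\mathrm{Var}_{\hat p}[\overline V_{k,h+1}]\mathbf L}{n}}+\tfrac{8H\mathbf L}{3(n-1)}+\sqrt{\tfrac{2\mathbf L\|\underline V_{k,h+1}-\overline V_{k,h+1}\|_{2,\hat p}^2}{n}}\Big),$$ $$b^{\rm str}_{k,h}=\|\overline V_{k,h+1}-\underline V_{k,h+1}\|_{2,\hat p}\sqrt{\tfrac{S\mathbf L}{n}}+\tfrac83\tfrac{SH\mathbf L}{n},$$ $$\overline Q_{k,h}(x,a)=\min\{H-h+1,\ \hat r+\hat p^\top\overline V_{k,h+1}+b^{\rm prob}_{k,h}+b^{\rm rew}_k+b^{\rm str}_{k,h}\},$$ where a vanishing denominator is read as giving $+\infty$ (so $b^{\rm rew}_k=1$ and $b^{\rm prob}_{k,h}=H$ if $n\le1$). Then $\pi_{k,h}(x)\in\arg\max_a\overline Q_{k,h}(x,a)$ (ties broken arbitrarily), $\overline V_{k,h}(x)=\overline Q_{k,h}(x,\pi_{k,h}(x))$ and, at $a=\pi_{k,h}(x)$,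 $\underline V_{k,h}(x)=\max\{0,\hat r-b^{\rm rew}_k+\hat p^\top\underline V_{k,h+1}-b^{\rm prob}_{k,h}-b^{\rm str}_{k,h}\}$. The surplus is $$\mathbf E_{k,h}(x,a)=\overline Q_{k,h}(x,a)-r(x,a)-p(x,a)^\top\overline V_{k,h+1}.$$ **Proposition.** There is a universal constant $\mathbf c\ge1$ such that, for every such MDP and $\delta$, StrongEuler run with confidence parameter $\delta$ admits an event $\mathcal A^{\rm conc}$ with $\Pr[\mathcal A^{\rm conc}]\ge1-\delta/2$ on which, for all $x\in\mathcal S$, $a\in\mathcal A$, $h\in[H]$ and $k\ge1$, $$0\le\frac1{\mathbf c}\mathbf E_{k,h}(x,a)\le\mathbf B^{\rm lead}_{k,h}(x,a)+\mathbb E^{\pi_k}\Big[\sum_{t=h}^H\mathbf B^{\rm fut}_k(x_t,a_t)\,\Big|\,(x_h,a_h)=(x,a)\Big],$$ where, with $n=n_k(x,a)$ and $\mathrm{Var}^{(k)}_{h,x,a}=\min\{\mathrm{Var}^\star_{h,x,a},\mathrm{Var}^{\pi_k}_{h,x,a}\}$, $$\mathbf B^{\rm lead}_{k,h}(x,a)=H\wedge\sqrt{\frac{\mathrm{Var}^{(k)}_{h,x,a}\log(Mn/\delta)}{n}},\qquad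 \mathbf B^{\rm fut}_k(x,a)=H^3\wedge H^3\Big(\sqrt{\frac{S\log(Mn/\delta)}{n}}+\frac{S\log(Mn/\delta)}{n}\Big)^2,$$ read as $H$ and $H^3$ respectively when $n=0$. In particular, on this event StrongEuler is strongly optimistic, i.e. all its surpluses are nonnegative. -/

import Mathlib

open MeasureTheory ProbabilityTheory

noncomputable section

namespace StrongEuler

/-- A stationary episodic MDP with states `S`, actions `A`, horizon `H`, initial distribution `p0`,
transition probabilities `p x a y = p(y | x, a)` and reward laws supported in `[0, 1]`.
Stages are numbered `1, …, H`. -/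
structure MDP (S A : Type*) [Fintype S] where
  H : ℕ
  p0 : S → ℝ
  p : S → A → S → ℝ
  rewardLaw : S → A → Measure ℝ
  p0_mem : p0 ∈ stdSimplex ℝ S
  p_mem : ∀ x a, p x a ∈ stdSimplex ℝ S
  rewardLaw_prob : ∀ x a, IsProbabilityMeasure (rewardLaw x a)
  rewardLaw_supp : ∀ x a, ∀ᵐ u ∂(rewardLaw x a), u ∈ Set.Icc (0 : ℝ) 1

/-- `q^⊤ V`. -/
def mean {S : Type*} [Fintype S] (q V : S → ℝ) : ℝ := ∑ y, q y * V y

/-- `Var_{y ∼ q}[V y]`. -/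
def var {S : Type*} [Fintype S] (q V : S → ℝ) : ℝ := ∑ y, q y * (V y - mean q V) ^ 2

/-- `‖V‖_{2,q} = √(∑ y, q y V(y)²)`. -/
def norm2 {S : Type*} [Fintype S] (q V : S → ℝ) : ℝ := Real.sqrt (∑ y, q y * V y ^ 2)

/-- `M = |S| |A| H`. -/
def size (S A : Type*) [Fintype S] [Fintype A] (H : ℕ) : ℕ := Fintype.card S * Fintype.card A * H

namespace MDP

variable {S A : Type*} [Fintype S] [Fintype A] [DecidableEq S] [DecidableEq A]

/-- Mean reward `r(x, a)`. -/
def r (𝓜 : MDP S A) (x : S) (a : A) : ℝ := ∫ u, u ∂(𝓜.rewardLaw x a)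

/-- `Var[R(x, a)]`. -/
def rewardVar (𝓜 : MDP S A) (x : S) (a : A) : ℝ := variance (fun u : ℝ => u) (𝓜.rewardLaw x a)

/-- `𝓜.law π h x a j y b` is the probability that `(x_{h+j}, a_{h+j}) = (y, b)` when the process is
started at stage `h` from the pair `(x_h, a_h) = (x, a)` and then follows
`x_{t+1} ∼ p(x_t, a_t)`, `a_{t+1} = π_{t+1}(x_{t+1})`. -/
def law (𝓜 : MDP S A) (π : ℕ → S → A) (h : ℕ) (x : S) (a : A) : ℕ → S → A → ℝ
  | 0 => fun y b => if y = x ∧ b = a then 1 else 0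
  | j + 1 => fun y b =>
      if b = π (h + (j + 1)) y then ∑ z, ∑ c, 𝓜.law π h x a j z c * 𝓜.p z c y else 0

/-- `E^π[∑_{t=h}^H f(x_t, a_t) | (x_h, a_h) = (x, a)]`. -/
def rolloutSum (𝓜 : MDP S A) (π : ℕ → S → A) (f : S → A → ℝ) (h : ℕ) (x : S) (a : A) : ℝ :=
  ∑ t ∈ Finset.Icc h 𝓜.H, ∑ y, ∑ b, 𝓜.law π h x a (t - h) y b * f y b

/-- The value `V^π_h(x)`; it is `0` at `h = H + 1`. -/
def value (𝓜 : MDP S A) (π : ℕ → S → A) (h : ℕ) (x : S) : ℝ :=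
  𝓜.rolloutSum π 𝓜.r h x (π h x)

/-- The optimal value `V^⋆_h(x)`, the supremum of `V^π_h(x)` over all policies. -/
def optValue (𝓜 : MDP S A) (h : ℕ) (x : S) : ℝ := ⨆ π : ℕ → S → A, 𝓜.value π h x

/-- `min {Var^⋆_{h,x,a}, Var^π_{h,x,a}}`, where
`Var^π_{h,x,a} = Var[R(x,a)] + Var_{x' ∼ p(x,a)}[V^π_{h+1}(x')]`. -/
def minVar (𝓜 : MDP S A) (π : ℕ → S → A) (h : ℕ) (x : S) (a : A) : ℝ :=
  min (𝓜.rewardVar x a + var (𝓜.p x a) (𝓜.optValue (h + 1)))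
    (𝓜.rewardVar x a + var (𝓜.p x a) (𝓜.value π (h + 1)))

end MDP

/-- One realization of the interaction: states `X k h`, rewards `rew k h` and policies `pol k h`
in episode `k ≥ 1` at stage `h`. The states include the state `X k (H + 1)` reached after the last
action. -/
structure Transcript (S A : Type*) where
  X : ℕ → ℕ → S
  rew : ℕ → ℕ → ℝ
  pol : ℕ → ℕ → S → A

namespace Transcript

variable {S A : Type*} [Fintype S] [Fintype A] [DecidableEq S] [DecidableEq A]

/-- The action `a_{k,h} = π_{k,h}(x_{k,h})`. -/
def action (D : Transcript S A) (k h : ℕ) : A := D.pol k h (D.X k h)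

/-- The (episode, stage) pairs before episode `k` at which `(x, a)` was visited. -/
def visits (D : Transcript S A) (H k : ℕ) (x : S) (a : A) : Finset (ℕ × ℕ) :=
  (Finset.Ico 1 k ×ˢ Finset.Icc 1 H).filter fun i => D.X i.1 i.2 = x ∧ D.action i.1 i.2 = a

/-- `n_k(x, a)`. -/
def n (D : Transcript S A) (H k : ℕ) (x : S) (a : A) : ℕ := (D.visits H k x a).card

/-- `n_k(y | x, a)`. -/
def nNext (D : Transcript S A) (H k : ℕ) (x : S) (a : A) (y : S) : ℕ :=
  ((D.visits H k x a).filter fun i => D.X i.1 (i.2 + 1) = y).card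

/-- Empirical transition probabilities (zero before the first visit). -/
def phat (D : Transcript S A) (H k : ℕ) (x : S) (a : A) (y : S) : ℝ :=
  (D.nNext H k x a y : ℝ) / (D.n H k x a : ℝ)

/-- Empirical mean reward (zero before the first visit). -/
def rhat (D : Transcript S A) (H k : ℕ) (x : S) (a : A) : ℝ :=
  (∑ i ∈ D.visits H k x a, D.rew i.1 i.2) / (D.n H k x a : ℝ)

/-- Empirical reward variance (zero before the first visit). -/
def varHat (D : Transcript S A) (H k : ℕ) (x : S) (a : A) : ℝ :=
  (∑ i ∈ D.visits H k x a, D.rew i.1 i.2 ^ 2) / (D.n H k x a : ℝ) - D.rhat H k x a ^ 2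

/-- The logarithmic factor `L(u) = 2 log (10 M² max{u, 1} / δ)` at `u = n_k(x, a)`. -/
def L (D : Transcript S A) (H : ℕ) (δ : ℝ) (k : ℕ) (x : S) (a : A) : ℝ :=
  2 * Real.log (10 * (size S A H : ℝ) ^ 2 * max (D.n H k x a : ℝ) 1 / δ)

/-- The reward bonus. If `n_k(x, a) ≤ 1` a denominator vanishes, the expression in parentheses is
`+∞`, and the minimum is `1`. -/
def bonusRew (D : Transcript S A) (H : ℕ) (δ : ℝ) (k : ℕ) (x : S) (a : A) : ℝ :=
  if D.n H k x a ≤ 1 then 1 else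
    min 1 (Real.sqrt (2 * D.varHat H k x a * D.L H δ k x a / (D.n H k x a : ℝ))
      + 8 * D.L H δ k x a / (3 * ((D.n H k x a : ℝ) - 1)))

/-- The transition bonus, as a function of the upper and lower values `vu`, `vl` of the next stage.
If `n_k(x, a) ≤ 1` a denominator vanishes, the expression in parentheses is `+∞`, and the minimum
is `H`. -/
def bonusProb (D : Transcript S A) (H : ℕ) (δ : ℝ) (k : ℕ) (vu vl : S → ℝ) (x : S) (a : A) : ℝ :=
  if D.n H k x a ≤ 1 then (H : ℝ) else
    min (H : ℝ) (Real.sqrt (2 * var (D.phat H k x a) vu * D.L H δ k x a / (D.n H k x a : ℝ))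
      + 8 * (H : ℝ) * D.L H δ k x a / (3 * ((D.n H k x a : ℝ) - 1))
      + Real.sqrt (2 * D.L H δ k x a * norm2 (D.phat H k x a) (vl - vu) ^ 2 / (D.n H k x a : ℝ)))

/-- The strong-optimism bonus. Its value for `n_k(x, a) = 0` (formally `+∞`) is immaterial: then the
other two bonuses are `H` and `1`, and both truncations in `qStep` and `vLowStep` are active. -/
def bonusStr (D : Transcript S A) (H : ℕ) (δ : ℝ) (k : ℕ) (vu vl : S → ℝ) (x : S) (a : A) : ℝ :=
  norm2 (D.phat H k x a) (vu - vl)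
      * Real.sqrt ((Fintype.card S : ℝ) * D.L H δ k x a / (D.n H k x a : ℝ))
    + 8 / 3 * ((Fintype.card S : ℝ) * (H : ℝ) * D.L H δ k x a / (D.n H k x a : ℝ))

/-- The optimistic `Q`-function with `j + 1` stages to go, from the values of the next stage. -/
def qStep (D : Transcript S A) (H : ℕ) (δ : ℝ) (k j : ℕ) (vu vl : S → ℝ) (x : S) (a : A) : ℝ :=
  min ((j : ℝ) + 1) (D.rhat H k x a + mean (D.phat H k x a) vu + D.bonusProb H δ k vu vl x a
    + D.bonusRew H δ k x a + D.bonusStr H δ k vu vl x a)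

/-- The lower value at a stage where the action `a` is played, from the values of the next stage. -/
def vLowStep (D : Transcript S A) (H : ℕ) (δ : ℝ) (k : ℕ) (vu vl : S → ℝ) (x : S) (a : A) : ℝ :=
  max 0 (D.rhat H k x a - D.bonusRew H δ k x a + mean (D.phat H k x a) vl
    - D.bonusProb H δ k vu vl x a - D.bonusStr H δ k vu vl x a)

/-- Optimistic value iteration in episode `k`: upper and lower values with `j` stages to go, that is,
at stage `H + 1 - j`. -/
def values (D : Transcript S A) (H : ℕ) (δ : ℝ) (k : ℕ) : ℕ → (S → ℝ) × (S → ℝ)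
  | 0 => (fun _ => 0, fun _ => 0)
  | j + 1 =>
    (fun x => D.qStep H δ k j (D.values H δ k j).1 (D.values H δ k j).2 x (D.pol k (H - j) x),
     fun x => D.vLowStep H δ k (D.values H δ k j).1 (D.values H δ k j).2 x (D.pol k (H - j) x))

/-- The optimistic value function of episode `k` at stage `h ≤ H + 1`. -/
def vUp (D : Transcript S A) (H : ℕ) (δ : ℝ) (k h : ℕ) (x : S) : ℝ :=
  (D.values H δ k (H + 1 - h)).1 x

/-- The lower value function of episode `k` at stage `h ≤ H + 1`. -/
def vLow (D : Transcript S A) (H : ℕ) (δ : ℝ) (k h : ℕ) (x : S) : ℝ :=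
  (D.values H δ k (H + 1 - h)).2 x

/-- The optimistic `Q`-function of episode `k` at stage `h ≤ H`. -/
def qUp (D : Transcript S A) (H : ℕ) (δ : ℝ) (k h : ℕ) (x : S) (a : A) : ℝ :=
  D.qStep H δ k (H - h) (D.vUp H δ k (h + 1)) (D.vLow H δ k (h + 1)) x a

/-- The policies are those of StrongEuler with confidence parameter `δ`: in every episode they
maximize the optimistic `Q`-function built from the preceding episodes (ties broken arbitrarily). -/
def IsStrongEuler (D : Transcript S A) (H : ℕ) (δ : ℝ) : Prop :=
  ∀ k, 1 ≤ k → ∀ h ∈ Finset.Icc 1 H, ∀ x a,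
    D.qUp H δ k h x a ≤ D.qUp H δ k h x (D.pol k h x)

/-- The surplus `E_{k,h}(x, a)`. -/
def surplus (D : Transcript S A) (𝓜 : MDP S A) (δ : ℝ) (k h : ℕ) (x : S) (a : A) : ℝ :=
  D.qUp 𝓜.H δ k h x a - 𝓜.r x a - mean (𝓜.p x a) (D.vUp 𝓜.H δ k (h + 1))

/-- `log (M n_k(x, a) / δ)`. -/
def logTerm (D : Transcript S A) (H : ℕ) (δ : ℝ) (k : ℕ) (x : S) (a : A) : ℝ :=
  Real.log ((size S A H : ℝ) * (D.n H k x a : ℝ) / δ)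

/-- The lead term; it is `H` if `n_k(x, a) = 0`. -/
def bLead (D : Transcript S A) (𝓜 : MDP S A) (δ : ℝ) (k h : ℕ) (x : S) (a : A) : ℝ :=
  if D.n 𝓜.H k x a = 0 then (𝓜.H : ℝ) else
    min (𝓜.H : ℝ) (Real.sqrt
      (𝓜.minVar (D.pol k) h x a * D.logTerm 𝓜.H δ k x a / (D.n 𝓜.H k x a : ℝ)))

/-- The future term; it is `H³` if `n_k(x, a) = 0`. -/
def bFut (D : Transcript S A) (H : ℕ) (δ : ℝ) (k : ℕ) (x : S) (a : A) : ℝ :=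
  if D.n H k x a = 0 then (H : ℝ) ^ 3 else
    min ((H : ℝ) ^ 3) ((H : ℝ) ^ 3 *
      (Real.sqrt ((Fintype.card S : ℝ) * D.logTerm H δ k x a / (D.n H k x a : ℝ))
        + (Fintype.card S : ℝ) * D.logTerm H δ k x a / (D.n H k x a : ℝ)) ^ 2)

end Transcript

/-- The history just before the reward and the next state of episode `k`, stage `h` are drawn: the
policies of episodes `1, …, k`, all states and rewards of the episodes before `k`, the states
`X k 1, …, X k h` and the rewards `rew k 1, …, rew k (h - 1)`. For `h = 0` this is the history just
before the initial state of episode `k` is drawn. -/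
@[reducible]
def history {S A Ω : Type*} (H : ℕ) (D : Ω → Transcript S A) (k h : ℕ) : MeasurableSpace Ω :=
  MeasurableSpace.generateFrom
    ({E | ∃ j t x a, 1 ≤ j ∧ j ≤ k ∧ 1 ≤ t ∧ t ≤ H ∧ E = {ω | (D ω).pol j t x = a}} ∪
     {E | ∃ j t x, 1 ≤ j ∧ 1 ≤ t ∧ ((j < k ∧ t ≤ H + 1) ∨ (j = k ∧ t ≤ h)) ∧
        E = {ω | (D ω).X j t = x}} ∪
     {E | ∃ j t B, 1 ≤ j ∧ 1 ≤ t ∧ ((j < k ∧ t ≤ H) ∨ (j = k ∧ t < h)) ∧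
        MeasurableSet B ∧ E = {ω | (D ω).rew j t ∈ B}})

/-- `D` is, under `μ`, a random interaction with the MDP `𝓜`: conditionally on the history, initial
states have law `p0`, rewards have law `R(x_{k,h}, a_{k,h})` and next states have law
`p(x_{k,h}, a_{k,h})`. -/
structure IsInteraction {S A Ω : Type*} [Fintype S] [MeasurableSpace Ω]
    (𝓜 : MDP S A) (μ : Measure Ω) (D : Ω → Transcript S A) : Prop where
  measurable_X : ∀ k h x, MeasurableSet {ω | (D ω).X k h = x}
  measurable_rew : ∀ k h, Measurable fun ω => (D ω).rew k h
  measurable_pol : ∀ k h x a, MeasurableSet {ω | (D ω).pol k h x = a}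
  initial : ∀ k, 1 ≤ k → ∀ y,
    μ[{ω | (D ω).X k 1 = y}.indicator (fun _ => (1 : ℝ)) | history 𝓜.H D k 0]
      =ᵐ[μ] fun _ => 𝓜.p0 y
  transition : ∀ k, 1 ≤ k → ∀ h ∈ Finset.Icc 1 𝓜.H, ∀ y,
    μ[{ω | (D ω).X k (h + 1) = y}.indicator (fun _ => (1 : ℝ)) | history 𝓜.H D k h]
      =ᵐ[μ] fun ω => 𝓜.p ((D ω).X k h) ((D ω).action k h) y
  reward : ∀ k, 1 ≤ k → ∀ h ∈ Finset.Icc 1 𝓜.H, ∀ B : Set ℝ, MeasurableSet B →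
    μ[{ω | (D ω).rew k h ∈ B}.indicator (fun _ => (1 : ℝ)) | history 𝓜.H D k h]
      =ᵐ[μ] fun ω => (𝓜.rewardLaw ((D ω).X k h) ((D ω).action k h)).real B

end StrongEuler

end

/-! Optimism requires the bonuses to pay for `(p - p̂)ᵀV̄`, although `V̄` depends on the data. The
error splits as `(p - p̂)V⋆ + (p - p̂)(V̄ - V⋆)`. In the first summand `V⋆` is a fixed function, so
an empirical Bernstein inequality without a factor `S` applies; its variance is that of `V⋆`, and
passing to `V̄` costs the norm of `V̄ - V̲`. This is `bonusProb`. The second summand needs a bound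
uniform over all functions, hence a factor `S`, but it scales with the norm of `V̄ - V̲`. This is
`bonusStr`. Both parts feed a backward induction (`backup_le_qStep`, `vLowStep_le_backup`,
`sandwich_values`) showing that `V̲ ≤ V^π ≤ V⋆ ≤ V̄` for the played policy, and that the surplus is
nonnegative.

All randomness is handled by Ville's inequality for nonnegative supermartingales which move only at
visits to a fixed pair, so the random number of visits costs nothing extra. Three kinds occur: the
wealth of gamblers betting dyadic fractions (`empirical_bernstein`), an exponential supermartingale
for the empirical reward variance, and the likelihood ratio of Laplace's rule of succession to `p`.
The last bounds `KL(p̂‖p)` by `S log (n K) / n`, used in its dual form (`change_of_measure`). Each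
kind fails with probability at most `1 / K`, where `K = 10 M² / δ`.

For the upper bound, `qStep_sub_le` estimates the surplus by a standard deviation, the mean square
of the gap `V̄ - V̲` at the next stage, and `H ε` with `ε = S L / n`. The standard deviation may be
that of any function between `V̲` and `V̄`, so of `V⋆` or of `V^π`: this gives the minimum in the
lead term. The term `H ε` is below the future term at `(x, a)`. The gap grows per stage by at most a
multiple of `H (√ε + ε)` (`qStep_sub_vLowStep_le`), up to truncation; by Jensen and Cauchy–Schwarz
over at most `H` stages, its square is below the expected sum of future terms (`gap_sq_le`). -/

set_option linter.unusedSectionVars false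

noncomputable section

namespace StrongEuler

/-! ### Means, variances and norms under finite weights -/

section FiniteExpectation

variable {S : Type*} [Fintype S]

lemma mean_add (q V W : S → ℝ) : mean q (fun y => V y + W y) = mean q V + mean q W := by
  simp only [mean, mul_add, Finset.sum_add_distrib]

lemma mean_sub (q V W : S → ℝ) : mean q (fun y => V y - W y) = mean q V - mean q W := by
  simp only [mean, mul_sub, Finset.sum_sub_distrib]

lemma mean_const_mul (q V : S → ℝ) (c : ℝ) : mean q (fun y => c * V y) = c * mean q V := by
  simp only [mean, Finset.mul_sum]
  exact Finset.sum_congr rfl fun y _ => by ring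

lemma mean_const {q : S → ℝ} (hq : q ∈ stdSimplex ℝ S) (c : ℝ) : mean q (fun _ => c) = c := by
  simp only [mean, ← Finset.sum_mul, hq.2, one_mul]

lemma mean_mono {q V W : S → ℝ} (hq : ∀ y, 0 ≤ q y) (h : ∀ y, V y ≤ W y) :
    mean q V ≤ mean q W :=
  Finset.sum_le_sum fun y _ => mul_le_mul_of_nonneg_left (h y) (hq y)

lemma mean_nonneg {q V : S → ℝ} (hq : ∀ y, 0 ≤ q y) (h : ∀ y, 0 ≤ V y) : 0 ≤ mean q V :=
  Finset.sum_nonneg fun y _ => mul_nonneg (hq y) (h y)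

lemma mean_le {q V : S → ℝ} (hq : q ∈ stdSimplex ℝ S) {c : ℝ} (h : ∀ y, V y ≤ c) :
    mean q V ≤ c :=
  (mean_mono hq.1 h).trans_eq (mean_const hq c)

lemma le_mean {q V : S → ℝ} (hq : q ∈ stdSimplex ℝ S) {c : ℝ} (h : ∀ y, c ≤ V y) :
    c ≤ mean q V :=
  (mean_const hq c).symm.trans_le (mean_mono hq.1 h)

lemma mean_sub_const {q : S → ℝ} (hq : q ∈ stdSimplex ℝ S) (V : S → ℝ) (c : ℝ) :
    mean q (fun y => V y - c) = mean q V - c := by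
  rw [mean_sub, mean_const hq]

lemma var_nonneg {q : S → ℝ} (hq : ∀ y, 0 ≤ q y) (V : S → ℝ) : 0 ≤ var q V :=
  Finset.sum_nonneg fun y _ => mul_nonneg (hq y) (sq_nonneg _)

/-- Bias–variance decomposition: the variance is the least mean square over all centres. -/
lemma mean_sq_sub {q : S → ℝ} (hq : q ∈ stdSimplex ℝ S) (V : S → ℝ) (c : ℝ) :
    mean q (fun y => (V y - c) ^ 2) = var q V + (mean q V - c) ^ 2 := by
  have h1 : ∀ y, (V y - c) ^ 2 = (V y - mean q V) ^ 2
      + (2 * (mean q V - c) * (V y - mean q V) + (mean q V - c) ^ 2) := fun y => by ring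
  simp only [h1, mean_add, mean_const_mul, mean_sub_const hq, mean_const hq]
  simp [var, mean]

lemma var_le_mean_sq_sub {q : S → ℝ} (hq : q ∈ stdSimplex ℝ S) (V : S → ℝ) (c : ℝ) :
    var q V ≤ mean q (fun y => (V y - c) ^ 2) := by
  rw [mean_sq_sub hq]; nlinarith [sq_nonneg (mean q V - c)]

lemma sq_mean_le {q : S → ℝ} (hq : q ∈ stdSimplex ℝ S) (V : S → ℝ) :
    mean q V ^ 2 ≤ mean q (fun y => V y ^ 2) := by
  have h := mean_sq_sub hq V 0
  simp only [sub_zero] at h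
  rw [h]; linarith [var_nonneg hq.1 V]

lemma norm2_sq {q : S → ℝ} (hq : ∀ y, 0 ≤ q y) (V : S → ℝ) :
    norm2 q V ^ 2 = mean q (fun y => V y ^ 2) :=
  Real.sq_sqrt (Finset.sum_nonneg fun y _ => mul_nonneg (hq y) (sq_nonneg _))

lemma norm2_nonneg (q V : S → ℝ) : 0 ≤ norm2 q V := Real.sqrt_nonneg _

lemma norm2_eq (q V : S → ℝ) : norm2 q V = √(mean q (fun y => V y ^ 2)) := rfl

lemma norm2_mono {q V W : S → ℝ} (hq : ∀ y, 0 ≤ q y) (h0 : ∀ y, 0 ≤ V y) (h : ∀ y, V y ≤ W y) :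
    norm2 q V ≤ norm2 q W :=
  Real.sqrt_le_sqrt (mean_mono hq fun y => pow_le_pow_left₀ (h0 y) (h y) 2)

lemma norm2_sub_comm (q V W : S → ℝ) : norm2 q (V - W) = norm2 q (W - V) := by
  unfold norm2
  congr 1
  exact Finset.sum_congr rfl fun y _ => by simp only [Pi.sub_apply]; ring

/-- Cauchy–Schwarz for finite weighted sums. -/
lemma abs_mean_mul_le {q : S → ℝ} (hq : ∀ y, 0 ≤ q y) (V W : S → ℝ) :
    |mean q (fun y => V y * W y)| ≤ norm2 q V * norm2 q W := by
  refine abs_le_of_sq_le_sq ?_ (mul_nonneg (norm2_nonneg _ _) (norm2_nonneg _ _))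
  rw [mul_pow, norm2_sq hq, norm2_sq hq]
  have h := Finset.sum_mul_sq_le_sq_mul_sq Finset.univ (fun y => √(q y) * V y)
    (fun y => √(q y) * W y)
  have h1 : ∀ y, √(q y) * V y * (√(q y) * W y) = q y * (V y * W y) := fun y => by
    rw [show √(q y) * V y * (√(q y) * W y) = (√(q y)) ^ 2 * (V y * W y) by ring,
      Real.sq_sqrt (hq y)]
  have h2 : ∀ (U : S → ℝ) y, (√(q y) * U y) ^ 2 = q y * U y ^ 2 := fun U y => by
    rw [mul_pow, Real.sq_sqrt (hq y)]
  simpa only [h1, h2, mean] using h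

lemma norm2_add_le {q : S → ℝ} (hq : ∀ y, 0 ≤ q y) (V W : S → ℝ) :
    norm2 q (fun y => V y + W y) ≤ norm2 q V + norm2 q W := by
  refine abs_le_of_sq_le_sq' ?_ (add_nonneg (norm2_nonneg _ _) (norm2_nonneg _ _)) |>.2
  have h1 : ∀ y, (V y + W y) ^ 2 = V y ^ 2 + (2 * (V y * W y) + W y ^ 2) := fun y => by ring
  rw [norm2_sq hq]
  simp only [h1, mean_add, mean_const_mul]
  rw [← norm2_sq hq, ← norm2_sq hq]
  nlinarith [le_of_abs_le (abs_mean_mul_le hq V W)]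

lemma norm2_sub_mean_le {q : S → ℝ} (hq : q ∈ stdSimplex ℝ S) (V : S → ℝ) :
    norm2 q (fun y => V y - mean q V) ≤ norm2 q V := by
  refine Real.sqrt_le_sqrt ?_
  have := var_le_mean_sq_sub hq V 0
  simpa [var, mean] using this

/-- The standard deviation satisfies a triangle inequality. -/
lemma sqrt_var_le {q : S → ℝ} (hq : q ∈ stdSimplex ℝ S) (V W : S → ℝ) :
    √(var q V) ≤ √(var q W) + norm2 q (W - V) := by
  rw [norm2_sub_comm]
  have h1 := norm2_add_le hq.1 (fun y => W y - mean q W)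
    (fun y => (V - W) y - mean q (V - W))
  have h2 := norm2_sub_mean_le hq (V - W)
  have h3 : mean q (V - W) = mean q V - mean q W := mean_sub q V W
  have h4 : (fun y => (W y - mean q W) + ((V - W) y - mean q (V - W)))
      = fun y => V y - mean q V := by
    funext y; rw [h3]; simp only [Pi.sub_apply]; ring
  rw [h4] at h1
  exact h1.trans (by simpa [norm2, var] using h2)

/-- Centre `V` at the mean of `W` and use `(s + t)² ≤ 2s² + 2t²`. -/
lemma var_le_two_mul_add {q : S → ℝ} (hq : q ∈ stdSimplex ℝ S) (V W : S → ℝ) :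
    var q V ≤ 2 * var q W + 2 * mean q (fun y => (V y - W y) ^ 2) := by
  refine (var_le_mean_sq_sub hq V (mean q W)).trans ?_
  have : var q W = mean q (fun y => (W y - mean q W) ^ 2) := rfl
  rw [this, ← mean_const_mul, ← mean_const_mul, ← mean_add]
  refine mean_mono hq.1 fun y => ?_
  nlinarith [sq_nonneg ((V y - W y) - (W y - mean q W))]

end FiniteExpectation

/-! ### Bellman equations and bounds on values -/

namespace MDP

lemma r_mem {S A : Type*} [Fintype S] (𝓜 : MDP S A) (x : S) (a : A) : 𝓜.r x a ∈ Set.Icc (0 : ℝ) 1 := by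
  have := 𝓜.rewardLaw_prob x a
  have hs := 𝓜.rewardLaw_supp x a
  refine ⟨integral_nonneg_of_ae (hs.mono fun u hu => hu.1), ?_⟩
  have hi : Integrable (fun u : ℝ => u) (𝓜.rewardLaw x a) :=
    Integrable.of_mem_Icc 0 1 aemeasurable_id hs
  calc 𝓜.r x a ≤ ∫ _, (1 : ℝ) ∂(𝓜.rewardLaw x a) :=
        integral_mono_ae hi (integrable_const _) (hs.mono fun u hu => hu.2)
    _ = 1 := by simp

lemma rewardVar_nonneg {S A : Type*} [Fintype S] (𝓜 : MDP S A) (x : S) (a : A) : 0 ≤ 𝓜.rewardVar x a :=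
  variance_nonneg _ _

variable {S A : Type*} [Fintype S] [Fintype A] [DecidableEq S] [DecidableEq A]

lemma law_nonneg (𝓜 : MDP S A) (π : ℕ → S → A) (h : ℕ) (x : S) (a : A) (j : ℕ) (y : S) (b : A) :
    0 ≤ 𝓜.law π h x a j y b := by
  induction j generalizing y b with
  | zero => simp only [law]; split_ifs <;> norm_num
  | succ j ih =>
    simp only [law]
    split_ifs
    · exact Finset.sum_nonneg fun z _ => Finset.sum_nonneg fun c _ =>
        mul_nonneg (ih z c) ((𝓜.p_mem z c).1 y)
    · exact le_rfl

/-- First-step decomposition of the law of the process. -/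
lemma law_succ (𝓜 : MDP S A) (π : ℕ → S → A) (h : ℕ) (x : S) (a : A) (j : ℕ) (y : S) (b : A) :
    𝓜.law π h x a (j + 1) y b
      = ∑ z, 𝓜.p x a z * 𝓜.law π (h + 1) z (π (h + 1) z) j y b := by
  -- `law` recurses on the last step of the process, while the Bellman equation conditions on the
  -- first.
  induction j generalizing y b with
  | zero =>
    simp only [law, Nat.zero_add, ite_and, ite_mul, one_mul, zero_mul, mul_ite, mul_one, mul_zero]
    by_cases hb : b = π (h + 1) y
    · subst hb; simp
    · rw [if_neg hb]
      symm
      refine Finset.sum_eq_zero fun z _ => ?_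
      by_cases hz : y = z
      · subst hz; simp [hb]
      · simp [hz]
  | succ j ih =>
    rw [law]
    simp only [ih]
    have hidx : h + (j + 1 + 1) = h + 1 + (j + 1) := by ring
    rw [hidx]
    have hR : ∀ z, 𝓜.law π (h + 1) z (π (h + 1) z) (j + 1) y b
        = if b = π (h + 1 + (j + 1)) y then
            ∑ w, ∑ c, 𝓜.law π (h + 1) z (π (h + 1) z) j w c * 𝓜.p w c y else 0 := fun z => rfl
    simp only [hR]
    by_cases hb : b = π (h + 1 + (j + 1)) y
    · simp only [hb, if_true, Finset.sum_mul, Finset.mul_sum]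
      rw [Finset.sum_congr rfl fun w _ => Finset.sum_comm, Finset.sum_comm]
      exact Finset.sum_congr rfl fun z _ => Finset.sum_congr rfl fun w _ =>
        Finset.sum_congr rfl fun c _ => by ring
    · simp [hb]

lemma rolloutSum_of_lt (𝓜 : MDP S A) (π : ℕ → S → A) (f : S → A → ℝ) {h : ℕ} (hh : 𝓜.H < h)
    (x : S) (a : A) : 𝓜.rolloutSum π f h x a = 0 := by
  simp [rolloutSum, Finset.Icc_eq_empty_of_lt hh]

/-- The Bellman equation for expected cumulative sums. -/
lemma rolloutSum_eq (𝓜 : MDP S A) (π : ℕ → S → A) (f : S → A → ℝ) {h : ℕ} (hh : h ≤ 𝓜.H)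
    (x : S) (a : A) :
    𝓜.rolloutSum π f h x a
      = f x a + mean (𝓜.p x a) (fun y => 𝓜.rolloutSum π f (h + 1) y (π (h + 1) y)) := by
  unfold rolloutSum mean
  rw [← Finset.add_sum_Ioc_eq_sum_Icc hh]
  congr 1
  · simp [law, ite_and]
  · rw [show Finset.Ioc h 𝓜.H = Finset.Icc (h + 1) 𝓜.H by ext; simp]
    simp only [Finset.mul_sum]
    conv_rhs => rw [Finset.sum_comm]
    refine Finset.sum_congr rfl fun t ht => ?_
    obtain ⟨j, rfl⟩ := Nat.exists_eq_add_of_le (Finset.mem_Icc.mp ht).1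
    rw [show h + 1 + j - h = j + 1 by omega, show h + 1 + j - (h + 1) = j by omega]
    simp only [law_succ, Finset.sum_mul]
    rw [Finset.sum_congr rfl fun w _ => Finset.sum_comm, Finset.sum_comm]
    exact Finset.sum_congr rfl fun z _ => Finset.sum_congr rfl fun w _ =>
      Finset.sum_congr rfl fun c _ => by ring

lemma rolloutSum_nonneg (𝓜 : MDP S A) (π : ℕ → S → A) {f : S → A → ℝ} (hf : ∀ x a, 0 ≤ f x a)
    (h : ℕ) (x : S) (a : A) : 0 ≤ 𝓜.rolloutSum π f h x a :=
  Finset.sum_nonneg fun _ _ => Finset.sum_nonneg fun y _ => Finset.sum_nonneg fun b _ =>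
    mul_nonneg (𝓜.law_nonneg π h x a _ y b) (hf y b)

lemma value_of_lt (𝓜 : MDP S A) (π : ℕ → S → A) {h : ℕ} (hh : 𝓜.H < h) (x : S) :
    𝓜.value π h x = 0 :=
  𝓜.rolloutSum_of_lt π _ hh x _

lemma value_eq (𝓜 : MDP S A) (π : ℕ → S → A) {h : ℕ} (hh : h ≤ 𝓜.H) (x : S) :
    𝓜.value π h x = 𝓜.r x (π h x) + mean (𝓜.p x (π h x)) (𝓜.value π (h + 1)) :=
  𝓜.rolloutSum_eq π _ hh x _

lemma value_nonneg (𝓜 : MDP S A) (π : ℕ → S → A) (h : ℕ) (x : S) : 0 ≤ 𝓜.value π h x :=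
  𝓜.rolloutSum_nonneg π (fun x a => (𝓜.r_mem x a).1) h x _

lemma value_le (𝓜 : MDP S A) (π : ℕ → S → A) (h : ℕ) (x : S) :
    𝓜.value π h x ≤ ((𝓜.H + 1 - h : ℕ) : ℝ) := by
  obtain hh | hh := Nat.lt_or_ge 𝓜.H h
  · rw [𝓜.value_of_lt π hh]; positivity
  · obtain ⟨d, hd⟩ := Nat.exists_eq_add_of_le hh
    induction d generalizing h x with
    | zero =>
      rw [𝓜.value_eq π hh]
      have h0 : mean (𝓜.p x (π h x)) (𝓜.value π (h + 1)) ≤ 0 :=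
        mean_le (𝓜.p_mem _ _) fun y => (𝓜.value_of_lt π (by omega) y).le
      rw [show 𝓜.H + 1 - h = 1 by omega]
      push_cast
      linarith [(𝓜.r_mem x (π h x)).2]
    | succ d ih =>
      rw [𝓜.value_eq π hh]
      have h0 : mean (𝓜.p x (π h x)) (𝓜.value π (h + 1)) ≤ ((𝓜.H + 1 - (h + 1) : ℕ) : ℝ) :=
        mean_le (𝓜.p_mem _ _) fun y => ih (h + 1) y (by omega) (by omega)
      rw [show 𝓜.H + 1 - h = (𝓜.H + 1 - (h + 1)) + 1 by omega]
      push_cast at h0 ⊢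
      linarith [(𝓜.r_mem x (π h x)).2]

/-- Without boundedness the real supremum in `optValue` would default to `0`. -/
lemma bddAbove_value (𝓜 : MDP S A) (h : ℕ) (x : S) :
    BddAbove (Set.range fun π : ℕ → S → A => 𝓜.value π h x) :=
  ⟨_, by rintro _ ⟨π, rfl⟩; exact 𝓜.value_le π h x⟩

lemma value_le_optValue (𝓜 : MDP S A) (π : ℕ → S → A) (h : ℕ) (x : S) :
    𝓜.value π h x ≤ 𝓜.optValue h x :=
  le_ciSup (𝓜.bddAbove_value h x) π

lemma optValue_le [Nonempty A] (𝓜 : MDP S A) {h : ℕ} {x : S} {c : ℝ}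
    (hc : ∀ π, 𝓜.value π h x ≤ c) : 𝓜.optValue h x ≤ c :=
  ciSup_le hc

end MDP

/-! ### Elementary bounds on the logarithm and the exponential -/

section Elementary

/-- On `[-1/2, 0]` the difference of the two sides increases up to `-3/8` and then decreases to `0`,
so only the endpoint `-1/2` matters. There it equals `7/10 - log 2 > 0`, which is why `4/5`
suffices. -/
lemma sub_le_log_one_add {u : ℝ} (hu : -(1 / 2) ≤ u) :
    u - 4 / 5 * u ^ 2 ≤ Real.log (1 + u) := by
  obtain h0 | h0 := le_total 0 u
  · refine le_trans ?_ (Real.le_log_one_add_of_nonneg h0)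
    rw [le_div_iff₀ (by linarith)]
    nlinarith [pow_nonneg h0 2, pow_nonneg h0 3]
  · have hd : ∀ x : ℝ, -1 < x → HasDerivAt (fun x => Real.log (1 + x) - x + 4 / 5 * x ^ 2)
        (x * (3 / 5 + 8 / 5 * x) / (1 + x)) x := by
      intro x hx
      have hx' : 1 + x ≠ 0 := by linarith
      have h1 := ((((hasDerivAt_id x).const_add 1).log hx').sub (hasDerivAt_id x)).add
        (((hasDerivAt_id x).pow 2).const_mul (4 / 5))
      refine h1.congr_deriv ?_
      simp only [id]
      field_simp
      ring
    obtain h1 | h1 := le_total (-(3 / 8)) u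
    · have hanti : AntitoneOn (fun x => Real.log (1 + x) - x + 4 / 5 * x ^ 2)
          (Set.Icc (-(3 / 8)) 0) := by
        refine antitoneOn_of_deriv_nonpos (convex_Icc _ _) ?_ ?_ ?_
        · exact fun x hx => (hd x (by linarith [hx.1])).continuousAt.continuousWithinAt
        · rw [interior_Icc]
          exact fun x hx => (hd x (by linarith [hx.1])).differentiableAt.differentiableWithinAt
        · rw [interior_Icc]
          intro x hx
          rw [(hd x (by linarith [hx.1])).deriv]
          exact div_nonpos_of_nonpos_of_nonneg
            (mul_nonpos_of_nonpos_of_nonneg hx.2.le (by linarith [hx.1])) (by linarith [hx.1])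
      have := hanti (Set.mem_Icc.2 ⟨h1, h0⟩) (Set.mem_Icc.2 ⟨by norm_num, le_rfl⟩) h0
      simp only [add_zero, Real.log_one] at this
      linarith
    · have hmono : MonotoneOn (fun x => Real.log (1 + x) - x + 4 / 5 * x ^ 2)
          (Set.Icc (-(1 / 2)) (-(3 / 8))) := by
        refine monotoneOn_of_deriv_nonneg (convex_Icc _ _) ?_ ?_ ?_
        · exact fun x hx => (hd x (by linarith [hx.1])).continuousAt.continuousWithinAt
        · rw [interior_Icc]
          exact fun x hx => (hd x (by linarith [hx.1])).differentiableAt.differentiableWithinAt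
        · rw [interior_Icc]
          intro x hx
          rw [(hd x (by linarith [hx.1])).deriv]
          exact div_nonneg (mul_nonneg_of_nonpos_of_nonpos (by linarith [hx.2])
            (by linarith [hx.2])) (by linarith [hx.1])
      have := hmono (Set.mem_Icc.2 ⟨le_rfl, by norm_num⟩) (Set.mem_Icc.2 ⟨hu, h1⟩) hu
      have h2 : Real.log (1 + -(1 / 2)) = -Real.log 2 := by
        rw [← Real.log_inv]; norm_num
      simp only [h2] at this
      nlinarith [Real.log_two_lt_d9]

/-- The product of `1 + u + u²/2` and `1 - u + u²/2` is `1 + u⁴/4`. -/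
lemma exp_neg_le {u : ℝ} (hu : 0 ≤ u) : Real.exp (-u) ≤ 1 - u + u ^ 2 / 2 := by
  have h := Real.quadratic_le_exp_of_nonneg hu
  have hp : 0 < 1 + u + u ^ 2 / 2 := by positivity
  rw [Real.exp_neg]
  calc (Real.exp u)⁻¹ ≤ (1 + u + u ^ 2 / 2)⁻¹ := inv_anti₀ hp h
    _ ≤ 1 - u + u ^ 2 / 2 := by
      rw [inv_le_iff_one_le_mul₀ hp]
      nlinarith [sq_nonneg (u ^ 2)]

lemma exp_le_one_add_add_sq {u : ℝ} (h0 : 0 ≤ u) (h1 : u ≤ 1) :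
    Real.exp u ≤ 1 + u + u ^ 2 := by
  have := (abs_le.1 (Real.abs_exp_sub_one_sub_id_le (x := u) (by rw [abs_of_nonneg h0]; exact h1))).2
  linarith

lemma exp_le_one_add_two_mul {u : ℝ} (h0 : 0 ≤ u) (h1 : u ≤ 1) :
    Real.exp u ≤ 1 + 2 * u := by
  nlinarith [exp_le_one_add_add_sq h0 h1]

end Elementary

/-! ### Empirical Bernstein inequality by betting -/

section Betting

variable {ι : Type*} {I : Finset ι} {ξ : ι → ℝ} {n : ℕ} {K : ℝ}

/-- A bound on the wealth of a gambler betting a constant fraction bounds the empirical mean by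
the empirical second moment. -/
lemma mean_le_of_wealth_le (hξ : ∀ i ∈ I, |ξ i| ≤ 1) (hn : 2 ≤ n) (hI : I.card = n)
    {lam : ℝ} (hl0 : 0 < lam) (hl : lam ≤ 1 / 2) (hw : ∏ i ∈ I, (1 + lam * ξ i) ≤ n * K) :
    lam * ((∑ i ∈ I, ξ i) / n)
      ≤ 4 / 5 * lam ^ 2 * ((∑ i ∈ I, ξ i ^ 2) / n) + Real.log (n * K) / n := by
  have hnpos : (0 : ℝ) < n := by exact_mod_cast (by omega : 0 < n)
  have hu : ∀ i ∈ I, -(1 / 2) ≤ lam * ξ i := fun i hi => by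
    nlinarith [(abs_le.1 (hξ i hi)).1]
  have h1 : ∑ i ∈ I, (lam * ξ i - 4 / 5 * (lam * ξ i) ^ 2)
      ≤ Real.log (∏ i ∈ I, (1 + lam * ξ i)) := by
    rw [Real.log_prod fun i hi => by linarith [hu i hi]]
    exact Finset.sum_le_sum fun i hi => sub_le_log_one_add (hu i hi)
  have h2 : Real.log (∏ i ∈ I, (1 + lam * ξ i)) ≤ Real.log (n * K) :=
    Real.log_le_log (Finset.prod_pos fun i hi => by linarith [hu i hi]) hw
  have h3 : ∑ i ∈ I, (lam * ξ i - 4 / 5 * (lam * ξ i) ^ 2)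
      = lam * (∑ i ∈ I, ξ i) - 4 / 5 * lam ^ 2 * ∑ i ∈ I, ξ i ^ 2 := by
    rw [Finset.sum_sub_distrib, Finset.mul_sum, Finset.mul_sum]
    congr 1
    exact Finset.sum_congr rfl fun i _ => by ring
  rw [h3] at h1
  have h4 := (div_le_div_iff_of_pos_right hnpos).2 (h1.trans h2)
  rw [sub_div, mul_div_assoc, mul_div_assoc] at h4
  linarith

/-- Empirical Bernstein bound from wealth bounds for a geometric grid of betting fractions. -/
lemma empirical_bernstein (hξ : ∀ i ∈ I, |ξ i| ≤ 1) (hn : 2 ≤ n) (hI : I.card = n) (hK : 4 ≤ K)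
    (hw : ∀ j : ℕ, ∏ i ∈ I, (1 + 1 / 2 ^ (j + 1) * ξ i) ≤ 2 ^ (j + 1) * K) :
    (∑ i ∈ I, ξ i) / n
      ≤ 2 * √(((∑ i ∈ I, ξ i ^ 2) / n - ((∑ i ∈ I, ξ i) / n) ^ 2) * (Real.log (n * K) / n))
        + 16 / 3 * (Real.log (n * K) / n) := by
  have hnpos : (0 : ℝ) < n := by exact_mod_cast (by omega : 0 < n)
  have hn2 : (2 : ℝ) ≤ n := by exact_mod_cast hn
  have hstep : ∀ j : ℕ, 2 ^ (j + 1) ≤ n → _ := fun j hj =>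
    mean_le_of_wealth_le (lam := 1 / 2 ^ (j + 1)) hξ hn hI (by positivity)
      (by
        rw [one_div, one_div]
        refine inv_anti₀ (by norm_num) ?_
        calc (2 : ℝ) = 2 ^ 1 := by norm_num
          _ ≤ 2 ^ (j + 1) := pow_le_pow_right₀ (by norm_num) (by omega))
      ((hw j).trans (mul_le_mul_of_nonneg_right (by exact_mod_cast hj) (by linarith)))
  -- Here `n * K ≥ 8`; the value `1.6 = 2 · 4/5` is the one needed for `hjn`.
  have hlog : 1.6 ≤ Real.log (n * K) := by
    have h1 : Real.log (2 ^ 3 : ℝ) ≤ Real.log (n * K) :=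
      Real.log_le_log (by norm_num) (by nlinarith)
    rw [Real.log_pow] at h1
    push_cast at h1
    linarith [Real.log_two_gt_d9]
  have ha0 : 0 ≤ (∑ i ∈ I, ξ i ^ 2) / (n : ℝ) :=
    div_nonneg (Finset.sum_nonneg fun i _ => sq_nonneg _) hnpos.le
  have ha1 : (∑ i ∈ I, ξ i ^ 2) / (n : ℝ) ≤ 1 := by
    rw [div_le_one hnpos]
    calc ∑ i ∈ I, ξ i ^ 2 ≤ ∑ _i ∈ I, (1 : ℝ) := Finset.sum_le_sum fun i hi => by
          rw [← sq_abs]; nlinarith [hξ i hi, abs_nonneg (ξ i)]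
      _ = n := by simp [hI]
  have hD1 : (∑ i ∈ I, ξ i) / (n : ℝ) ≤ 1 := by
    rw [div_le_one hnpos]
    calc ∑ i ∈ I, ξ i ≤ ∑ _i ∈ I, (1 : ℝ) := Finset.sum_le_sum fun i hi => (abs_le.1 (hξ i hi)).2
      _ = n := by simp [hI]
  have hen : Real.log (n * K) / n * n = Real.log (n * K) := div_mul_cancel₀ _ hnpos.ne'
  have hepos : 0 < Real.log (n * K) / n := div_pos (by linarith) hnpos
  generalize (∑ i ∈ I, ξ i) / (n : ℝ) = D at *
  generalize (∑ i ∈ I, ξ i ^ 2) / (n : ℝ) = a at *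
  generalize hE : Real.log (n * K) / (n : ℝ) = e at *
  have hs0 : 0 ≤ √((a - D ^ 2) * e) := Real.sqrt_nonneg _
  by_cases hD : D ≤ 16 / 3 * e
  · linarith
  push Not at hD
  -- For the fraction `1/2` the quadratic term is `a / 5`; if it is at most `e`, then `D ≤ 4e`.
  by_cases hsmall : a / 5 ≤ e
  · have := hstep 0 (by simpa using hn)
    norm_num at this
    linarith
  push Not at hsmall
  have hex : ∃ j : ℕ, 4 / 5 * a * (1 / 2 ^ (j + 1)) ^ 2 ≤ 2 * e := by
    obtain ⟨j, hj⟩ := exists_pow_lt_of_lt_one hepos (by norm_num : (1 / 2 : ℝ) < 1)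
    refine ⟨j, ?_⟩
    have h1 : (1 / 2 ^ (j + 1) : ℝ) = 1 / 2 * (1 / 2) ^ j := by rw [pow_succ, one_div_pow]; field_simp
    have h2 : (0 : ℝ) < (1 / 2) ^ j := by positivity
    have h3 : ((1 / 2) ^ j : ℝ) ≤ 1 := pow_le_one₀ (by norm_num) (by norm_num)
    rw [h1]
    nlinarith [mul_nonneg ha0 h2.le]
  classical
  -- The largest dyadic fraction whose quadratic term is at most `2e`. Halving a fraction divides
  -- that term by four, so it is still at least `e / 2`.
  obtain ⟨j, hj, hmin⟩ : ∃ j : ℕ, 4 / 5 * a * (1 / 2 ^ (j + 1)) ^ 2 ≤ 2 * e ∧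
      ∀ i < j, ¬ 4 / 5 * a * (1 / 2 ^ (i + 1)) ^ 2 ≤ 2 * e :=
    ⟨Nat.find hex, Nat.find_spec hex, fun i hi => Nat.find_min hex hi⟩
  have hlow : e / 2 ≤ 4 / 5 * a * (1 / 2 ^ (j + 1)) ^ 2 := by
    cases j with
    | zero => norm_num; linarith
    | succ i =>
      have := hmin i (by omega)
      push Not at this
      have h1 : (1 / 2 ^ (i + 1 + 1) : ℝ) = 1 / 2 * (1 / 2 ^ (i + 1)) := by
        rw [pow_succ (2 : ℝ) (i + 1)]; field_simp
      rw [h1]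
      nlinarith
  -- The fraction is at least `1 / n`, so its threshold `2 ^ (j + 1) * K` is at most `n * K`.
  have hjn : 2 ^ (j + 1) ≤ n := by
    have h2 : (0 : ℝ) < 2 ^ (j + 1) := by positivity
    have h3 : e * (2 ^ (j + 1) : ℝ) ^ 2 ≤ 1.6 := by
      rw [one_div, inv_pow, ← div_eq_mul_inv, le_div_iff₀ (by positivity)] at hlow
      nlinarith
    have h4 : (2 ^ (j + 1) : ℝ) ^ 2 ≤ (n : ℝ) ^ 2 := by
      have h5 : 1.6 / n ≤ e := by rw [← hE]; exact (div_le_div_iff_of_pos_right hnpos).2 hlog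
      have h6 : 1.6 / n * (2 ^ (j + 1) : ℝ) ^ 2 ≤ 1.6 :=
        (mul_le_mul_of_nonneg_right h5 (by positivity)).trans h3
      rw [div_mul_eq_mul_div, div_le_iff₀ hnpos] at h6
      nlinarith
    exact_mod_cast (pow_le_pow_iff_left₀ h2.le hnpos.le two_ne_zero).1 h4
  have hmain := hstep j hjn
  have hlpos : (0 : ℝ) < 1 / 2 ^ (j + 1) := by positivity
  generalize (1 / 2 ^ (j + 1) : ℝ) = l at *
  have hDpos : 0 < D := by linarith
  have hsq : D ^ 2 ≤ 18 / 5 * a * e := by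
    have h1 : (l * D) ^ 2 ≤ (4 / 5 * l ^ 2 * a + e) ^ 2 :=
      pow_le_pow_left₀ (mul_pos hlpos hDpos).le hmain 2
    -- For the quadratic term `t`, `(2e - t)(t - e/2) ≥ 0` says exactly `(t + e)² ≤ 9/2 t e`.
    have h2 : (4 / 5 * l ^ 2 * a + e) ^ 2 ≤ 9 / 2 * ((4 / 5 * l ^ 2 * a) * e) := by
      nlinarith [mul_nonneg (sub_nonneg.2 hj) (sub_nonneg.2 hlow)]
    have h3 : l ^ 2 * D ^ 2 ≤ l ^ 2 * (18 / 5 * a * e) := by nlinarith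
    exact le_of_mul_le_mul_left h3 (by positivity)
  -- Passage from the second moment to the variance. Since `4ae ≥ 10/9 D²`, a margin `D²/9` is left;
  -- the correction `4D²e` is at most `4De` because `D ≤ 1`, and the linear term absorbs it.
  by_contra hcon
  push Not at hcon
  have hk : 4 * ((a - D ^ 2) * e) < (D - 16 / 3 * e) ^ 2 := by
    have h1 : √((a - D ^ 2) * e) < (D - 16 / 3 * e) / 2 := by linarith
    rw [Real.sqrt_lt' (by linarith)] at h1
    nlinarith
  nlinarith [mul_pos hDpos hepos, mul_pos hepos hepos,
    mul_nonneg (mul_nonneg hDpos.le hepos.le) (sub_nonneg.2 hD1)]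

end Betting

/-! ### Consequences of a relative entropy bound -/

section ChangeOfMeasure

variable {S : Type*} [Fintype S] {p q : S → ℝ} {κ : ℝ}

lemma mean_exp_pos (hp : p ∈ stdSimplex ℝ S) (f : S → ℝ) :
    0 < mean p (fun y => Real.exp (f y)) := by
  obtain ⟨y, hy⟩ : ∃ y, 0 < p y := by
    by_contra h
    push Not at h
    have h1 := hp.2
    linarith [Finset.sum_nonpos fun y (_ : y ∈ Finset.univ) => h y]
  exact Finset.sum_pos' (fun z _ => mul_nonneg (hp.1 z) (Real.exp_pos _).le)
    ⟨y, Finset.mem_univ y, mul_pos hy (Real.exp_pos _)⟩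

/-- `hkl` is the Donsker–Varadhan form of `KL(q‖p) ≤ κ`. With `log z ≤ z - 1`, each comparison of
`q` with `p` below reduces to a choice of `f` and an elementary bound on `exp`. -/
lemma mean_le_of_exp_le (hp : p ∈ stdSimplex ℝ S)
    (hkl : ∀ f : S → ℝ, mean q f ≤ Real.log (mean p fun y => Real.exp (f y)) + κ)
    {f g : S → ℝ} (h : ∀ y, Real.exp (f y) ≤ 1 + g y) : mean q f ≤ mean p g + κ := by
  have h1 : mean p (fun y => Real.exp (f y)) ≤ 1 + mean p g :=
    (mean_mono hp.1 h).trans_eq (by rw [mean_add, mean_const hp])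
  have h2 := Real.log_le_sub_one_of_pos (mean_exp_pos hp f)
  linarith [hkl f]

/-- Take `f = Y / B` and `exp u ≤ 1 + 2u` on `[0, 1]`. There is no square root: variances and
squared gaps change measure at the cost of a factor `2` and an additive term. -/
lemma mean_le_two_mul_mean_add (hp : p ∈ stdSimplex ℝ S)
    (hkl : ∀ f : S → ℝ, mean q f ≤ Real.log (mean p fun y => Real.exp (f y)) + κ)
    {B : ℝ} (hB : 0 < B) {Y : S → ℝ} (h0 : ∀ y, 0 ≤ Y y) (h1 : ∀ y, Y y ≤ B) :
    mean q Y ≤ 2 * mean p Y + B * κ := by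
  have h := mean_le_of_exp_le hp hkl (f := fun y => B⁻¹ * Y y) (g := fun y => 2 * (B⁻¹ * Y y))
    fun y => exp_le_one_add_two_mul (mul_nonneg (inv_nonneg.2 hB.le) (h0 y))
      (by rw [inv_mul_le_iff₀ hB, mul_one]; exact h1 y)
  simp only [mean_const_mul] at h
  have h2 := mul_le_mul_of_nonneg_left h hB.le
  have h3 : B * B⁻¹ = 1 := mul_inv_cancel₀ hB.ne'
  calc mean q Y = B * B⁻¹ * mean q Y := by rw [h3, one_mul]
    _ ≤ B * (2 * (B⁻¹ * mean p Y) + κ) := by linarith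
    _ = 2 * (B * B⁻¹) * mean p Y + B * κ := by ring
    _ = _ := by rw [h3, mul_one]

lemma mul_mean_sub_mean_le (hp : p ∈ stdSimplex ℝ S)
    (hkl : ∀ f : S → ℝ, mean q f ≤ Real.log (mean p fun y => Real.exp (f y)) + κ)
    {lam : ℝ} (hl : 0 ≤ lam) {Y : S → ℝ} (h0 : ∀ y, 0 ≤ Y y) (h1 : ∀ y, lam * Y y ≤ 1) :
    lam * (mean q Y - mean p Y) ≤ lam ^ 2 * mean p (fun y => Y y ^ 2) + κ := by
  have h := mean_le_of_exp_le hp hkl (f := fun y => lam * Y y)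
    (g := fun y => lam * Y y + lam ^ 2 * Y y ^ 2)
    fun y => by
      have := exp_le_one_add_add_sq (mul_nonneg hl (h0 y)) (h1 y)
      linarith
  simp only [mean_add, mean_const_mul] at h
  linarith

/-- Underestimation of a nonnegative function needs no upper bound on it, because `exp (-u) ≤ 1 - u
+ u²/2` for all `u ≥ 0`. The factor `d / X` is the optimal multiple of `-Y`. -/
lemma mean_sub_mean_le_sqrt (hp : p ∈ stdSimplex ℝ S) (hq : ∀ y, 0 ≤ q y)
    (hkl : ∀ f : S → ℝ, mean q f ≤ Real.log (mean p fun y => Real.exp (f y)) + κ)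
    {Y : S → ℝ} (h0 : ∀ y, 0 ≤ Y y) :
    mean p Y - mean q Y ≤ √(2 * κ * mean p (fun y => Y y ^ 2)) := by
  obtain hd | hd := le_or_gt (mean p Y - mean q Y) 0
  · exact hd.trans (Real.sqrt_nonneg _)
  have hX : 0 < mean p (fun y => Y y ^ 2) := by
    have h1 : 0 < mean p Y := by linarith [mean_nonneg hq h0]
    nlinarith [sq_mean_le hp Y]
  set X := mean p (fun y => Y y ^ 2)
  set d := mean p Y - mean q Y
  have hl : 0 ≤ d / X := (div_pos hd hX).le
  have h := mean_le_of_exp_le hp hkl (f := fun y => -(d / X) * Y y)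
    (g := fun y => -(d / X) * Y y + (d / X) ^ 2 / 2 * Y y ^ 2)
    fun y => by
      have := exp_neg_le (mul_nonneg hl (h0 y))
      rw [neg_mul]
      linarith
  simp only [mean_add, mean_const_mul] at h
  have h2 : d / X * d ≤ (d / X) ^ 2 / 2 * X + κ := by
    have : d / X * d = d / X * mean p Y - d / X * mean q Y := by rw [← mul_sub]
    rw [this]; linarith
  have h3 : (d / X) ^ 2 / 2 * X = d ^ 2 / X / 2 := by field_simp
  rw [h3, show d / X * d = d ^ 2 / X by ring] at h2
  have h4 : d ^ 2 / X ≤ 2 * κ := by linarith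
  rw [div_le_iff₀ hX] at h4
  exact Real.le_sqrt_of_sq_le h4

/-- The overestimation of the mean of a nonnegative function, in terms of the empirical norm. -/
lemma mean_sub_mean_le_norm2 (hp : p ∈ stdSimplex ℝ S) (hq : ∀ y, 0 ≤ q y) (hκ : 0 ≤ κ)
    (hkl : ∀ f : S → ℝ, mean q f ≤ Real.log (mean p fun y => Real.exp (f y)) + κ)
    {b : ℝ} (hb : 0 ≤ b) {Y : S → ℝ} (h0 : ∀ y, 0 ≤ Y y) (h1 : ∀ y, Y y ≤ b) :
    mean p Y - mean q Y ≤ norm2 q Y * √(2 * κ) + b * (2 * κ) := by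
  have hd := mean_sub_mean_le_sqrt hp hq hkl h0
  -- The norm under `p` is exchanged for the norm under `q` by the same inequality for `Y²`: for
  -- nonnegative numbers, `s² - t² ≤ w s` forces `s ≤ t + w`.
  have hd2 := mean_sub_mean_le_sqrt hp hq hkl (Y := fun y => Y y ^ 2) fun y => sq_nonneg _
  rw [Real.sqrt_mul (by linarith), ← norm2_eq] at hd
  have hX : mean p (fun y => (Y y ^ 2) ^ 2) ≤ (b * norm2 p Y) ^ 2 := by
    rw [mul_pow, norm2_sq hp.1, ← mean_const_mul]
    refine mean_mono hp.1 fun y => ?_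
    rw [sq (Y y ^ 2)]
    exact mul_le_mul_of_nonneg_right (pow_le_pow_left₀ (h0 y) (h1 y) 2) (sq_nonneg _)
  have h2 : √(mean p (fun y => (Y y ^ 2) ^ 2)) ≤ b * norm2 p Y :=
    Real.sqrt_le_iff.2 ⟨mul_nonneg hb (norm2_nonneg _ _), hX⟩
  rw [Real.sqrt_mul (by linarith), ← norm2_sq hp.1, ← norm2_sq hq] at hd2
  have hs : 0 ≤ √(2 * κ) := Real.sqrt_nonneg _
  have hss : √(2 * κ) ^ 2 = 2 * κ := Real.sq_sqrt (by linarith)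
  have h3 : norm2 p Y ^ 2 - norm2 q Y ^ 2 ≤ b * √(2 * κ) * norm2 p Y :=
    hd2.trans (by nlinarith [mul_le_mul_of_nonneg_left h2 hs])
  have hx0 := norm2_nonneg p Y
  have hy0 := norm2_nonneg q Y
  have h4 : norm2 p Y ≤ norm2 q Y + b * √(2 * κ) := by
    by_contra hc
    push Not at hc
    have hw : 0 ≤ b * √(2 * κ) := mul_nonneg hb hs
    nlinarith
  calc mean p Y - mean q Y ≤ √(2 * κ) * norm2 p Y := hd
    _ ≤ √(2 * κ) * (norm2 q Y + b * √(2 * κ)) := mul_le_mul_of_nonneg_left h4 hs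
    _ = norm2 q Y * √(2 * κ) + b * √(2 * κ) ^ 2 := by ring
    _ = _ := by rw [hss]

end ChangeOfMeasure

end StrongEuler

end

noncomputable section

namespace StrongEuler

open scoped ENNReal

/-! ### Ville's inequality and sampling on visits -/

section Ville

variable {Ω : Type*} {m0 : MeasurableSpace Ω} {μ : Measure Ω}

/-- Ville's maximal inequality for nonnegative supermartingales. -/
lemma ville {F : ℕ → MeasurableSpace Ω} (hmono : Monotone F) (hle : ∀ t, F t ≤ m0)
    {W : ℕ → Ω → ℝ≥0∞} (hW : ∀ t, Measurable[F t] (W t)) (h0 : ∫⁻ ω, W 0 ω ∂μ ≤ 1)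
    (hstep : ∀ t E, MeasurableSet[F t] E → ∫⁻ ω in E, W (t + 1) ω ∂μ ≤ ∫⁻ ω in E, W t ω ∂μ)
    (c : ℝ≥0∞) : c * μ {ω | ∃ t, c ≤ W t ω} ≤ 1 := by
  set G : ℕ → Set Ω := fun T => {ω | ∀ s ≤ T, W s ω < c} with hG
  have hmeasW : ∀ s T, s ≤ T → MeasurableSet[F T] {ω | W s ω < c} := fun s T hs =>
    hmono hs _ ((hW s) measurableSet_Iio)
  have hGm : ∀ T, MeasurableSet[F T] (G T) := fun T => by
    have : G T = ⋂ s ∈ Set.Iic T, {ω | W s ω < c} := by ext; simp [hG]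
    rw [this]
    exact @MeasurableSet.biInter _ _ (F T) _ _ (Set.finite_Iic T).countable
      fun s hs => hmeasW s T hs
  -- `G T` is the event of no crossing up to time `T`. The left side bounds from below the
  -- expectation of the process stopped at its first crossing; the induction splits off the
  -- crossings at time `T + 1`.
  have key : ∀ T, ∫⁻ ω in G T, W T ω ∂μ + c * μ (G T)ᶜ ≤ 1 := by
    intro T
    induction T with
    | zero =>
      have hG0 : (G 0)ᶜ = (G 0)ᶜ ∩ {ω | c ≤ W 0 ω} := by
        ext ω; simp [hG]
      have h1 : c * μ (G 0)ᶜ ≤ ∫⁻ ω in (G 0)ᶜ, W 0 ω ∂μ := by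
        rw [← setLIntegral_const]
        refine setLIntegral_mono ((hW 0).mono (hle 0) le_rfl) fun ω hω => ?_
        rw [hG0] at hω; exact hω.2
      calc _ ≤ ∫⁻ ω in G 0, W 0 ω ∂μ + ∫⁻ ω in (G 0)ᶜ, W 0 ω ∂μ := by gcongr
        _ = ∫⁻ ω, W 0 ω ∂μ := lintegral_add_compl _ (hle 0 _ (hGm 0))
        _ ≤ 1 := h0
    | succ T ih =>
      have hsub : G (T + 1) ⊆ G T := fun ω hω s hs => hω s (by omega)
      have hGm' : MeasurableSet (G (T + 1)) := hle _ _ (hGm _)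
      have hGT : MeasurableSet (G T) := hle _ _ (hGm _)
      have hcompl : (G (T + 1))ᶜ = (G T)ᶜ ∪ (G T \ G (T + 1)) := by
        ext ω
        simp only [Set.mem_compl_iff, Set.mem_union, Set.mem_sdiff]
        have := @hsub ω
        tauto
      have hdiff : ∀ ω ∈ G T \ G (T + 1), c ≤ W (T + 1) ω := by
        rintro ω ⟨h1, h2⟩
        by_contra hc
        refine h2 fun s hs => ?_
        obtain hs' | rfl := Nat.le_succ_iff.1 hs
        · exact h1 s hs'
        · exact not_le.1 hc
      have h1 : c * μ (G T \ G (T + 1)) ≤ ∫⁻ ω in G T \ G (T + 1), W (T + 1) ω ∂μ := by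
        rw [← setLIntegral_const]
        exact setLIntegral_mono ((hW _).mono (hle _) le_rfl) hdiff
      have h2 : ∫⁻ ω in G (T + 1), W (T + 1) ω ∂μ + ∫⁻ ω in G T \ G (T + 1), W (T + 1) ω ∂μ
          = ∫⁻ ω in G T, W (T + 1) ω ∂μ := by
        rw [← lintegral_union (hGT.diff hGm') Set.disjoint_sdiff_right,
          Set.union_sdiff_cancel hsub]
      calc _ ≤ ∫⁻ ω in G (T + 1), W (T + 1) ω ∂μ + c * (μ (G T)ᶜ + μ (G T \ G (T + 1))) := by
            rw [hcompl]; gcongr; exact measure_union_le _ _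
        _ = (∫⁻ ω in G (T + 1), W (T + 1) ω ∂μ + c * μ (G T \ G (T + 1))) + c * μ (G T)ᶜ := by
            ring
        _ ≤ (∫⁻ ω in G (T + 1), W (T + 1) ω ∂μ + ∫⁻ ω in G T \ G (T + 1), W (T + 1) ω ∂μ)
            + c * μ (G T)ᶜ := by gcongr
        _ ≤ ∫⁻ ω in G T, W T ω ∂μ + c * μ (G T)ᶜ := by
            rw [h2]; exact add_le_add (hstep T _ (hGm T)) le_rfl
        _ ≤ 1 := ih
  have hU : {ω | ∃ t, c ≤ W t ω} = ⋃ T, (G T)ᶜ := by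
    ext ω
    simp only [hG, Set.mem_ofPred_eq, Set.mem_iUnion, Set.mem_compl_iff, not_forall, not_lt]
    exact ⟨fun ⟨t, ht⟩ => ⟨t, t, le_rfl, ht⟩, fun ⟨_, t, _, ht⟩ => ⟨t, ht⟩⟩
  have hmonoG : Monotone fun T => (G T)ᶜ := fun T T' h =>
    Set.compl_subset_compl.2 fun ω hω s hs => hω s (hs.trans h)
  rw [hU, hmonoG.measure_iUnion, ENNReal.mul_iSup]
  exact iSup_le fun T => le_add_self.trans (key T)

end Ville

/-- Outcomes `ξ t` which, on the event `v t`, have conditional law `ν` given `F t`. -/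
structure IsSampledOn {Ω O : Type*} [m0 : MeasurableSpace Ω] [MeasurableSpace O] (μ : Measure Ω)
    (F : ℕ → MeasurableSpace Ω) (v : ℕ → Set Ω) (ξ : ℕ → Ω → O) (ν : Measure O) : Prop where
  mono : Monotone F
  le : ∀ t, F t ≤ m0
  measurable_visit : ∀ t, MeasurableSet[F t] (v t)
  measurable_outcome : ∀ t, Measurable[F (t + 1)] (ξ t)
  law : ∀ t E B, MeasurableSet[F t] E → E ⊆ v t → MeasurableSet B →
    μ (E ∩ ξ t ⁻¹' B) = μ E * ν B

namespace IsSampledOn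

variable {Ω O : Type*} [m0 : MeasurableSpace Ω] [MeasurableSpace O] {μ : Measure Ω}
  {F : ℕ → MeasurableSpace Ω} {v : ℕ → Set Ω} {ξ : ℕ → Ω → O}
  {ν : Measure O}

/-- `law` is the case where `Z` is an indicator; an equality of trimmed measures extends it to all
`F t`-measurable weights. -/
lemma setLIntegral_preimage (hs : IsSampledOn μ F v ξ ν) {t : ℕ} {Z : Ω → ℝ≥0∞}
    (hZ : Measurable[F t] Z) {B : Set O} (hB : MeasurableSet B) :
    ∫⁻ ω in v t ∩ ξ t ⁻¹' B, Z ω ∂μ = ν B * ∫⁻ ω in v t, Z ω ∂μ := by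
  have hm := hs.le t
  have hξ : Measurable (ξ t) := (hs.measurable_outcome t).mono (hs.le _) le_rfl
  have heq : (μ.restrict (v t ∩ ξ t ⁻¹' B)).trim hm = ν B • (μ.restrict (v t)).trim hm := by
    refine @Measure.ext _ (F t) _ _ fun E hE => ?_
    rw [trim_measurableSet_eq hm hE, Measure.smul_apply, trim_measurableSet_eq hm hE,
      Measure.restrict_apply (hm _ hE), Measure.restrict_apply (hm _ hE), smul_eq_mul,
      ← Set.inter_assoc, hs.law t _ B (hE.inter (hs.measurable_visit t)) Set.inter_subset_right hB,
      mul_comm]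
  rw [← lintegral_trim hm hZ, heq, lintegral_smul_measure, lintegral_trim hm hZ, smul_eq_mul]

/-- The image under `ξ t` of `μ` restricted to the visit, with density `Z`, is a multiple of `ν`;
hence past and outcome factor. -/
lemma setLIntegral_mul (hs : IsSampledOn μ F v ξ ν) {t : ℕ} {Z : Ω → ℝ≥0∞}
    (hZ : Measurable[F t] Z) {f : O → ℝ≥0∞} (hf : Measurable f) :
    ∫⁻ ω in v t, Z ω * f (ξ t ω) ∂μ = (∫⁻ ω in v t, Z ω ∂μ) * ∫⁻ o, f o ∂ν := by
  have hξ : Measurable (ξ t) := (hs.measurable_outcome t).mono (hs.le _) le_rfl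
  have hZ' : Measurable Z := hZ.mono (hs.le t) le_rfl
  have hmap : ((μ.restrict (v t)).withDensity Z).map (ξ t) = (∫⁻ ω in v t, Z ω ∂μ) • ν := by
    refine Measure.ext fun B hB => ?_
    rw [Measure.map_apply hξ hB, withDensity_apply _ (hξ hB), Measure.restrict_restrict (hξ hB),
      Set.inter_comm, hs.setLIntegral_preimage hZ hB, Measure.smul_apply, smul_eq_mul, mul_comm]
  rw [← smul_eq_mul (_ : ℝ≥0∞), ← lintegral_smul_measure, ← hmap, lintegral_map hf hξ,
    lintegral_withDensity_eq_lintegral_mul _ hZ' (g := fun ω => f (ξ t ω)) (hf.comp hξ)]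
  rfl

/-- Absorbs a past event into the visit, so that statements about `v t` localise. -/
lemma mono_visit (hs : IsSampledOn μ F v ξ ν) {w : ℕ → Set Ω}
    (hw : ∀ t, MeasurableSet[F t] (w t)) : IsSampledOn μ F (fun t => w t ∩ v t) ξ ν where
  mono := hs.mono
  le := hs.le
  measurable_visit t := (hw t).inter (hs.measurable_visit t)
  measurable_outcome := hs.measurable_outcome
  law t E B hE hsub hB := hs.law t E B hE (hsub.trans Set.inter_subset_right) hB

lemma setLIntegral_inter_mul_le (hs : IsSampledOn μ F v ξ ν) {t : ℕ} {E : Set Ω}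
    (hE : MeasurableSet[F t] E) {Z : Ω → ℝ≥0∞}
    (hZ : Measurable[F t] Z) {f : O → ℝ≥0∞} (hf : Measurable f) (hf1 : ∫⁻ o, f o ∂ν ≤ 1) :
    ∫⁻ ω in E ∩ v t, Z ω * f (ξ t ω) ∂μ ≤ ∫⁻ ω in E ∩ v t, Z ω ∂μ := by
  have hs' : IsSampledOn μ F (fun s => (if s = t then E else Set.univ) ∩ v s) ξ ν :=
    hs.mono_visit fun s => by
      split_ifs with h
      · subst h; exact hE
      · exact @MeasurableSet.univ _ (F s)
  have := hs'.setLIntegral_mul hZ hf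
  simp only [if_true] at this
  rw [this]
  exact mul_le_of_le_one_right' hf1

/-- A process frozen between visits has to satisfy the supermartingale inequality at visits only. -/
lemma ville_of_visit (hs : IsSampledOn μ F v ξ ν) (hμ : μ Set.univ ≤ 1) {W : ℕ → Ω → ℝ≥0∞}
    (hW : ∀ t, Measurable[F t] (W t)) (h0 : ∀ ω, W 0 ω = 1)
    (hout : ∀ t, ∀ ω ∉ v t, W (t + 1) ω = W t ω)
    (hstep : ∀ t E, MeasurableSet[F t] E →
      ∫⁻ ω in E ∩ v t, W (t + 1) ω ∂μ ≤ ∫⁻ ω in E ∩ v t, W t ω ∂μ) (c : ℝ≥0∞) :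
    c * μ {ω | ∃ t, c ≤ W t ω} ≤ 1 := by
  refine ville hs.mono hs.le hW (by simpa [h0] using hμ) (fun t E hE => ?_) c
  have hv : MeasurableSet (v t) := hs.le t _ (hs.measurable_visit t)
  rw [← lintegral_inter_add_sdiff _ E hv, ← lintegral_inter_add_sdiff (W t) E hv]
  refine add_le_add (hstep t E hE) (le_of_eq ?_)
  exact setLIntegral_congr_fun ((hs.le t _ hE).diff hv) fun ω hω => hout t ω hω.2

/-- Time-uniform tail bound for products of a function of the outcomes over the visits. -/
lemma measure_prod_le (hs : IsSampledOn μ F v ξ ν) (hμ : μ Set.univ ≤ 1)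
    {f : O → ℝ≥0∞} (hf : Measurable f) (hf1 : ∫⁻ o, f o ∂ν ≤ 1) {W : ℕ → Ω → ℝ≥0∞}
    (h0 : ∀ ω, W 0 ω = 1) (hin : ∀ t, ∀ ω ∈ v t, W (t + 1) ω = W t ω * f (ξ t ω))
    (hout : ∀ t, ∀ ω ∉ v t, W (t + 1) ω = W t ω) (c : ℝ≥0∞) :
    c * μ {ω | ∃ t, c ≤ W t ω} ≤ 1 := by
  have hW : ∀ t, Measurable[F t] (W t) := by
    intro t
    induction t with
    | zero => rw [funext h0]; exact @measurable_const _ _ _ (F 0) _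
    | succ t ih =>
      have hle : F t ≤ F (t + 1) := hs.mono t.le_succ
      have hv : MeasurableSet[F (t + 1)] (v t) := hle _ (hs.measurable_visit t)
      have h1 : Measurable[F (t + 1)] (W t) := ih.mono hle le_rfl
      have h2 : W (t + 1) = (v t).indicator (fun ω => W t ω * f (ξ t ω))
          + (v t)ᶜ.indicator (W t) := by
        funext ω
        by_cases hω : ω ∈ v t
        · simp [hω, hin t ω hω]
        · simp [hω, hout t ω hω]
      rw [h2]
      exact ((h1.mul (hf.comp (hs.measurable_outcome t))).indicator hv).add
        (h1.indicator (MeasurableSet.compl hv))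
  refine hs.ville_of_visit hμ hW h0 hout (fun t E hE => ?_) c
  rw [setLIntegral_congr_fun ((hs.le t _ hE).inter (hs.le t _ (hs.measurable_visit t)))
    fun ω hω => hin t ω hω.2]
  exact hs.setLIntegral_inter_mul_le hE (hW t) hf hf1

/-- Time-uniform tail bound for likelihood ratios of predictable estimates of the law. -/
lemma measure_likelihood_le [Fintype O] [MeasurableSingletonClass O]
    (hs : IsSampledOn μ F v ξ ν) (hμ : μ Set.univ ≤ 1) {W : ℕ → Ω → ℝ≥0∞}
    {w : ℕ → O → Ω → ℝ≥0∞} (hW : ∀ t, Measurable[F t] (W t))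
    (hw : ∀ t y, Measurable[F t] (w t y)) (hw1 : ∀ t ω, ∑ y, w t y ω ≤ 1)
    (h0 : ∀ ω, W 0 ω = 1)
    (hin : ∀ t, ∀ ω ∈ v t, W (t + 1) ω = W t ω * (w t (ξ t ω) ω * (ν {ξ t ω})⁻¹))
    (hout : ∀ t, ∀ ω ∉ v t, W (t + 1) ω = W t ω) (c : ℝ≥0∞) :
    c * μ {ω | ∃ t, c ≤ W t ω} ≤ 1 := by
  classical
  refine hs.ville_of_visit hμ hW h0 hout (fun t E hE => ?_) c
  have hEv := (hs.le t _ hE).inter (hs.le t _ (hs.measurable_visit t))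
  have hξ : Measurable (ξ t) := (hs.measurable_outcome t).mono (hs.le _) le_rfl
  set f : O → O → ℝ≥0∞ := fun y => Set.indicator {y} fun _ => (ν {y})⁻¹ with hfdef
  have hf : ∀ y, Measurable (f y) := fun y => measurable_const.indicator (measurableSet_singleton y)
  have hf1 : ∀ y, ∫⁻ o, f y o ∂ν ≤ 1 := fun y => by
    rw [lintegral_indicator (measurableSet_singleton y), setLIntegral_const, mul_comm]
    -- Only an inequality: for `ν {y} = 0` the inverse is `∞` and the product is `0`.
    exact ENNReal.mul_inv_le_one _
  have hZ : ∀ y, Measurable[F t] (fun ω => W t ω * w t y ω) := fun y => (hW t).mul (hw t y)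
  -- Summing over the possible outcomes makes each summand a predictable weight times a function of
  -- the outcome.
  calc ∫⁻ ω in E ∩ v t, W (t + 1) ω ∂μ
      = ∫⁻ ω in E ∩ v t, ∑ y, W t ω * w t y ω * f y (ξ t ω) ∂μ := by
        refine setLIntegral_congr_fun hEv fun ω hω => ?_
        simp only [hin t ω hω.2, hfdef]
        rw [Finset.sum_eq_single (ξ t ω)]
        · simp [mul_assoc]
        · intro y _ hy
          simp [Set.indicator, hy.symm]
        · simp
    _ = ∑ y, ∫⁻ ω in E ∩ v t, W t ω * w t y ω * f y (ξ t ω) ∂μ :=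
        lintegral_finsetSum _ fun y _ => ((hZ y).mono (hs.le t) le_rfl).mul ((hf y).comp hξ)
    _ ≤ ∑ y, ∫⁻ ω in E ∩ v t, W t ω * w t y ω ∂μ :=
        Finset.sum_le_sum fun y _ => hs.setLIntegral_inter_mul_le hE (hZ y) (hf y) (hf1 y)
    _ = ∫⁻ ω in E ∩ v t, W t ω * ∑ y, w t y ω ∂μ := by
        rw [← lintegral_finsetSum _ fun y _ => (hZ y).mono (hs.le t) le_rfl]
        simp only [Finset.mul_sum]
    _ ≤ ∫⁻ ω in E ∩ v t, W t ω ∂μ :=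
        lintegral_mono fun ω => mul_le_of_le_one_right' (hw1 t ω)

end IsSampledOn

end StrongEuler

end

noncomputable section

namespace StrongEuler

open scoped ENNReal

/-! ### From the interaction to samples at visits -/

section Interaction

/-- Since the conditional probability is constant on `E`, integrating it over `E` gives the product
rule that `IsSampledOn` asks for. -/
lemma measure_inter_of_condExp_eq {Ω : Type*} {m m0 : MeasurableSpace Ω}
    {μ : Measure Ω} [IsProbabilityMeasure μ] (hm : m ≤ m0) {T E : Set Ω}
    (hT : MeasurableSet T) (hE : MeasurableSet[m] E) {g : Ω → ℝ} {c : ℝ}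
    (hg : μ[T.indicator (fun _ => (1 : ℝ)) | m] =ᵐ[μ] g) (hgc : ∀ ω ∈ E, g ω = c) :
    μ (E ∩ T) = μ E * ENNReal.ofReal c := by
  have hE' := hm _ hE
  have h1 : ∫ ω in E, T.indicator (fun _ => (1 : ℝ)) ω ∂μ = μ.real E * c := by
    rw [← setIntegral_condExp hm ((integrable_const _).indicator hT) hE,
      setIntegral_congr_ae hE' (hg.mono fun ω h _ => h), setIntegral_congr_fun hE' hgc]
    simp
  rw [setIntegral_indicator hT] at h1
  simp only [integral_const, smul_eq_mul, mul_one, MeasurableSet.univ, measureReal_restrict_apply,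
    Set.univ_inter] at h1
  rw [← ofReal_measureReal (μ := μ) (s := E ∩ T), h1, ENNReal.ofReal_mul measureReal_nonneg,
    ofReal_measureReal]

variable {S A Ω : Type*}

/-- The history before the outcome of the `t`-th action overall (counting from `0`). -/
@[reducible]
def flatHistory (H : ℕ) (D : Ω → Transcript S A) (t : ℕ) : MeasurableSpace Ω :=
  history H D (t / H + 1) (t % H + 1)

/-- The event that the `t`-th action overall visits `(x, a)`. -/
def visitEvent (H : ℕ) (D : Ω → Transcript S A) (x : S) (a : A) (t : ℕ) : Set Ω :=
  {ω | (D ω).X (t / H + 1) (t % H + 1) = x ∧ (D ω).action (t / H + 1) (t % H + 1) = a}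

/-- The bound on `h` matters when the episode changes: a past episode records only the states up to
stage `H + 1`. -/
lemma history_mono {H k h k' h' : ℕ} (D : Ω → Transcript S A) (hh : h ≤ H + 1)
    (hlt : k < k' ∨ (k = k' ∧ h ≤ h')) : history H D k h ≤ history H D k' h' := by
  refine MeasurableSpace.generateFrom_mono ?_
  rintro E ((⟨j, t, x, a, h1, h2, h3, h4, rfl⟩ | ⟨j, t, x, h1, h2, h3, rfl⟩) |
    ⟨j, t, B, h1, h2, h3, h4, rfl⟩)
  · exact Or.inl (Or.inl ⟨j, t, x, a, h1, by omega, h3, h4, rfl⟩)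
  · exact Or.inl (Or.inr ⟨j, t, x, h1, h2, by omega, rfl⟩)
  · exact Or.inr ⟨j, t, B, h1, h2, by omega, h4, rfl⟩

lemma measurableSet_history_X {H k h j t : ℕ} (D : Ω → Transcript S A) (hj : 1 ≤ j) (ht : 1 ≤ t)
    (hjt : (j < k ∧ t ≤ H + 1) ∨ (j = k ∧ t ≤ h)) (x : S) :
    MeasurableSet[history H D k h] {ω | (D ω).X j t = x} :=
  MeasurableSpace.measurableSet_generateFrom (Or.inl (Or.inr ⟨j, t, x, hj, ht, hjt, rfl⟩))

lemma measurable_history_rew {H k h j t : ℕ} (D : Ω → Transcript S A) (hj : 1 ≤ j) (ht : 1 ≤ t)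
    (hjt : (j < k ∧ t ≤ H) ∨ (j = k ∧ t < h)) :
    Measurable[history H D k h] fun ω => (D ω).rew j t := fun B hB =>
  MeasurableSpace.measurableSet_generateFrom (Or.inr ⟨j, t, B, hj, ht, hjt, hB, rfl⟩)

lemma flatHistory_mono {H : ℕ} (hH : 1 ≤ H) (D : Ω → Transcript S A) :
    Monotone (flatHistory H D) := by
  refine fun s t hst => history_mono D (by have := Nat.mod_lt s hH; omega) ?_
  have h1 := Nat.div_le_div_right (c := H) hst
  obtain h2 | h2 := Nat.lt_or_eq_of_le h1
  · exact Or.inl (by omega)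
  · refine Or.inr ⟨by omega, ?_⟩
    have h3 := Nat.div_add_mod s H
    have h4 := Nat.div_add_mod t H
    rw [h2] at h3
    omega

/-- Either the episode continues or a new one starts; in both cases the outcome of the present
action belongs to the next history. -/
lemma succ_div_mod {H : ℕ} (hH : 1 ≤ H) (t : ℕ) :
    ((t + 1) / H = t / H ∧ (t + 1) % H = t % H + 1) ∨
      (t % H + 1 = H ∧ (t + 1) / H = t / H + 1) := by
  have h3 := Nat.div_add_mod t H
  have hlt := Nat.mod_lt t hH
  obtain h | h := Nat.lt_or_ge (t % H + 1) H
  · left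
    have : t + 1 = (t % H + 1) + H * (t / H) := by omega
    rw [this, Nat.add_mul_div_left _ _ hH, Nat.add_mul_mod_self_left, Nat.div_eq_of_lt h,
      Nat.mod_eq_of_lt h]
    simp
  · right
    refine ⟨by omega, ?_⟩
    have : t + 1 = H * (t / H + 1) := by rw [mul_add]; omega
    rw [this, Nat.mul_div_cancel_left _ hH]

lemma measurableSet_visitEvent {H : ℕ} (hH : 1 ≤ H) (D : Ω → Transcript S A) (x : S) (a : A)
    (t : ℕ) : MeasurableSet[flatHistory H D t] (visitEvent H D x a t) := by
  have hlt := Nat.mod_lt t hH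
  -- The action is the policy at a random state; on `X = x` it is the policy at a fixed state.
  have : visitEvent H D x a t = {ω | (D ω).X (t / H + 1) (t % H + 1) = x} ∩
      {ω | (D ω).pol (t / H + 1) (t % H + 1) x = a} := by
    ext ω
    simp only [visitEvent, Transcript.action, Set.mem_ofPred_eq, Set.mem_inter_iff]
    constructor
    · rintro ⟨h1, h2⟩; exact ⟨h1, h1 ▸ h2⟩
    · rintro ⟨h1, h2⟩; exact ⟨h1, by rw [h1]; exact h2⟩
  rw [this]
  exact MeasurableSet.inter
    (measurableSet_history_X D (Nat.le_add_left 1 _) (Nat.le_add_left 1 _) (Or.inr ⟨rfl, le_rfl⟩) x)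
    (MeasurableSpace.measurableSet_generateFrom
      (Or.inl (Or.inl ⟨_, _, x, a, Nat.le_add_left 1 _, le_rfl, by omega, by omega, rfl⟩)))

variable [Fintype S] [m0 : MeasurableSpace Ω] {μ : Measure Ω} {𝓜 : MDP S A}
  {D : Ω → Transcript S A}

lemma IsInteraction.history_le (hI : IsInteraction 𝓜 μ D) (k h : ℕ) :
    history 𝓜.H D k h ≤ m0 := by
  refine MeasurableSpace.generateFrom_le ?_
  rintro E ((⟨j, t, x, a, h1, h2, h3, h4, rfl⟩ | ⟨j, t, x, h1, h2, h3, rfl⟩) |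
    ⟨j, t, B, h1, h2, h3, h4, rfl⟩)
  · exact hI.measurable_pol _ _ _ _
  · exact hI.measurable_X _ _ _
  · exact hI.measurable_rew _ _ h4

variable [IsProbabilityMeasure μ]

/-- At the visits to `(x, a)`, rewards are samples of `R(x, a)`. -/
lemma IsInteraction.isSampledOn_rew (hI : IsInteraction 𝓜 μ D) (hH : 1 ≤ 𝓜.H) (x : S) (a : A) :
    IsSampledOn μ (flatHistory 𝓜.H D) (visitEvent 𝓜.H D x a)
      (fun t ω => (D ω).rew (t / 𝓜.H + 1) (t % 𝓜.H + 1)) (𝓜.rewardLaw x a) where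
  mono := flatHistory_mono hH D
  le t := hI.history_le _ _
  measurable_visit := measurableSet_visitEvent hH D x a
  measurable_outcome t := measurable_history_rew D (Nat.le_add_left 1 _) (Nat.le_add_left 1 _) (by
    have := succ_div_mod hH t
    have := Nat.mod_lt t hH
    omega)
  law t E B hE hsub hB := by
    have := 𝓜.rewardLaw_prob x a
    have hlt := Nat.mod_lt t hH
    rw [measure_inter_of_condExp_eq (T := (fun ω => (D ω).rew (t / 𝓜.H + 1) (t % 𝓜.H + 1)) ⁻¹' B)
      (hI.history_le _ _) (hI.measurable_rew _ _ hB) hE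
      (hI.reward (t / 𝓜.H + 1) (Nat.le_add_left 1 _) (t % 𝓜.H + 1) (Finset.mem_Icc.2 (by omega)) B hB)
      fun ω hω => by rw [(hsub hω).1, (hsub hω).2], ofReal_measureReal]

/-- The transition law `p(· | x, a)` as a measure. -/
def transitionMeasure (𝓜 : MDP S A) (x : S) (a : A) : @Measure S ⊤ :=
  @Measure.sum S S ⊤ fun y => ENNReal.ofReal (𝓜.p x a y) • @Measure.dirac S ⊤ y

lemma lintegral_transitionMeasure (𝓜 : MDP S A) (x : S) (a : A) (f : S → ℝ≥0∞) :
    @lintegral S ⊤ (transitionMeasure 𝓜 x a) f = ∑ y, ENNReal.ofReal (𝓜.p x a y) * f y := by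
  let _ : MeasurableSpace S := ⊤
  rw [transitionMeasure, lintegral_sum_measure, tsum_fintype]
  refine Finset.sum_congr rfl fun y _ => ?_
  rw [lintegral_smul_measure, lintegral_dirac, smul_eq_mul]

lemma transitionMeasure_apply (𝓜 : MDP S A) (x : S) (a : A) (B : Set S) :
    transitionMeasure 𝓜 x a B = ∑ y, ENNReal.ofReal (𝓜.p x a y) * B.indicator 1 y := by
  let _ : MeasurableSpace S := ⊤
  rw [← lintegral_transitionMeasure, lintegral_indicator_one MeasurableSpace.measurableSet_top]

/-- At the visits to `(x, a)`, next states are samples of `p(· | x, a)`. -/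
lemma IsInteraction.isSampledOn_next (hI : IsInteraction 𝓜 μ D) (hH : 1 ≤ 𝓜.H) (x : S) (a : A) :
    @IsSampledOn Ω S m0 ⊤ μ (flatHistory 𝓜.H D) (visitEvent 𝓜.H D x a)
      (fun t ω => (D ω).X (t / 𝓜.H + 1) (t % 𝓜.H + 1 + 1)) (transitionMeasure 𝓜 x a) := by
  let _ : MeasurableSpace S := ⊤
  refine ⟨flatHistory_mono hH D, fun t => hI.history_le _ _, measurableSet_visitEvent hH D x a,
    fun t => ?_, fun t E B hE hsub _ => ?_⟩
  · refine @measurable_to_countable' S Ω _ _ (flatHistory 𝓜.H D (t + 1)) _ fun y => ?_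
    exact measurableSet_history_X D (Nat.le_add_left 1 _) (Nat.le_add_left 1 _) (by
      have := succ_div_mod hH t
      have := Nat.mod_lt t hH
      omega) y
  · have hlt := Nat.mod_lt t hH
    -- `transition` speaks of single next states; a set of them is a finite disjoint union.
    have hpre : E ∩ (fun ω => (D ω).X (t / 𝓜.H + 1) (t % 𝓜.H + 1 + 1)) ⁻¹' B
        = ⋃ y ∈ B.toFinite.toFinset, E ∩ {ω | (D ω).X (t / 𝓜.H + 1) (t % 𝓜.H + 1 + 1) = y} := by
      ext ω; simp
    rw [hpre, measure_biUnion_finset]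
    · rw [transitionMeasure_apply, Finset.mul_sum, ← Finset.sum_subset (Finset.subset_univ _)]
      · refine Finset.sum_congr rfl fun y hy => ?_
        rw [measure_inter_of_condExp_eq (hI.history_le _ _) (hI.measurable_X _ _ y) hE
          (hI.transition (t / 𝓜.H + 1) (Nat.le_add_left 1 _) (t % 𝓜.H + 1) (Finset.mem_Icc.2 (by omega)) y)
          fun ω hω => by rw [(hsub hω).1, (hsub hω).2]]
        simp only [Set.Finite.mem_toFinset] at hy
        simp [hy]
      · intro y _ hy
        simp only [Set.Finite.mem_toFinset] at hy
        simp [hy]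
    · intro y _ z _ hyz
      refine Set.disjoint_left.2 fun ω h1 h2 => hyz ?_
      exact h1.2.symm.trans h2.2
    · exact fun y _ => ((hI.history_le _ _) _ hE).inter (hI.measurable_X _ _ y)

end Interaction

end StrongEuler

end

noncomputable section

namespace StrongEuler

open scoped ENNReal Nat

/-! ### Laplace's mixture and the relative entropy of counts -/

section Laplace

variable {S : Type*} [Fintype S]

/-- The probability that Laplace's rule of succession assigns to any sequence with counts `N`. -/
def laplaceWeight (N : S → ℕ) : ℝ :=
  ((Fintype.card S - 1)! * ∏ y, (N y)! : ℕ) / ((∑ y, N y + (Fintype.card S - 1))! : ℕ)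

lemma laplaceWeight_pos (N : S → ℕ) : 0 < laplaceWeight N := by
  refine div_pos ?_ (by exact_mod_cast Nat.factorial_pos _)
  exact_mod_cast Nat.mul_pos (Nat.factorial_pos _) (Finset.prod_pos fun y _ => Nat.factorial_pos _)

/-- The new factor is the predictive probability of `y`, so the weight is a product of predictable
probabilities. -/
lemma laplaceWeight_succ [DecidableEq S] (N : S → ℕ) (y : S) :
    laplaceWeight (fun z => N z + if y = z then 1 else 0)
      = laplaceWeight N * ((N y + 1) / (∑ z, N z + Fintype.card S)) := by
  have hS : 1 ≤ Fintype.card S := Fintype.card_pos_iff.2 ⟨y⟩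
  have h1 : ∑ z, (N z + if y = z then 1 else 0) = ∑ z, N z + 1 := by
    simp [Finset.sum_add_distrib]
  have h2 : ∏ z, (N z + if y = z then 1 else 0)! = (N y + 1) * ∏ z, (N z)! := by
    have h3 : ∀ z, (N z + if y = z then 1 else 0)! = (if y = z then N z + 1 else 1) * (N z)! := by
      intro z
      split_ifs with h
      · rw [Nat.factorial_succ]
      · simp
    simp only [h3, Finset.prod_mul_distrib, Finset.prod_ite_eq, Finset.mem_univ, if_true]
  unfold laplaceWeight
  rw [h1, h2, show ∑ z, N z + 1 + (Fintype.card S - 1)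
    = (∑ z, N z + (Fintype.card S - 1)) + 1 by ring, Nat.factorial_succ]
  have h4 : ((∑ z, N z + (Fintype.card S - 1) + 1 : ℕ) : ℝ) = ((∑ z, N z : ℕ) : ℝ) + Fintype.card S := by
    rw [← Nat.cast_add]; congr 1; omega
  have h6 : ((∑ z, N z : ℕ) : ℝ) + Fintype.card S ≠ 0 := by
    have : (1 : ℝ) ≤ Fintype.card S := by exact_mod_cast hS
    positivity
  rw [Nat.cast_mul (_ + 1) (_ !), h4]
  have h7 : (((∑ z, N z + (Fintype.card S - 1))! : ℕ) : ℝ) ≠ 0 := by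
    exact_mod_cast Nat.factorial_ne_zero _
  push_cast at h7 h6 ⊢
  field_simp

/-- From `n + s + 1 ≤ (s + 1)(n + 1)`. Equivalently `(n + s).choose s ≤ (n + 1) ^ s`, the price of
the mixture. -/
lemma factorial_add_le (n s : ℕ) : (n + s)! ≤ n ! * s ! * (n + 1) ^ s := by
  induction s with
  | zero => simp
  | succ s ih =>
    rw [← add_assoc, Nat.factorial_succ, Nat.factorial_succ, pow_succ]
    calc (n + s + 1) * (n + s)! ≤ ((s + 1) * (n + 1)) * (n ! * s ! * (n + 1) ^ s) :=
          Nat.mul_le_mul (by nlinarith [Nat.zero_le (s * n)]) ih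
      _ = _ := by ring

/-- A single term of the multinomial expansion is at most the whole sum. -/
lemma factorial_mul_prod_pow_le (N : S → ℕ) {w : S → ℝ} (hw : ∀ y, 0 ≤ w y) :
    ((∑ y, N y)! : ℝ) * ∏ y, w y ^ N y ≤ (∏ y, ((N y)! : ℝ)) * (∑ y, w y) ^ (∑ y, N y) := by
  classical
  have h1 := Finset.sum_pow_eq_sum_piAntidiag Finset.univ w (∑ y, N y)
  have h2 : (Nat.multinomial Finset.univ N : ℝ) * ∏ y, w y ^ N y ≤ (∑ y, w y) ^ (∑ y, N y) := by
    rw [h1]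
    refine Finset.single_le_sum (f := fun k : S → ℕ =>
      (Nat.multinomial Finset.univ k : ℝ) * ∏ y, w y ^ k y) (fun k _ => ?_) ?_
    · exact mul_nonneg (Nat.cast_nonneg _) (Finset.prod_nonneg fun y _ => pow_nonneg (hw y) _)
    · simp
  have h3 : (∏ y, ((N y)! : ℝ)) * (Nat.multinomial Finset.univ N : ℝ) = ((∑ y, N y)! : ℝ) := by
    exact_mod_cast Nat.multinomial_spec Finset.univ N
  rw [← h3, mul_assoc]
  exact mul_le_mul_of_nonneg_left h2 (Finset.prod_nonneg fun y _ => Nat.cast_nonneg _)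

/-- A likelihood bound for the Laplace mixture yields a change-of-measure inequality. -/
lemma change_of_measure {p : S → ℝ} (hp : p ∈ stdSimplex ℝ S) {N : S → ℕ} {n : ℕ} (hn : 1 ≤ n)
    (hN : ∑ y, N y = n) {K : ℝ} (hK : 2 ≤ K) (hlap : laplaceWeight N ≤ K * ∏ y, p y ^ N y)
    (f : S → ℝ) :
    mean (fun y => (N y : ℝ) / n) f ≤ Real.log (mean p fun y => Real.exp (f y))
      + Fintype.card S * Real.log (n * K) / n := by
  have hS : 1 ≤ Fintype.card S := by
    refine Fintype.card_pos_iff.2 ?_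
    by_contra h
    rw [not_nonempty_iff] at h
    simp at hN; omega
  have hnpos : (0 : ℝ) < n := by exact_mod_cast hn
  have hn1 : (1 : ℝ) ≤ n := by exact_mod_cast hn
  have hKpos : 0 < K := by linarith
  set Z := mean p fun y => Real.exp (f y)
  have hZ : 0 < Z := mean_exp_pos hp f
  -- One term of the multinomial expansion of `Z ^ n` at the tilted weights. Combined with `hlap` it
  -- eliminates `∏ p ^ N` without dividing by it, so vanishing `p y` need no separate treatment.
  have hmult := factorial_mul_prod_pow_le N (w := fun y => p y * Real.exp (f y))
    fun y => mul_nonneg (hp.1 y) (Real.exp_pos _).le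
  have hexp : ∏ y, Real.exp (f y) ^ N y = Real.exp (∑ y, N y * f y) := by
    rw [Real.exp_sum]; exact Finset.prod_congr rfl fun y _ => by rw [Real.exp_nat_mul]
  simp only [mul_pow, Finset.prod_mul_distrib, hexp] at hmult
  rw [hN] at hmult
  have hmult' : (n ! : ℝ) * ((∏ y, p y ^ N y) * Real.exp (∑ y, N y * f y))
      ≤ (∏ y, ((N y)! : ℝ)) * Z ^ n := hmult
  have hNpos : (0 : ℝ) < ∏ y, ((N y)! : ℝ) :=
    Finset.prod_pos fun y _ => by exact_mod_cast Nat.factorial_pos _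
  have hfac : ((n + (Fintype.card S - 1))! : ℝ)
      ≤ n ! * (Fintype.card S - 1)! * (n + 1) ^ (Fintype.card S - 1) := by
    exact_mod_cast factorial_add_le n (Fintype.card S - 1)
  have hE : Real.exp (∑ y, N y * f y) ≤ Z ^ n * (K * (n + 1) ^ (Fintype.card S - 1)) := by
    set E := Real.exp (∑ y, N y * f y)
    have hEpos : 0 < E := Real.exp_pos _
    set P := ∏ y, p y ^ N y
    set s := Fintype.card S - 1
    have hnf : (0 : ℝ) < n ! := by exact_mod_cast Nat.factorial_pos _
    have hsf : (0 : ℝ) < s ! := by exact_mod_cast Nat.factorial_pos _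
    have hnsf : (0 : ℝ) < (n + s)! := by exact_mod_cast Nat.factorial_pos _
    have h1 : (s ! : ℝ) * ∏ y, ((N y)! : ℝ) ≤ K * P * (n + s)! := by
      have := hlap
      unfold laplaceWeight at this
      rw [hN, div_le_iff₀ (by exact_mod_cast Nat.factorial_pos _)] at this
      exact_mod_cast this
    have h2 : (∏ y, ((N y)! : ℝ)) * (s ! * n ! * E)
        ≤ (∏ y, ((N y)! : ℝ)) * (s ! * n ! * (Z ^ n * (K * (n + 1) ^ s))) :=
      calc (∏ y, ((N y)! : ℝ)) * (s ! * n ! * E) = (s ! * ∏ y, ((N y)! : ℝ)) * (n ! * E) := by ring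
        _ ≤ (K * P * (n + s)!) * (n ! * E) := mul_le_mul_of_nonneg_right h1 (by positivity)
        _ = K * (n + s)! * (n ! * (P * E)) := by ring
        _ ≤ K * (n + s)! * ((∏ y, ((N y)! : ℝ)) * Z ^ n) :=
            mul_le_mul_of_nonneg_left hmult' (by positivity)
        _ ≤ K * (n ! * s ! * (n + 1) ^ s) * ((∏ y, ((N y)! : ℝ)) * Z ^ n) :=
            mul_le_mul_of_nonneg_right (mul_le_mul_of_nonneg_left hfac hKpos.le) (by positivity)
        _ = _ := by ring
    exact le_of_mul_le_mul_left (le_of_mul_le_mul_left h2 hNpos) (by positivity)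
  have hlog := Real.log_le_log (Real.exp_pos _) hE
  rw [Real.log_exp, Real.log_mul (by positivity) (by positivity),
    Real.log_mul hKpos.ne' (by positivity), Real.log_pow, Real.log_pow] at hlog
  have hl1 : Real.log K ≤ Real.log (n * K) :=
    Real.log_le_log hKpos (le_mul_of_one_le_left hKpos.le hn1)
  -- Since `K ≥ 2`, `n + 1 ≤ n * K`. The `card S - 1` factors `n + 1` and the factor `K` together
  -- cost `card S` logarithms of `n * K`.
  have hl2 : Real.log (n + 1) ≤ Real.log (n * K) :=
    Real.log_le_log (by positivity) (by nlinarith)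
  have hs : ((Fintype.card S - 1 : ℕ) : ℝ) = Fintype.card S - 1 := by
    rw [Nat.cast_sub hS]; simp
  have hs0 : (0 : ℝ) ≤ ((Fintype.card S - 1 : ℕ) : ℝ) := Nat.cast_nonneg _
  have hfin : ∑ y, N y * f y ≤ n * Real.log Z + Fintype.card S * Real.log (n * K) := by
    have := mul_le_mul_of_nonneg_left hl2 hs0
    rw [hs] at this hlog
    linarith
  have hmean : mean (fun y => (N y : ℝ) / n) f = (∑ y, N y * f y) / n := by
    rw [mean, Finset.sum_div]; exact Finset.sum_congr rfl fun y _ => by ring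
  rw [hmean, div_le_iff₀ hnpos, add_mul, div_mul_cancel₀ _ hnpos.ne']
  linarith

end Laplace

/-! ### Visits in flattened time -/

section Visits

variable {S A : Type*} [DecidableEq S] [DecidableEq A]

lemma prod_Ico_product_Icc {M : Type*} [CommMonoid M] (H : ℕ) (k : ℕ) (F : ℕ × ℕ → M) :
    ∏ i ∈ Finset.Ico 1 k ×ˢ Finset.Icc 1 H, F i
      = ∏ t ∈ Finset.range ((k - 1) * H), F (t / H + 1, t % H + 1) := by
  rw [Finset.prod_product, Finset.prod_Ico_eq_prod_range]
  generalize k - 1 = m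
  induction m with
  | zero => simp
  | succ m ih =>
    rw [Finset.prod_range_succ, ih, Nat.succ_mul, Finset.prod_range_add]
    congr 1
    rw [show Finset.Icc 1 H = Finset.Ico 1 (H + 1) by ext; simp,
      Finset.prod_Ico_eq_prod_range]
    refine Finset.prod_congr (by simp) fun h hh => ?_
    have hlt : h < H := by simpa using hh
    have h1 : (m * H + h) / H = m := by
      rw [mul_comm, Nat.mul_add_div (by omega), Nat.div_eq_of_lt hlt, add_zero]
    have h2 : (m * H + h) % H = h := by
      rw [mul_comm, Nat.mul_add_mod, Nat.mod_eq_of_lt hlt]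
    rw [h1, h2, add_comm 1 m, add_comm 1 h]

/-- A product over the visits as a product over the flattened time. -/
lemma Transcript.prod_visits {M : Type*} [CommMonoid M] (D : Transcript S A) (H k : ℕ) (x : S)
    (a : A) (g : ℕ × ℕ → M) :
    ∏ i ∈ D.visits H k x a, g i = ∏ t ∈ Finset.range ((k - 1) * H),
      if D.X (t / H + 1) (t % H + 1) = x ∧ D.action (t / H + 1) (t % H + 1) = a then
        g (t / H + 1, t % H + 1) else 1 := by
  rw [Transcript.visits, Finset.prod_filter, prod_Ico_product_Icc]

/-- The product formula read in `Multiplicative ℕ`. -/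
lemma Transcript.nNext_eq_sum (D : Transcript S A) (H k : ℕ) (x : S) (a : A) (y : S) :
    D.nNext H k x a y = ∑ t ∈ Finset.range ((k - 1) * H),
      if D.X (t / H + 1) (t % H + 1) = x ∧ D.action (t / H + 1) (t % H + 1) = a then
        (if D.X (t / H + 1) (t % H + 1 + 1) = y then 1 else 0) else 0 := by
  have h := D.prod_visits (M := Multiplicative ℕ) H k x a
    fun i => Multiplicative.ofAdd (if D.X i.1 (i.2 + 1) = y then 1 else 0)
  have h2 := congrArg Multiplicative.toAdd h
  simp only [toAdd_prod, apply_ite Multiplicative.toAdd, toAdd_ofAdd, toAdd_one] at h2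
  rw [← h2, Transcript.nNext, Finset.card_filter]

end Visits

/-! ### Time-uniform tail bounds over visits -/

section TailBounds

variable {S A Ω O : Type*} [DecidableEq S] [DecidableEq A] [MeasurableSpace Ω]
  [MeasurableSpace O] {μ : Measure Ω} [IsProbabilityMeasure μ] {D : Ω → Transcript S A} {H : ℕ}
  {x : S} {a : A} {ν : Measure O} {ζ : Ω → ℕ × ℕ → O}

lemma le_ofReal_inv_of_mul_le_one {c : ℝ} (hc : 0 < c) {m : ℝ≥0∞} (h : ENNReal.ofReal c * m ≤ 1) :
    m ≤ ENNReal.ofReal c⁻¹ := by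
  rw [ENNReal.ofReal_inv_of_pos hc, ← one_div]
  rw [ENNReal.le_div_iff_mul_le (Or.inl (by simpa using hc)) (Or.inl ENNReal.ofReal_ne_top),
    mul_comm]
  exact h

/-- Nonnegative factors let the real product be read in `ℝ≥0∞`. Episode `k` begins at flat time `(k
- 1) * H`, so uniformity in flat time gives uniformity in `k`. -/
lemma measure_exists_prod_le
    (hs : IsSampledOn μ (flatHistory H D) (visitEvent H D x a)
      (fun t ω => ζ ω (t / H + 1, t % H + 1)) ν)
    {f : O → ℝ} (hf : Measurable f) (hf1 : ∫⁻ o, ENNReal.ofReal (f o) ∂ν ≤ 1) {c : ℝ}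
    (hc : 0 < c) :
    μ {ω | ∃ k, (∀ i ∈ (D ω).visits H k x a, 0 ≤ f (ζ ω i)) ∧
      c < ∏ i ∈ (D ω).visits H k x a, f (ζ ω i)} ≤ ENNReal.ofReal c⁻¹ := by
  classical
  refine le_ofReal_inv_of_mul_le_one hc ?_
  set W : ℕ → Ω → ℝ≥0∞ := fun T ω => ∏ t ∈ Finset.range T,
      if (D ω).X (t / H + 1) (t % H + 1) = x ∧ (D ω).action (t / H + 1) (t % H + 1) = a then
        ENNReal.ofReal (f (ζ ω (t / H + 1, t % H + 1))) else 1 with hWdef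
  have key := hs.measure_prod_le (by simp) hf.ennreal_ofReal hf1 (W := W) (by simp [hWdef])
    (fun t ω hω => by
      simp only [hWdef, Finset.prod_range_succ]
      exact congrArg _ (if_pos hω))
    (fun t ω hω => by
      simp only [hWdef, Finset.prod_range_succ]
      exact (congrArg _ (if_neg hω)).trans (mul_one _)) (ENNReal.ofReal c)
  refine le_trans (mul_le_mul_right (measure_mono ?_) _) key
  rintro ω ⟨k, h0, hk⟩
  refine ⟨(k - 1) * H, ?_⟩
  rw [hWdef]
  simp only
  rw [← (D ω).prod_visits H k x a fun i => ENNReal.ofReal (f (ζ ω i)),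
    ← ENNReal.ofReal_prod_of_nonneg h0]
  exact ENNReal.ofReal_le_ofReal hk.le

/-- The wealth processes of a geometric grid of betting fractions are simultaneously bounded. -/
lemma measure_exists_wealth_le [IsProbabilityMeasure ν]
    (hs : IsSampledOn μ (flatHistory H D) (visitEvent H D x a)
      (fun t ω => ζ ω (t / H + 1, t % H + 1)) ν)
    {g : O → ℝ} (hg : Measurable g) (hg1 : ∀ᵐ o ∂ν, |g o| ≤ 1) (hg0 : ∫ o, g o ∂ν = 0) {K : ℝ}
    (hK : 0 < K) :
    μ {ω | ∃ j k : ℕ, (∀ i ∈ (D ω).visits H k x a, |g (ζ ω i)| ≤ 1) ∧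
      2 ^ (j + 1) * K < ∏ i ∈ (D ω).visits H k x a, (1 + 1 / 2 ^ (j + 1) * g (ζ ω i))}
      ≤ ENNReal.ofReal K⁻¹ := by
  have hnn : ∀ (j : ℕ) (u : ℝ), |u| ≤ 1 → 0 ≤ 1 + 1 / 2 ^ (j + 1) * u := fun j u hu => by
    have h1 : (1 : ℝ) / 2 ^ (j + 1) ≤ 1 :=
      (div_le_one (by positivity)).2 (one_le_pow₀ (by norm_num))
    have h2 : (0 : ℝ) < 1 / 2 ^ (j + 1) := by positivity
    nlinarith [(abs_le.1 hu).1]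
  have hint : Integrable g ν := Integrable.of_bound hg.aestronglyMeasurable 1 hg1
  have hj : ∀ j : ℕ, μ {ω | ∃ k, (∀ i ∈ (D ω).visits H k x a,
        0 ≤ 1 + 1 / 2 ^ (j + 1) * g (ζ ω i)) ∧
      2 ^ (j + 1) * K < ∏ i ∈ (D ω).visits H k x a, (1 + 1 / 2 ^ (j + 1) * g (ζ ω i))}
      ≤ ENNReal.ofReal (2 ^ (j + 1) * K)⁻¹ := fun j => by
    refine measure_exists_prod_le hs (f := fun o => 1 + 1 / 2 ^ (j + 1) * g o)
      ((hg.const_mul _).const_add _) ?_ (by positivity)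
    have hi : Integrable (fun o => 1 + 1 / 2 ^ (j + 1) * g o) ν :=
      (integrable_const _).add (hint.const_mul _)
    rw [← ofReal_integral_eq_lintegral_ofReal hi
      (hg1.mono fun o ho => hnn j _ ho), integral_add (integrable_const _) (hint.const_mul _),
      integral_const_mul, hg0]
    simp
  have hsub : {ω | ∃ j k : ℕ, (∀ i ∈ (D ω).visits H k x a, |g (ζ ω i)| ≤ 1) ∧
      2 ^ (j + 1) * K < ∏ i ∈ (D ω).visits H k x a, (1 + 1 / 2 ^ (j + 1) * g (ζ ω i))}
      ⊆ ⋃ j : ℕ, {ω | ∃ k, (∀ i ∈ (D ω).visits H k x a, 0 ≤ 1 + 1 / 2 ^ (j + 1) * g (ζ ω i)) ∧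
      2 ^ (j + 1) * K < ∏ i ∈ (D ω).visits H k x a, (1 + 1 / 2 ^ (j + 1) * g (ζ ω i))} := by
    rintro ω ⟨j, k, h1, h2⟩
    exact Set.mem_iUnion.2 ⟨j, k, fun i hi => hnn j _ (h1 i hi), h2⟩
  refine (measure_mono hsub).trans ((measure_iUnion_le _).trans
    ((ENNReal.tsum_le_tsum hj).trans (le_of_eq ?_)))
  -- The failure probabilities `1 / (2 ^ (j + 1) * K)` sum to `1 / K`.
  have hgeo : HasSum (fun j : ℕ => ((2 : ℝ) ^ (j + 1) * K)⁻¹) K⁻¹ := by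
    have h1 := hasSum_geometric_two' (K⁻¹ : ℝ)
    refine h1.congr_fun fun j => ?_
    rw [mul_inv, pow_succ]
    field_simp
  rw [← ENNReal.ofReal_tsum_of_nonneg (fun j => by positivity) hgeo.summable, hgeo.tsum_eq]

end TailBounds

end StrongEuler

end

noncomputable section

namespace StrongEuler

open scoped ENNReal Nat

/-! ### The likelihood ratio of next states -/

section LaplaceTail

lemma isProbabilityMeasure_transitionMeasure {S A : Type*} [Fintype S] (𝓜 : MDP S A) (x : S) (a : A) :
    @IsProbabilityMeasure S ⊤ (transitionMeasure 𝓜 x a) := by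
  refine @IsProbabilityMeasure.mk S ⊤ _ ?_
  rw [transitionMeasure_apply]
  simp only [Set.indicator_univ, Pi.one_apply, mul_one]
  rw [← ENNReal.ofReal_sum_of_nonneg fun y _ => (𝓜.p_mem x a).1 y, (𝓜.p_mem x a).2,
    ENNReal.ofReal_one]

lemma transitionMeasure_singleton {S A : Type*} [Fintype S] (𝓜 : MDP S A) (x : S) (a : A) (y : S) :
    transitionMeasure 𝓜 x a {y} = ENNReal.ofReal (𝓜.p x a y) := by
  rw [transitionMeasure_apply, Finset.sum_eq_single y]
  · simp
  · intro z _ hz; simp [hz]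
  · simp

lemma integral_transitionMeasure {S A : Type*} [Fintype S] (𝓜 : MDP S A) (x : S) (a : A) (f : S → ℝ) :
    @integral S ℝ _ _ ⊤ (transitionMeasure 𝓜 x a) f = mean (𝓜.p x a) f := by
  let _ : MeasurableSpace S := ⊤
  have := isProbabilityMeasure_transitionMeasure 𝓜 x a
  rw [integral_fintype .of_finite]
  refine Finset.sum_congr rfl fun y _ => ?_
  rw [Measure.real, transitionMeasure_singleton, ENNReal.toReal_ofReal ((𝓜.p_mem x a).1 y),
    smul_eq_mul]

variable {S A Ω : Type*} [Fintype S] [DecidableEq S] [DecidableEq A]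
  [m0 : MeasurableSpace Ω] {μ : Measure Ω} {𝓜 : MDP S A}
  {D : Ω → Transcript S A}

/-- The number of transitions `(x, a) → y` among the first `t` actions. -/
def nextCount (H : ℕ) (D : Ω → Transcript S A) (x : S) (a : A) (t : ℕ) (ω : Ω) (y : S) : ℕ :=
  ∑ s ∈ Finset.range t,
    if (D ω).X (s / H + 1) (s % H + 1) = x ∧ (D ω).action (s / H + 1) (s % H + 1) = a then
      (if (D ω).X (s / H + 1) (s % H + 1 + 1) = y then 1 else 0) else 0

lemma measurable_nextCount {F : ℕ → MeasurableSpace Ω} {x : S} {a : A} {H : ℕ}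
    {ν : @Measure S ⊤}
    (hs : @IsSampledOn Ω S m0 ⊤ μ F (visitEvent H D x a)
      (fun t ω => (D ω).X (t / H + 1) (t % H + 1 + 1)) ν) (t : ℕ) :
    Measurable[F t] (nextCount H D x a t) := by
  let _ : MeasurableSpace S := ⊤
  refine @measurable_pi_lambda _ _ _ (F t) _ _ fun y => ?_
  refine @Finset.measurable_fun_sum _ _ _ _ _ _ (F t) _ _ fun s hst => ?_
  have hle : F s ≤ F t := hs.mono (Finset.mem_range.1 hst).le
  have hle' : F (s + 1) ≤ F t := hs.mono (Finset.mem_range.1 hst)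
  refine Measurable.ite (hle _ (hs.measurable_visit s)) ?_
    measurable_const
  exact Measurable.ite
    (hle' _ (hs.measurable_outcome s (measurableSet_singleton y)))
    measurable_const measurable_const

/-- The likelihood ratio of Laplace's rule of succession is bounded uniformly in time. -/
lemma measure_exists_laplaceWeight_gt [IsProbabilityMeasure μ]
    (hI : IsInteraction 𝓜 μ D) (hH : 1 ≤ 𝓜.H) (x : S) (a : A)
    {K : ℝ} (hK : 0 < K) :
    μ {ω | ∃ k, K * ∏ y, 𝓜.p x a y ^ (D ω).nNext 𝓜.H k x a y
      < laplaceWeight ((D ω).nNext 𝓜.H k x a)} ≤ ENNReal.ofReal K⁻¹ := by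
  let _ : MeasurableSpace S := ⊤
  have hs := hI.isSampledOn_next hH x a
  set N := nextCount 𝓜.H D x a with hN
  -- Likelihood ratio of Laplace's rule to `p`. It is `∞` once a transition of probability `0` is
  -- counted, so such outcomes fall into the exceptional event.
  set W : ℕ → Ω → ℝ≥0∞ := fun t ω => ENNReal.ofReal (laplaceWeight (N t ω))
    * (∏ y, ENNReal.ofReal (𝓜.p x a y) ^ N t ω y)⁻¹ with hWdef
  set w : ℕ → S → Ω → ℝ≥0∞ := fun t y ω =>
    ENNReal.ofReal ((N t ω y + 1) / (∑ z, N t ω z + Fintype.card S)) with hwdef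
  have hNm := measurable_nextCount hs
  refine le_ofReal_inv_of_mul_le_one hK ?_
  have hcount : ∀ (g : (S → ℕ) → ℝ≥0∞), Measurable g := fun g => measurable_of_countable g
  have key := hs.measure_likelihood_le (by simp) (W := W) (w := w)
    (fun t => (hcount fun M => ENNReal.ofReal (laplaceWeight M)
      * (∏ y, ENNReal.ofReal (𝓜.p x a y) ^ M y)⁻¹).comp (hNm t))
    (fun t y => (hcount fun M =>
      ENNReal.ofReal ((M y + 1) / (∑ z, M z + Fintype.card S))).comp (hNm t))
    (fun t ω => by
      simp only [hwdef]
      have hpos : (0 : ℝ) < ((∑ z, N t ω z : ℕ) : ℝ) + Fintype.card S := by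
        have : 0 < Fintype.card S := Fintype.card_pos_iff.2 ⟨x⟩
        positivity
      rw [← ENNReal.ofReal_sum_of_nonneg fun y _ => by positivity, ← Finset.sum_div,
        Finset.sum_add_distrib]
      simp only [Finset.sum_const, Finset.card_univ, nsmul_eq_mul, mul_one]
      push_cast at hpos ⊢
      rw [div_self hpos.ne', ENNReal.ofReal_one])
    (fun ω => by
      have h0 : N 0 ω = fun _ => 0 := by funext y; simp [hN, nextCount]
      simp only [hWdef, h0]
      simp [laplaceWeight, div_self (show ((Fintype.card S - 1)! : ℝ) ≠ 0 from by
        exact_mod_cast Nat.factorial_ne_zero _)])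
    (fun t ω hω => by
      set y := (D ω).X (t / 𝓜.H + 1) (t % 𝓜.H + 1 + 1) with hy
      have h1 : N (t + 1) ω = fun z => N t ω z + if y = z then 1 else 0 := by
        funext z
        simp only [hN, nextCount, Finset.sum_range_succ]
        exact congrArg _ (if_pos hω)
      have h2 : ∏ z, ENNReal.ofReal (𝓜.p x a z) ^ (N t ω z + if y = z then 1 else 0)
          = (∏ z, ENNReal.ofReal (𝓜.p x a z) ^ N t ω z) * ENNReal.ofReal (𝓜.p x a y) := by
        simp only [pow_add, Finset.prod_mul_distrib]
        congr 1
        rw [Finset.prod_eq_single y]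
        · simp
        · intro z _ hz; simp [hz.symm]
        · simp
      simp only [hWdef, hwdef]
      rw [h1, laplaceWeight_succ, h2, ENNReal.ofReal_mul (laplaceWeight_pos _).le,
        ENNReal.mul_inv (Or.inr ENNReal.ofReal_ne_top)
          (Or.inl (ENNReal.prod_ne_top fun z _ => ENNReal.pow_ne_top ENNReal.ofReal_ne_top)),
        transitionMeasure_singleton]
      ring)
    (fun t ω hω => by
      have h1 : N (t + 1) ω = N t ω := by
        funext z
        simp only [hN, nextCount, Finset.sum_range_succ]
        exact (congrArg _ (if_neg hω)).trans (add_zero _)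
      simp only [hWdef, h1])
    (ENNReal.ofReal K)
  refine le_trans (mul_le_mul_right (measure_mono ?_) _) key
  rintro ω ⟨k, hk⟩
  refine ⟨(k - 1) * 𝓜.H, ?_⟩
  have hNk : N ((k - 1) * 𝓜.H) ω = (D ω).nNext 𝓜.H k x a := by
    funext y; rw [(D ω).nNext_eq_sum]; rfl
  simp only [hWdef, hNk]
  by_contra hlt
  push Not at hlt
  have h3 := (ENNReal.div_le_iff_le_mul (Or.inr ENNReal.ofReal_ne_top)
    (Or.inr (ENNReal.ofReal_pos.2 hK).ne')).1 hlt.le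
  have h4 : ∏ y, ENNReal.ofReal (𝓜.p x a y) ^ (D ω).nNext 𝓜.H k x a y
      = ENNReal.ofReal (∏ y, 𝓜.p x a y ^ (D ω).nNext 𝓜.H k x a y) := by
    rw [ENNReal.ofReal_prod_of_nonneg fun y _ => pow_nonneg ((𝓜.p_mem x a).1 y) _]
    exact Finset.prod_congr rfl fun y _ => (ENNReal.ofReal_pow ((𝓜.p_mem x a).1 y) _).symm
  rw [h4, ← ENNReal.ofReal_mul hK.le, ENNReal.ofReal_le_ofReal_iff
    (mul_nonneg hK.le (Finset.prod_nonneg fun y _ => pow_nonneg ((𝓜.p_mem x a).1 y) _))] at h3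
  exact absurd hk (not_lt.2 h3)

end LaplaceTail

end StrongEuler

end

noncomputable section

namespace StrongEuler

open scoped ENNReal Nat

/-! ### The concentration event and its probability -/

section Regular

variable {S A Ω : Type*} [Fintype S] [Fintype A] [DecidableEq S] [DecidableEq A]

/-- The deterministic content of the concentration event. -/
structure Regular (𝓜 : MDP S A) (K : ℝ) (T : Transcript S A) : Prop where
  rew_mem : ∀ k, 1 ≤ k → ∀ h ∈ Finset.Icc 1 𝓜.H, T.rew k h ∈ Set.Icc (0 : ℝ) 1
  wealth_rew : ∀ x a (s : ℝ), s = 1 ∨ s = -1 → ∀ j k : ℕ,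
    ∏ i ∈ T.visits 𝓜.H k x a, (1 + 1 / 2 ^ (j + 1) * (s * (T.rew i.1 i.2 - 𝓜.r x a)))
      ≤ 2 ^ (j + 1) * K
  wealth_next : ∀ x a, ∀ h ∈ Finset.Icc 1 𝓜.H, ∀ s : ℝ, s = 1 ∨ s = -1 → ∀ j k : ℕ,
    ∏ i ∈ T.visits 𝓜.H k x a, (1 + 1 / 2 ^ (j + 1) *
      (s * ((𝓜.optValue (h + 1) (T.X i.1 (i.2 + 1))
        - mean (𝓜.p x a) (𝓜.optValue (h + 1))) / 𝓜.H))) ≤ 2 ^ (j + 1) * K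
  second_moment : ∀ x a k, ∏ i ∈ T.visits 𝓜.H k x a,
    Real.exp ((T.rew i.1 i.2 - 𝓜.r x a) ^ 2 - 2 * 𝓜.rewardVar x a) ≤ K
  laplace : ∀ x a k, laplaceWeight (T.nNext 𝓜.H k x a)
    ≤ K * ∏ y, 𝓜.p x a y ^ T.nNext 𝓜.H k x a y

lemma Transcript.mem_visits {T : Transcript S A} {H k : ℕ} {x : S} {a : A} {i : ℕ × ℕ}
    (hi : i ∈ T.visits H k x a) : 1 ≤ i.1 ∧ i.2 ∈ Finset.Icc 1 H := by
  simp only [Transcript.visits, Finset.mem_filter, Finset.mem_product, Finset.mem_Ico] at hi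
  exact ⟨hi.1.1.1, hi.1.2⟩

lemma MDP.optValue_mem [Nonempty A] (𝓜 : MDP S A) {h : ℕ} (hh : 1 ≤ h) (x : S) :
    𝓜.optValue h x ∈ Set.Icc (0 : ℝ) 𝓜.H := by
  refine ⟨?_, 𝓜.optValue_le fun π => (𝓜.value_le π h x).trans ?_⟩
  · exact (𝓜.value_nonneg (fun _ _ => Classical.arbitrary A) h x).trans
      (𝓜.value_le_optValue _ h x)
  · exact_mod_cast (by omega : 𝓜.H + 1 - h ≤ 𝓜.H)

lemma abs_sub_le_one {u v : ℝ} (hu : u ∈ Set.Icc (0 : ℝ) 1) (hv : v ∈ Set.Icc (0 : ℝ) 1) :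
    |u - v| ≤ 1 :=
  abs_le.2 ⟨by linarith [hu.1, hv.2], by linarith [hu.2, hv.1]⟩

lemma abs_sign_mul {s u : ℝ} (hs : s = 1 ∨ s = -1) : |s * u| = |u| := by
  obtain rfl | rfl := hs <;> simp

lemma MDP.abs_optValue_sub_div_le [Nonempty A] (𝓜 : MDP S A) (hH : 1 ≤ 𝓜.H) (h : ℕ) (x : S)
    (a : A) (y : S) :
    |(𝓜.optValue (h + 1) y - mean (𝓜.p x a) (𝓜.optValue (h + 1))) / 𝓜.H| ≤ 1 := by
  have hpos : (0 : ℝ) < 𝓜.H := by exact_mod_cast hH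
  have h1 := fun y => 𝓜.optValue_mem (h := h + 1) (by omega) y
  have h2 : mean (𝓜.p x a) (𝓜.optValue (h + 1)) ∈ Set.Icc (0 : ℝ) 𝓜.H :=
    ⟨le_mean (𝓜.p_mem x a) fun y => (h1 y).1, mean_le (𝓜.p_mem x a) fun y => (h1 y).2⟩
  rw [abs_div, abs_of_pos hpos, div_le_one hpos, abs_le]
  exact ⟨by linarith [(h1 y).1, h2.2], by linarith [(h1 y).2, h2.1]⟩

variable [m0 : MeasurableSpace Ω] {μ : Measure Ω} [IsProbabilityMeasure μ] {𝓜 : MDP S A}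
  {D : Ω → Transcript S A} {K : ℝ}

/-- Every action is a visit to some pair, and there are only countably many times and pairs. -/
lemma IsInteraction.ae_rew_mem (hI : IsInteraction 𝓜 μ D) (hH : 1 ≤ 𝓜.H) :
    ∀ᵐ ω ∂μ, ∀ k, 1 ≤ k → ∀ h ∈ Finset.Icc 1 𝓜.H, (D ω).rew k h ∈ Set.Icc (0 : ℝ) 1 := by
  have key : ∀ᵐ ω ∂μ, ∀ t x a, ω ∈ visitEvent 𝓜.H D x a t →
      (D ω).rew (t / 𝓜.H + 1) (t % 𝓜.H + 1) ∈ Set.Icc (0 : ℝ) 1 := by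
    refine ae_all_iff.2 fun t => ae_all_iff.2 fun x => ae_all_iff.2 fun a => ?_
    have h1 := (hI.isSampledOn_rew hH x a).law t _ (Set.Icc (0 : ℝ) 1)ᶜ
      (measurableSet_visitEvent hH D x a t) subset_rfl measurableSet_Icc.compl
    have h2 : 𝓜.rewardLaw x a (Set.Icc (0 : ℝ) 1)ᶜ = 0 := 𝓜.rewardLaw_supp x a
    rw [h2, mul_zero] at h1
    refine measure_mono_null (fun ω hω => ?_) h1
    simp only [Set.mem_compl_iff, Set.mem_ofPred_eq, Classical.not_imp] at hω
    exact ⟨hω.1, hω.2⟩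
  filter_upwards [key] with ω hω k hk h hh
  obtain ⟨h1, h2⟩ := Finset.mem_Icc.1 hh
  have h3 := hω ((k - 1) * 𝓜.H + (h - 1)) _ _ ⟨rfl, rfl⟩
  have e1 : ((k - 1) * 𝓜.H + (h - 1)) / 𝓜.H + 1 = k := by
    rw [mul_comm, Nat.mul_add_div (by omega), Nat.div_eq_of_lt (by omega)]; omega
  have e2 : ((k - 1) * 𝓜.H + (h - 1)) % 𝓜.H + 1 = h := by
    rw [mul_comm, Nat.mul_add_mod, Nat.mod_eq_of_lt (by omega)]; omega
  rwa [e1, e2] at h3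

lemma IsInteraction.measure_wealth_rew_le (hI : IsInteraction 𝓜 μ D) (hH : 1 ≤ 𝓜.H) (hK : 0 < K)
    (x : S) (a : A) {s : ℝ} (hs : s = 1 ∨ s = -1) :
    μ {ω | ∃ j k : ℕ, (∀ i ∈ (D ω).visits 𝓜.H k x a,
        |s * ((D ω).rew i.1 i.2 - 𝓜.r x a)| ≤ 1) ∧
      2 ^ (j + 1) * K < ∏ i ∈ (D ω).visits 𝓜.H k x a,
        (1 + 1 / 2 ^ (j + 1) * (s * ((D ω).rew i.1 i.2 - 𝓜.r x a)))} ≤ ENNReal.ofReal K⁻¹ := by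
  have := 𝓜.rewardLaw_prob x a
  have hsupp := 𝓜.rewardLaw_supp x a
  have hi : Integrable (fun u : ℝ => u) (𝓜.rewardLaw x a) :=
    Integrable.of_mem_Icc 0 1 aemeasurable_id hsupp
  refine measure_exists_wealth_le (ζ := fun ω i => (D ω).rew i.1 i.2)
    (hI.isSampledOn_rew hH x a) (g := fun u => s * (u - 𝓜.r x a)) (by fun_prop) ?_ ?_ hK
  · exact hsupp.mono fun u hu => by
      rw [abs_sign_mul hs]; exact abs_sub_le_one hu (𝓜.r_mem x a)
  · rw [integral_const_mul, integral_sub hi (integrable_const _)]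
    simp [MDP.r]

/-- `V⋆` does not depend on the data, so its normalised values at next states are centred bounded
samples, and no factor `S` arises. -/
lemma IsInteraction.measure_wealth_next_le [Nonempty A] (hI : IsInteraction 𝓜 μ D)
    (hH : 1 ≤ 𝓜.H) (hK : 0 < K) (x : S) (a : A) (h : ℕ) {s : ℝ} (hs : s = 1 ∨ s = -1) :
    μ {ω | ∃ j k : ℕ, (∀ i ∈ (D ω).visits 𝓜.H k x a,
        |s * ((𝓜.optValue (h + 1) ((D ω).X i.1 (i.2 + 1))
          - mean (𝓜.p x a) (𝓜.optValue (h + 1))) / 𝓜.H)| ≤ 1) ∧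
      2 ^ (j + 1) * K < ∏ i ∈ (D ω).visits 𝓜.H k x a, (1 + 1 / 2 ^ (j + 1) *
        (s * ((𝓜.optValue (h + 1) ((D ω).X i.1 (i.2 + 1))
          - mean (𝓜.p x a) (𝓜.optValue (h + 1))) / 𝓜.H)))} ≤ ENNReal.ofReal K⁻¹ := by
  let _ : MeasurableSpace S := ⊤
  have := isProbabilityMeasure_transitionMeasure 𝓜 x a
  refine measure_exists_wealth_le (ζ := fun ω i => (D ω).X i.1 (i.2 + 1))
    (hI.isSampledOn_next hH x a) (g := fun y => s * ((𝓜.optValue (h + 1) y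
          - mean (𝓜.p x a) (𝓜.optValue (h + 1))) / 𝓜.H)) measurable_from_top ?_ ?_ hK
  · exact Filter.Eventually.of_forall fun y => by
      rw [abs_sign_mul hs]; exact 𝓜.abs_optValue_sub_div_le hH h x a y
  · rw [integral_transitionMeasure, mean_const_mul]
    have : mean (𝓜.p x a) (fun y => (𝓜.optValue (h + 1) y
        - mean (𝓜.p x a) (𝓜.optValue (h + 1))) / 𝓜.H) = 0 := by
      simp only [div_eq_inv_mul, mean_const_mul, mean_sub_const (𝓜.p_mem x a)]
      simp
    rw [this, mul_zero]

/-- With `v` the variance, `(u - r)² ≤ 1` and `exp w ≤ 1 + 2w` bound the mean of one factor by `exp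
(-2v) (1 + 2v) ≤ 1`. The event excluded here would break the bound of the empirical variance by `2v`
plus `log K / n`. -/
lemma IsInteraction.measure_second_moment_le (hI : IsInteraction 𝓜 μ D) (hH : 1 ≤ 𝓜.H)
    (hK : 0 < K) (x : S) (a : A) :
    μ {ω | ∃ k, K < ∏ i ∈ (D ω).visits 𝓜.H k x a,
      Real.exp (((D ω).rew i.1 i.2 - 𝓜.r x a) ^ 2 - 2 * 𝓜.rewardVar x a)}
      ≤ ENNReal.ofReal K⁻¹ := by
  have := 𝓜.rewardLaw_prob x a
  have hsupp := 𝓜.rewardLaw_supp x a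
  have hle := measure_exists_prod_le (ζ := fun ω i => (D ω).rew i.1 i.2)
    (hI.isSampledOn_rew hH x a)
    (f := fun u => Real.exp ((u - 𝓜.r x a) ^ 2 - 2 * 𝓜.rewardVar x a)) (by fun_prop) ?_ hK
  · refine (measure_mono ?_).trans hle
    rintro ω ⟨k, hk⟩
    exact ⟨k, fun i _ => (Real.exp_pos _).le, hk⟩
  · have hsq : Integrable (fun u : ℝ => (u - 𝓜.r x a) ^ 2) (𝓜.rewardLaw x a) := by
      refine Integrable.of_mem_Icc 0 1 (by fun_prop) (hsupp.mono fun u hu => ⟨sq_nonneg _, ?_⟩)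
      have := abs_sub_le_one hu (𝓜.r_mem x a)
      rw [← sq_abs]; nlinarith [abs_nonneg (u - 𝓜.r x a)]
    have hvar : ∫ u, (u - 𝓜.r x a) ^ 2 ∂(𝓜.rewardLaw x a) = 𝓜.rewardVar x a := by
      rw [MDP.rewardVar, variance_eq_integral aemeasurable_id']; rfl
    have hint : Integrable (fun u : ℝ => Real.exp (-(2 * 𝓜.rewardVar x a))
        * (1 + 2 * (u - 𝓜.r x a) ^ 2)) (𝓜.rewardLaw x a) :=
      ((integrable_const _).add (hsq.const_mul 2)).const_mul _
    calc ∫⁻ u, ENNReal.ofReal (Real.exp ((u - 𝓜.r x a) ^ 2 - 2 * 𝓜.rewardVar x a))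
          ∂(𝓜.rewardLaw x a)
        ≤ ∫⁻ u, ENNReal.ofReal (Real.exp (-(2 * 𝓜.rewardVar x a))
          * (1 + 2 * (u - 𝓜.r x a) ^ 2)) ∂(𝓜.rewardLaw x a) := by
          refine lintegral_mono_ae (hsupp.mono fun u hu => ENNReal.ofReal_le_ofReal ?_)
          have := abs_sub_le_one hu (𝓜.r_mem x a)
          have h1 : (u - 𝓜.r x a) ^ 2 ≤ 1 := by
            rw [← sq_abs]; nlinarith [abs_nonneg (u - 𝓜.r x a)]
          rw [sub_eq_neg_add, Real.exp_add]
          exact mul_le_mul_of_nonneg_left (exp_le_one_add_two_mul (sq_nonneg _) h1)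
            (Real.exp_pos _).le
      _ = ENNReal.ofReal (Real.exp (-(2 * 𝓜.rewardVar x a)) * (1 + 2 * 𝓜.rewardVar x a)) := by
          rw [← ofReal_integral_eq_lintegral_ofReal hint
            (Filter.Eventually.of_forall fun u => by positivity), integral_const_mul,
            integral_add (integrable_const _) (hsq.const_mul 2), integral_const_mul, hvar]
          simp
      _ ≤ 1 := by
          rw [← ENNReal.ofReal_one]
          refine ENNReal.ofReal_le_ofReal ?_
          rw [Real.exp_neg, inv_mul_le_iff₀ (Real.exp_pos _), mul_one]
          linarith [Real.add_one_le_exp (2 * 𝓜.rewardVar x a)]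

/-- Each pair has two signs for rewards, one second moment, one likelihood ratio and two signs at
each of `H` stages: `2H + 4` events of probability at most `1 / K`. Rewards outside `[0, 1]` form a
null event, off which the boundedness conditions hold. -/
lemma IsInteraction.measure_not_regular_le [Nonempty A] (hI : IsInteraction 𝓜 μ D)
    (hH : 1 ≤ 𝓜.H) (hK : 0 < K) :
    μ {ω | ¬ Regular 𝓜 K (D ω)}
      ≤ ENNReal.ofReal (Fintype.card S * Fintype.card A * ((2 * 𝓜.H + 4) * K⁻¹)) := by
  set B0 : Set Ω := {ω | ¬ ∀ k, 1 ≤ k → ∀ h ∈ Finset.Icc 1 𝓜.H,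
    (D ω).rew k h ∈ Set.Icc (0 : ℝ) 1}
  set B1 : S → A → ℝ → Set Ω := fun x a s => {ω | ∃ j k : ℕ, (∀ i ∈ (D ω).visits 𝓜.H k x a,
        |s * ((D ω).rew i.1 i.2 - 𝓜.r x a)| ≤ 1) ∧
      2 ^ (j + 1) * K < ∏ i ∈ (D ω).visits 𝓜.H k x a,
        (1 + 1 / 2 ^ (j + 1) * (s * ((D ω).rew i.1 i.2 - 𝓜.r x a)))} with hB1
  set B2 : S → A → ℕ → ℝ → Set Ω := fun x a h s =>
    {ω | ∃ j k : ℕ, (∀ i ∈ (D ω).visits 𝓜.H k x a,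
        |s * ((𝓜.optValue (h + 1) ((D ω).X i.1 (i.2 + 1))
          - mean (𝓜.p x a) (𝓜.optValue (h + 1))) / 𝓜.H)| ≤ 1) ∧
      2 ^ (j + 1) * K < ∏ i ∈ (D ω).visits 𝓜.H k x a, (1 + 1 / 2 ^ (j + 1) *
        (s * ((𝓜.optValue (h + 1) ((D ω).X i.1 (i.2 + 1))
          - mean (𝓜.p x a) (𝓜.optValue (h + 1))) / 𝓜.H)))} with hB2
  set B3 : S → A → Set Ω := fun x a => {ω | ∃ k, K < ∏ i ∈ (D ω).visits 𝓜.H k x a,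
      Real.exp (((D ω).rew i.1 i.2 - 𝓜.r x a) ^ 2 - 2 * 𝓜.rewardVar x a)} with hB3
  set B4 : S → A → Set Ω := fun x a => {ω | ∃ k, K * ∏ y, 𝓜.p x a y ^ (D ω).nNext 𝓜.H k x a y
      < laplaceWeight ((D ω).nNext 𝓜.H k x a)} with hB4
  set B : S × A → Set Ω := fun z => ((B1 z.1 z.2 1 ∪ B1 z.1 z.2 (-1)) ∪ (B3 z.1 z.2 ∪ B4 z.1 z.2))
    ∪ ⋃ h ∈ Finset.Icc 1 𝓜.H, (B2 z.1 z.2 h 1 ∪ B2 z.1 z.2 h (-1)) with hB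
  have hsub : {ω | ¬ Regular 𝓜 K (D ω)} ⊆ B0 ∪ ⋃ z, B z := by
    intro ω hω
    by_contra hcon
    simp only [Set.mem_union, Set.mem_iUnion, not_or, not_exists, hB, Set.mem_union] at hcon
    obtain ⟨h0, hz⟩ := hcon
    have h0' : ∀ k, 1 ≤ k → ∀ h ∈ Finset.Icc 1 𝓜.H, (D ω).rew k h ∈ Set.Icc (0 : ℝ) 1 :=
      not_not.1 h0
    refine hω ⟨h0', fun x a s hs j k => ?_, fun x a h hh s hs j k => ?_, fun x a k => ?_,
      fun x a k => ?_⟩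
    · by_contra hlt
      have hmem : ω ∈ B1 x a s := ⟨j, k, fun i hi => by
        rw [abs_sign_mul hs]
        exact abs_sub_le_one (h0' _ (Transcript.mem_visits hi).1 _ (Transcript.mem_visits hi).2)
          (𝓜.r_mem x a), not_le.1 hlt⟩
      obtain rfl | rfl := hs
      · exact (hz (x, a)).1.1.1 hmem
      · exact (hz (x, a)).1.1.2 hmem
    · by_contra hlt
      have hmem : ω ∈ B2 x a h s := ⟨j, k, fun i _ => by
        rw [abs_sign_mul hs]
        exact 𝓜.abs_optValue_sub_div_le hH h x a _, not_le.1 hlt⟩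
      obtain rfl | rfl := hs
      · exact ((hz (x, a)).2 h hh).1 hmem
      · exact ((hz (x, a)).2 h hh).2 hmem
    · by_contra hlt
      exact (hz (x, a)).1.2.1 ⟨k, not_le.1 hlt⟩
    · by_contra hlt
      exact (hz (x, a)).1.2.2 ⟨k, not_le.1 hlt⟩
  have hKi : (0 : ℝ) ≤ K⁻¹ := inv_nonneg.2 hK.le
  have hBz : ∀ z, μ (B z) ≤ ENNReal.ofReal ((2 * 𝓜.H + 4) * K⁻¹) := by
    rintro ⟨x, a⟩
    have h2 : μ (⋃ h ∈ Finset.Icc 1 𝓜.H, (B2 x a h 1 ∪ B2 x a h (-1)))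
        ≤ ∑ _h ∈ Finset.Icc 1 𝓜.H, ENNReal.ofReal (2 * K⁻¹) := by
      refine (measure_biUnion_finset_le _ _).trans (Finset.sum_le_sum fun h _ => ?_)
      rw [two_mul, ENNReal.ofReal_add hKi hKi]
      exact (measure_union_le _ _).trans (add_le_add
        (hI.measure_wealth_next_le hH hK x a h (Or.inl rfl))
        (hI.measure_wealth_next_le hH hK x a h (Or.inr rfl)))
    rw [Finset.sum_const, Nat.card_Icc, Nat.add_sub_cancel, nsmul_eq_mul, ← ENNReal.ofReal_natCast,
      ← ENNReal.ofReal_mul (Nat.cast_nonneg _)] at h2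
    have h1 : μ ((B1 x a 1 ∪ B1 x a (-1)) ∪ (B3 x a ∪ B4 x a)) ≤ ENNReal.ofReal (4 * K⁻¹) := by
      rw [show 4 * K⁻¹ = (K⁻¹ + K⁻¹) + (K⁻¹ + K⁻¹) by ring,
        ENNReal.ofReal_add (by positivity) (by positivity), ENNReal.ofReal_add hKi hKi]
      exact (measure_union_le _ _).trans (add_le_add
        ((measure_union_le _ _).trans (add_le_add
          (hI.measure_wealth_rew_le hH hK x a (Or.inl rfl))
          (hI.measure_wealth_rew_le hH hK x a (Or.inr rfl))))
        ((measure_union_le _ _).trans (add_le_add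
          (hI.measure_second_moment_le hH hK x a)
          (measure_exists_laplaceWeight_gt hI hH x a hK))))
    calc μ (B (x, a)) ≤ ENNReal.ofReal (4 * K⁻¹) + ENNReal.ofReal (𝓜.H * (2 * K⁻¹)) :=
          (measure_union_le _ _).trans (add_le_add h1 h2)
      _ = _ := by rw [← ENNReal.ofReal_add (by positivity) (by positivity)]; congr 1; ring
  have h0 : μ B0 = 0 := hI.ae_rew_mem hH
  calc μ {ω | ¬ Regular 𝓜 K (D ω)} ≤ μ B0 + μ (⋃ z, B z) :=
        (measure_mono hsub).trans (measure_union_le _ _)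
    _ ≤ 0 + ∑ z, μ (B z) := by
        rw [h0]; exact add_le_add le_rfl (measure_iUnion_fintype_le _ _)
    _ ≤ ∑ _z : S × A, ENNReal.ofReal ((2 * 𝓜.H + 4) * K⁻¹) := by
        rw [zero_add]; exact Finset.sum_le_sum fun z _ => hBz z
    _ = _ := by
        rw [Finset.sum_const, Finset.card_univ, Fintype.card_prod, nsmul_eq_mul,
          ← ENNReal.ofReal_natCast, ← ENNReal.ofReal_mul (Nat.cast_nonneg _)]
        push_cast; rfl

end Regular

/-! ### Confidence intervals from the concentration event -/

section Empirical

variable {S A : Type*} [Fintype S] [Fintype A] [DecidableEq S] [DecidableEq A]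
  {T : Transcript S A} {H k : ℕ} {x : S} {a : A} {δ : ℝ}

namespace Transcript

lemma nNext_eq (T : Transcript S A) (H k : ℕ) (x : S) (a : A) (y : S) :
    T.nNext H k x a y = ∑ i ∈ T.visits H k x a, if T.X i.1 (i.2 + 1) = y then 1 else 0 := by
  rw [nNext, Finset.card_filter]

lemma mean_phat (T : Transcript S A) (H k : ℕ) (x : S) (a : A) (f : S → ℝ) :
    mean (T.phat H k x a) f
      = (∑ i ∈ T.visits H k x a, f (T.X i.1 (i.2 + 1))) / T.n H k x a := by
  have h1 : ∀ y, T.phat H k x a y * f y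
      = (∑ i ∈ T.visits H k x a, if T.X i.1 (i.2 + 1) = y then f y else 0) / T.n H k x a := by
    intro y
    rw [phat, nNext_eq, div_mul_eq_mul_div]
    push_cast
    rw [Finset.sum_mul]
    simp only [ite_mul, one_mul, zero_mul]
  simp only [mean, h1, ← Finset.sum_div]
  rw [Finset.sum_comm]
  simp

lemma sum_nNext (T : Transcript S A) (H k : ℕ) (x : S) (a : A) :
    ∑ y, T.nNext H k x a y = T.n H k x a := by
  simp only [nNext_eq]
  rw [Finset.sum_comm]
  simp [n]

lemma phat_nonneg (T : Transcript S A) (H k : ℕ) (x : S) (a : A) (y : S) :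
    0 ≤ T.phat H k x a y := by
  unfold phat; positivity

lemma phat_mem (hn : T.n H k x a ≠ 0) : T.phat H k x a ∈ stdSimplex ℝ S := by
  refine ⟨T.phat_nonneg H k x a, ?_⟩
  simp only [phat, ← Finset.sum_div]
  rw [← Nat.cast_sum, sum_nNext, div_self (by exact_mod_cast hn)]

lemma mean_phat_le {V : S → ℝ} {c : ℝ} (hc : 0 ≤ c) (hV : ∀ y, V y ≤ c) :
    mean (T.phat H k x a) V ≤ c := by
  by_cases hn : T.n H k x a = 0
  · have : mean (T.phat H k x a) V = 0 := by rw [mean_phat, hn]; simp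
    rw [this]; exact hc
  · exact mean_le (phat_mem hn) hV

lemma L_eq (hn : 1 ≤ T.n H k x a) :
    T.L H δ k x a
      = 2 * Real.log (T.n H k x a * (10 * (size S A H : ℝ) ^ 2 / δ)) := by
  rw [L, max_eq_left (by exact_mod_cast hn)]
  congr 2
  ring

lemma rhat_mem {𝓜 : MDP S A} {K : ℝ} (hT : Regular 𝓜 K T) (k : ℕ) (x : S) (a : A) :
    T.rhat 𝓜.H k x a ∈ Set.Icc (0 : ℝ) 1 := by
  have hi : ∀ i ∈ T.visits 𝓜.H k x a, T.rew i.1 i.2 ∈ Set.Icc (0 : ℝ) 1 := fun i hi =>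
    hT.rew_mem _ (mem_visits hi).1 _ (mem_visits hi).2
  refine ⟨div_nonneg (Finset.sum_nonneg fun i h => (hi i h).1) (Nat.cast_nonneg _), ?_⟩
  refine div_le_one_of_le₀ ?_ (Nat.cast_nonneg _)
  calc ∑ i ∈ T.visits 𝓜.H k x a, T.rew i.1 i.2 ≤ ∑ _i ∈ T.visits 𝓜.H k x a, (1 : ℝ) :=
        Finset.sum_le_sum fun i h => (hi i h).2
    _ = _ := by simp [n]

end Transcript

lemma sum_sq_sub_div_sub_sq {ι : Type*} (I : Finset ι) (g : ι → ℝ) (c : ℝ) (hI : I.card ≠ 0) :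
    (∑ i ∈ I, (g i - c) ^ 2) / I.card - ((∑ i ∈ I, (g i - c)) / I.card) ^ 2
      = (∑ i ∈ I, g i ^ 2) / I.card - ((∑ i ∈ I, g i) / I.card) ^ 2 := by
  have hc : (I.card : ℝ) ≠ 0 := by exact_mod_cast hI
  have h1 : ∑ i ∈ I, (g i - c) ^ 2
      = ∑ i ∈ I, g i ^ 2 - 2 * c * ∑ i ∈ I, g i + I.card * c ^ 2 := by
    rw [Finset.mul_sum, ← Finset.sum_sub_distrib, ← nsmul_eq_mul, ← Finset.sum_const,
      ← Finset.sum_add_distrib]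
    exact Finset.sum_congr rfl fun i _ => by ring
  rw [h1, Finset.sum_sub_distrib, Finset.sum_const, nsmul_eq_mul]
  field_simp
  ring

/-- Two-sided empirical Bernstein bound for centered samples bounded by `1`. -/
lemma abs_mean_le_of_wealth {ι : Type*} {I : Finset ι} {g : ι → ℝ} {c K L : ℝ}
    (hg : ∀ i ∈ I, |g i - c| ≤ 1) (hn : 2 ≤ I.card) (hK : 4 ≤ K)
    (hL : L = 2 * Real.log (I.card * K))
    (hw : ∀ s : ℝ, s = 1 ∨ s = -1 → ∀ j : ℕ,
      ∏ i ∈ I, (1 + 1 / 2 ^ (j + 1) * (s * (g i - c))) ≤ 2 ^ (j + 1) * K) :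
    |(∑ i ∈ I, g i) / I.card - c|
      ≤ √(2 * ((∑ i ∈ I, g i ^ 2) / I.card - ((∑ i ∈ I, g i) / I.card) ^ 2) * L / I.card)
        + 8 * L / (3 * ((I.card : ℝ) - 1)) := by
  have hc : (2 : ℝ) ≤ I.card := by exact_mod_cast hn
  have hL0 : 0 ≤ L := by
    rw [hL]; exact mul_nonneg zero_le_two (Real.log_nonneg (by nlinarith))
  have hmean : (∑ i ∈ I, (g i - c)) / I.card = (∑ i ∈ I, g i) / I.card - c := by
    rw [Finset.sum_sub_distrib, Finset.sum_const, nsmul_eq_mul, sub_div,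
      mul_div_cancel_left₀ _ (by linarith)]
  have key : ∀ s : ℝ, s = 1 ∨ s = -1 → s * ((∑ i ∈ I, g i) / I.card - c)
      ≤ √(2 * ((∑ i ∈ I, g i ^ 2) / I.card - ((∑ i ∈ I, g i) / I.card) ^ 2) * L / I.card)
        + 8 * L / (3 * ((I.card : ℝ) - 1)) := by
    intro s hs
    have hs2 : s ^ 2 = 1 := by obtain rfl | rfl := hs <;> norm_num
    have h := empirical_bernstein (I := I) (ξ := fun i => s * (g i - c))
      (fun i hi => by rw [abs_sign_mul hs]; exact hg i hi) hn rfl hK (hw s hs)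
    simp only [mul_pow, hs2, one_mul] at h
    rw [← Finset.mul_sum, mul_div_assoc, mul_pow, hs2, one_mul,
      sum_sq_sub_div_sub_sq I g c (by omega), hmean] at h
    -- As `L = 2 log (n K)`, the two square roots agree, and `16/3 log (n K) / n = 8L / (3n)` is
    -- below the term with `n - 1`.
    refine h.trans (add_le_add (le_of_eq ?_) ?_)
    · rw [show (2 : ℝ) = √4 by rw [show (4 : ℝ) = 2 ^ 2 by norm_num]; simp, ← Real.sqrt_mul
        (by norm_num), hL, ← show (2 : ℝ) = √4 by rw [show (4 : ℝ) = 2 ^ 2 by norm_num]; simp]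
      congr 1
      ring
    · have h1 : Real.log (I.card * K) = L / 2 := by rw [hL]; ring
      rw [h1, show (16 : ℝ) / 3 * (L / 2 / I.card) = 8 * L / (3 * I.card) by ring]
      exact div_le_div_of_nonneg_left (by positivity) (by linarith) (by linarith)
  rw [abs_le]
  have h1 := key 1 (Or.inl rfl)
  have h2 := key (-1) (Or.inr rfl)
  constructor <;> linarith

/-- The confidence intervals of StrongEuler at a state-action pair, with `L` the logarithmic
factor. -/
structure Confident (𝓜 : MDP S A) (δ : ℝ) (T : Transcript S A) (k : ℕ) (x : S) (a : A) :
    Prop where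
  log_pos : 0 < T.L 𝓜.H δ k x a
  rhat_mem : T.rhat 𝓜.H k x a ∈ Set.Icc (0 : ℝ) 1
  abs_rhat_sub_le : 2 ≤ T.n 𝓜.H k x a → |T.rhat 𝓜.H k x a - 𝓜.r x a|
    ≤ √(2 * T.varHat 𝓜.H k x a * T.L 𝓜.H δ k x a / T.n 𝓜.H k x a)
      + 8 * T.L 𝓜.H δ k x a / (3 * ((T.n 𝓜.H k x a : ℝ) - 1))
  abs_mean_sub_le : 2 ≤ T.n 𝓜.H k x a → ∀ h ∈ Finset.Icc 1 𝓜.H,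
    |mean (T.phat 𝓜.H k x a) (𝓜.optValue (h + 1)) - mean (𝓜.p x a) (𝓜.optValue (h + 1))|
    ≤ √(2 * var (T.phat 𝓜.H k x a) (𝓜.optValue (h + 1)) * T.L 𝓜.H δ k x a / T.n 𝓜.H k x a)
      + 8 * (𝓜.H : ℝ) * T.L 𝓜.H δ k x a / (3 * ((T.n 𝓜.H k x a : ℝ) - 1))
  varHat_le : 1 ≤ T.n 𝓜.H k x a →
    T.varHat 𝓜.H k x a ≤ 2 * 𝓜.rewardVar x a + T.L 𝓜.H δ k x a / T.n 𝓜.H k x a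
  change_of_measure : 1 ≤ T.n 𝓜.H k x a → ∀ f : S → ℝ,
    mean (T.phat 𝓜.H k x a) f ≤ Real.log (mean (𝓜.p x a) fun y => Real.exp (f y))
      + Fintype.card S * T.L 𝓜.H δ k x a / T.n 𝓜.H k x a / 2

lemma four_le_confidence (hδ0 : 0 < δ) (hδ1 : δ < 1) {M : ℕ} (hM : 2 ≤ M) :
    (4 : ℝ) ≤ 10 * (M : ℝ) ^ 2 / δ := by
  have : (2 : ℝ) ≤ M := by exact_mod_cast hM
  rw [le_div_iff₀ hδ0]; nlinarith

lemma Regular.confident [Nonempty A] {𝓜 : MDP S A} (hH : 1 ≤ 𝓜.H) (hδ0 : 0 < δ) (hδ1 : δ < 1)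
    (hM : 2 ≤ size S A 𝓜.H) (hT : Regular 𝓜 (10 * (size S A 𝓜.H : ℝ) ^ 2 / δ) T)
    (k : ℕ) (x : S) (a : A) : Confident 𝓜 δ T k x a := by
  have hK := four_le_confidence hδ0 hδ1 hM
  set K := 10 * (size S A 𝓜.H : ℝ) ^ 2 / δ with hKdef
  have hpos : (0 : ℝ) < 𝓜.H := by exact_mod_cast hH
  have hrew : ∀ i ∈ T.visits 𝓜.H k x a, |T.rew i.1 i.2 - 𝓜.r x a| ≤ 1 := fun i hi =>
    abs_sub_le_one (hT.rew_mem _ (Transcript.mem_visits hi).1 _ (Transcript.mem_visits hi).2)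
      (𝓜.r_mem x a)
  have hL0 : 0 < T.L 𝓜.H δ k x a := by
    rw [Transcript.L]
    refine mul_pos zero_lt_two (Real.log_pos ?_)
    rw [mul_div_right_comm]
    nlinarith [le_max_right (T.n 𝓜.H k x a : ℝ) 1]
  refine ⟨hL0, T.rhat_mem hT k x a, fun hn => ?_, fun hn h hh => ?_, fun hn => ?_, fun hn f => ?_⟩
  · exact abs_mean_le_of_wealth (I := T.visits 𝓜.H k x a) (g := fun i => T.rew i.1 i.2)
      (c := 𝓜.r x a) hrew hn hK (Transcript.L_eq (by omega)) fun s hs j => hT.wealth_rew x a s hs j k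
  · set V := 𝓜.optValue (h + 1) with hV
    -- Division by `H` bounds the samples by `1`; undoing it puts the factor `H` into the linear
    -- term.
    have hb := abs_mean_le_of_wealth (I := T.visits 𝓜.H k x a)
      (g := fun i => V (T.X i.1 (i.2 + 1)) / 𝓜.H) (c := mean (𝓜.p x a) V / 𝓜.H)
      (L := T.L 𝓜.H δ k x a) (K := K)
      (fun i _ => by
        rw [← sub_div]; exact 𝓜.abs_optValue_sub_div_le hH h x a _)
      hn hK (Transcript.L_eq (by omega))
      (fun s hs j => by
        simp only [← sub_div]; exact hT.wealth_next x a h hh s hs j k)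
    have hm := T.mean_phat 𝓜.H k x a V
    have hm2 := T.mean_phat 𝓜.H k x a (fun y => V y ^ 2)
    have hvar : var (T.phat 𝓜.H k x a) V
        = mean (T.phat 𝓜.H k x a) (fun y => V y ^ 2) - mean (T.phat 𝓜.H k x a) V ^ 2 := by
      have := mean_sq_sub (Transcript.phat_mem (show T.n 𝓜.H k x a ≠ 0 by omega)) V 0
      simp only [sub_zero] at this
      linarith
    simp only [div_pow, ← Finset.sum_div] at hb
    have hcard : ((T.visits 𝓜.H k x a).card : ℝ) = T.n 𝓜.H k x a := rfl
    have e1 : (∑ i ∈ T.visits 𝓜.H k x a, V (T.X i.1 (i.2 + 1))) / 𝓜.H / T.n 𝓜.H k x a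
        = mean (T.phat 𝓜.H k x a) V / 𝓜.H := by rw [hm, div_right_comm]
    have e2 : (∑ i ∈ T.visits 𝓜.H k x a, V (T.X i.1 (i.2 + 1)) ^ 2) / (𝓜.H : ℝ) ^ 2
        / T.n 𝓜.H k x a = mean (T.phat 𝓜.H k x a) (fun y => V y ^ 2) / (𝓜.H : ℝ) ^ 2 := by
      rw [hm2, div_right_comm]
    have e3 : (∑ i ∈ T.visits 𝓜.H k x a, V (T.X i.1 (i.2 + 1))) ^ 2 / (𝓜.H : ℝ) ^ 2
        / (T.n 𝓜.H k x a : ℝ) ^ 2 = mean (T.phat 𝓜.H k x a) V ^ 2 / (𝓜.H : ℝ) ^ 2 := by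
      rw [hm, div_pow, div_right_comm]
    rw [hcard, e1, e2, e3, ← sub_div, ← sub_div, ← hvar, abs_div, abs_of_pos hpos,
      div_le_iff₀ hpos, add_mul] at hb
    refine hb.trans (le_of_eq ?_)
    congr 1
    · nth_rewrite 2 [← Real.sqrt_sq hpos.le]
      rw [← Real.sqrt_mul' _ (sq_nonneg _)]
      congr 1
      field_simp
    · ring
  · have hnpos : (0 : ℝ) < T.n 𝓜.H k x a := by exact_mod_cast hn
    have hn1 : (1 : ℝ) ≤ T.n 𝓜.H k x a := by exact_mod_cast hn
    have hs := hT.second_moment x a k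
    rw [← Real.exp_sum] at hs
    have hs' := (Real.le_log_iff_exp_le (by linarith)).2 hs
    rw [Finset.sum_sub_distrib, Finset.sum_const, nsmul_eq_mul] at hs'
    have hcard : ((T.visits 𝓜.H k x a).card : ℝ) = T.n 𝓜.H k x a := rfl
    rw [hcard] at hs'
    have hlog : Real.log K ≤ T.L 𝓜.H δ k x a := by
      have h1 : Real.log K ≤ Real.log (T.n 𝓜.H k x a * K) :=
        Real.log_le_log (by linarith) (le_mul_of_one_le_left (by linarith) hn1)
      have h2 : 0 ≤ Real.log (T.n 𝓜.H k x a * K) := Real.log_nonneg (by nlinarith)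
      rw [Transcript.L_eq hn]; linarith
    have hv := sum_sq_sub_div_sub_sq (T.visits 𝓜.H k x a) (fun i => T.rew i.1 i.2) (𝓜.r x a)
      (by change T.n 𝓜.H k x a ≠ 0; omega)
    rw [hcard] at hv
    -- The empirical variance is at most the mean square about the true mean, which `second_moment`
    -- controls.
    have hv' : T.varHat 𝓜.H k x a
        ≤ (∑ i ∈ T.visits 𝓜.H k x a, (T.rew i.1 i.2 - 𝓜.r x a) ^ 2) / T.n 𝓜.H k x a := by
      rw [Transcript.varHat, Transcript.rhat, ← hv]
      linarith [sq_nonneg ((∑ i ∈ T.visits 𝓜.H k x a, (T.rew i.1 i.2 - 𝓜.r x a))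
        / (T.n 𝓜.H k x a : ℝ))]
    refine hv'.trans ?_
    rw [div_le_iff₀ hnpos, add_mul, div_mul_cancel₀ _ hnpos.ne']
    linarith
  · have h1 := StrongEuler.change_of_measure (𝓜.p_mem x a) hn (T.sum_nNext 𝓜.H k x a)
      (K := K) (by linarith) (hT.laplace x a k) f
    refine h1.trans (le_of_eq ?_)
    rw [Transcript.L_eq hn]
    ring

end Empirical

/-! ### Optimism and enclosure of the true values -/

section Optimism

variable {S A : Type*} [Fintype S] [Fintype A] [DecidableEq S] [DecidableEq A]
  {𝓜 : MDP S A} {T : Transcript S A} {k : ℕ} {x : S} {a : A} {δ : ℝ}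

/-- `vl` and `vu` enclose the value of `π` and the optimal value at stage `h`. -/
structure Sandwich (𝓜 : MDP S A) (π : ℕ → S → A) (h : ℕ) (b : ℝ) (vu vl : S → ℝ) : Prop where
  low_nonneg : ∀ y, 0 ≤ vl y
  low_le : ∀ y, vl y ≤ 𝓜.value π h y
  le_up : ∀ y, 𝓜.optValue h y ≤ vu y
  up_le : ∀ y, vu y ≤ b

namespace Sandwich

variable {π : ℕ → S → A} {h : ℕ} {b : ℝ} {vu vl : S → ℝ}

lemma low_le_opt (hs : Sandwich 𝓜 π h b vu vl) (y : S) : vl y ≤ 𝓜.optValue h y :=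
  (hs.low_le y).trans (𝓜.value_le_optValue π h y)

lemma up_nonneg (hs : Sandwich 𝓜 π h b vu vl) (y : S) : 0 ≤ vu y :=
  (hs.low_nonneg y).trans ((hs.low_le_opt y).trans (hs.le_up y))

lemma gap_nonneg (hs : Sandwich 𝓜 π h b vu vl) (y : S) : 0 ≤ vu y - vl y :=
  sub_nonneg.2 ((hs.low_le_opt y).trans (hs.le_up y))

lemma gap_le (hs : Sandwich 𝓜 π h b vu vl) (y : S) : vu y - vl y ≤ b := by
  linarith [hs.low_nonneg y, hs.up_le y]

end Sandwich

lemma bonusStr_nonneg (hc : 0 ≤ T.L 𝓜.H δ k x a) (vu vl : S → ℝ) :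
    0 ≤ T.bonusStr 𝓜.H δ k vu vl x a := by
  unfold Transcript.bonusStr
  have := norm2_nonneg (T.phat 𝓜.H k x a) (vu - vl)
  positivity

namespace Confident

lemma abs_rhat_sub_le_bonusRew (hc : Confident 𝓜 δ T k x a) :
    |T.rhat 𝓜.H k x a - 𝓜.r x a| ≤ T.bonusRew 𝓜.H δ k x a := by
  have h1 := abs_sub_le_one hc.rhat_mem (𝓜.r_mem x a)
  unfold Transcript.bonusRew
  split_ifs with hn
  · exact h1
  · exact le_min h1 (hc.abs_rhat_sub_le (by omega))

variable {π : ℕ → S → A} {h : ℕ} {b : ℝ} {vu vl : S → ℝ}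

/-- Concentration produces the empirical variance of the unknown `V⋆`. The triangle inequality for
standard deviations passes to `vu`; as `V⋆` lies between `vl` and `vu`, the error is at most the
third term of the bonus. -/
lemma abs_mean_sub_le_bonusProb [Nonempty A] (hc : Confident 𝓜 δ T k x a)
    (hs : Sandwich 𝓜 π (h + 1) b vu vl) (hn : 2 ≤ T.n 𝓜.H k x a) (hh : h ∈ Finset.Icc 1 𝓜.H) :
    |mean (T.phat 𝓜.H k x a) (𝓜.optValue (h + 1)) - mean (𝓜.p x a) (𝓜.optValue (h + 1))|
      ≤ T.bonusProb 𝓜.H δ k vu vl x a := by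
  have hq := Transcript.phat_mem (show T.n 𝓜.H k x a ≠ 0 by omega)
  have hL := hc.log_pos.le
  have hV := fun y => 𝓜.optValue_mem (h := h + 1) (by omega) y
  unfold Transcript.bonusProb
  rw [if_neg (by omega)]
  refine le_min ?_ ((hc.abs_mean_sub_le hn h hh).trans ?_)
  · rw [abs_le]
    have h1 := le_mean hq fun y => (hV y).1
    have h2 := mean_le hq fun y => (hV y).2
    have h3 := le_mean (𝓜.p_mem x a) fun y => (hV y).1
    have h4 := mean_le (𝓜.p_mem x a) fun y => (hV y).2
    constructor <;> linarith
  · have h1 := sqrt_var_le hq (𝓜.optValue (h + 1)) vu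
    have h2 : norm2 (T.phat 𝓜.H k x a) (vu - 𝓜.optValue (h + 1))
        ≤ norm2 (T.phat 𝓜.H k x a) (vl - vu) := by
      rw [norm2_sub_comm _ vl vu]
      refine norm2_mono hq.1 (fun y => ?_) fun y => ?_
      · exact sub_nonneg.2 (hs.le_up y)
      · simp only [Pi.sub_apply]; linarith [hs.low_le_opt y]
    have hw : 0 ≤ 2 * T.L 𝓜.H δ k x a / T.n 𝓜.H k x a := by positivity
    have e1 : ∀ v : ℝ, √(2 * v * T.L 𝓜.H δ k x a / T.n 𝓜.H k x a)
        = √(2 * T.L 𝓜.H δ k x a / T.n 𝓜.H k x a) * √v := fun v => by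
      rw [← Real.sqrt_mul hw]; congr 1; ring
    have e2 : √(2 * T.L 𝓜.H δ k x a * norm2 (T.phat 𝓜.H k x a) (vl - vu) ^ 2 / T.n 𝓜.H k x a)
        = √(2 * T.L 𝓜.H δ k x a / T.n 𝓜.H k x a) * norm2 (T.phat 𝓜.H k x a) (vl - vu) := by
      rw [← Real.sqrt_sq (norm2_nonneg (T.phat 𝓜.H k x a) (vl - vu)), ← Real.sqrt_mul hw,
        Real.sqrt_sq (norm2_nonneg _ _)]
      congr 1; ring
    rw [e1, e1, e2]
    have h3 := mul_le_mul_of_nonneg_left (h1.trans (add_le_add le_rfl h2))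
      (Real.sqrt_nonneg (2 * T.L 𝓜.H δ k x a / T.n 𝓜.H k x a))
    linarith

/-- The entropy bound holds for all functions at once, so `Y` may depend on the data. With `2κ = S L
/ n` it has the form of the bonus. -/
lemma mean_sub_mean_le_bonusStr (hc : Confident 𝓜 δ T k x a)
    (hn : 1 ≤ T.n 𝓜.H k x a) {Y : S → ℝ} (h0 : ∀ y, 0 ≤ Y y)
    (hY : ∀ y, Y y ≤ vu y - vl y) (hb : ∀ y, vu y - vl y ≤ 𝓜.H) :
    mean (𝓜.p x a) Y - mean (T.phat 𝓜.H k x a) Y ≤ T.bonusStr 𝓜.H δ k vu vl x a := by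
  have hL := hc.log_pos.le
  have hκ : 0 ≤ Fintype.card S * T.L 𝓜.H δ k x a / T.n 𝓜.H k x a := by positivity
  have h1 := mean_sub_mean_le_norm2 (𝓜.p_mem x a) (T.phat_nonneg 𝓜.H k x a) (div_nonneg hκ zero_le_two)
    (hc.change_of_measure hn) (Nat.cast_nonneg 𝓜.H) h0 fun y => (hY y).trans (hb y)
  rw [mul_div_cancel₀ _ (two_ne_zero)] at h1
  have h2 : norm2 (T.phat 𝓜.H k x a) Y ≤ norm2 (T.phat 𝓜.H k x a) (vu - vl) :=
    norm2_mono (T.phat_nonneg 𝓜.H k x a) h0 hY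
  unfold Transcript.bonusStr
  have h3 := mul_le_mul_of_nonneg_right h2
    (Real.sqrt_nonneg (Fintype.card S * T.L 𝓜.H δ k x a / T.n 𝓜.H k x a))
  have h4 : (𝓜.H : ℝ) * (Fintype.card S * T.L 𝓜.H δ k x a / T.n 𝓜.H k x a)
      = Fintype.card S * 𝓜.H * T.L 𝓜.H δ k x a / T.n 𝓜.H k x a := by ring
  have h5 : 0 ≤ (Fintype.card S : ℝ) * 𝓜.H * T.L 𝓜.H δ k x a / T.n 𝓜.H k x a := by positivity
  linarith

/-- Strong optimism: the optimistic `Q`-function dominates its own Bellman backup. -/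
lemma backup_le_qStep [Nonempty A] (hc : Confident 𝓜 δ T k x a) {j : ℕ} (hj : j ≤ 𝓜.H)
    (hs : Sandwich 𝓜 π (h + 1) j vu vl) (hh : h ∈ Finset.Icc 1 𝓜.H) :
    𝓜.r x a + mean (𝓜.p x a) vu ≤ T.qStep 𝓜.H δ k j vu vl x a := by
  have hL := hc.log_pos.le
  have hjH : (j : ℝ) ≤ 𝓜.H := by exact_mod_cast hj
  have hr := 𝓜.r_mem x a
  have hpv : mean (𝓜.p x a) vu ≤ j := mean_le (𝓜.p_mem x a) hs.up_le
  have hstr := bonusStr_nonneg hL vu vl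
  refine le_min (by linarith [hr.2]) ?_
  -- With at most one visit the bonuses `H` and `1` already exceed the trivial bound `j + 1`.
  by_cases hn : T.n 𝓜.H k x a ≤ 1
  · have hq : 0 ≤ mean (T.phat 𝓜.H k x a) vu := mean_nonneg (T.phat_nonneg _ _ _ _) hs.up_nonneg
    rw [Transcript.bonusProb, Transcript.bonusRew, if_pos hn, if_pos hn]
    linarith [hr.2, hc.rhat_mem.1]
  · have h1 := (abs_le.1 hc.abs_rhat_sub_le_bonusRew).1
    have h2 := (abs_le.1 (hc.abs_mean_sub_le_bonusProb hs (by omega) hh)).1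
    -- In `(p - p̂) vu = (p - p̂) V⋆ + (p - p̂)(vu - V⋆)`, `bonusProb` pays for the first summand
    -- and `bonusStr` for the second.
    have h3 := hc.mean_sub_mean_le_bonusStr (vu := vu) (vl := vl) (by omega)
      (Y := fun y => vu y - 𝓜.optValue (h + 1) y)
      (fun y => sub_nonneg.2 (hs.le_up y)) (fun y => by linarith [hs.low_le_opt y])
      fun y => (hs.gap_le y).trans hjH
    rw [mean_sub, mean_sub] at h3
    linarith

/-- Write `p̂ vl ≤ p̂ V^π = p̂ V⋆ - p̂ (V⋆ - V^π)`. The difference `V⋆ - V^π` lies between `0` and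
the gap, so `bonusStr` pays for its underestimation. -/
lemma vLowStep_le_backup [Nonempty A] (hc : Confident 𝓜 δ T k x a) {j : ℕ} (hj : j ≤ 𝓜.H)
    (hs : Sandwich 𝓜 π (h + 1) j vu vl) (hh : h ∈ Finset.Icc 1 𝓜.H) :
    T.vLowStep 𝓜.H δ k vu vl x a ≤ 𝓜.r x a + mean (𝓜.p x a) (𝓜.value π (h + 1)) := by
  have hL := hc.log_pos.le
  have hjH : (j : ℝ) ≤ 𝓜.H := by exact_mod_cast hj
  have hr := 𝓜.r_mem x a
  have hpv : 0 ≤ mean (𝓜.p x a) (𝓜.value π (h + 1)) :=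
    mean_nonneg (𝓜.p_mem x a).1 (𝓜.value_nonneg π (h + 1))
  have hstr := bonusStr_nonneg hL vu vl
  refine max_le (by linarith [hr.1]) ?_
  by_cases hn : T.n 𝓜.H k x a ≤ 1
  · have hq : mean (T.phat 𝓜.H k x a) vl ≤ 𝓜.H := Transcript.mean_phat_le (Nat.cast_nonneg _)
      fun y => by linarith [hs.gap_nonneg y, hs.up_le y]
    rw [Transcript.bonusProb, Transcript.bonusRew, if_pos hn, if_pos hn]
    linarith [hr.1, hc.rhat_mem.2]
  · have h1 := (abs_le.1 hc.abs_rhat_sub_le_bonusRew).2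
    have h2 := (abs_le.1 (hc.abs_mean_sub_le_bonusProb hs (by omega) hh)).2
    have h3 := hc.mean_sub_mean_le_bonusStr (vu := vu) (vl := vl) (by omega)
      (Y := fun y => 𝓜.optValue (h + 1) y - 𝓜.value π (h + 1) y)
      (fun y => sub_nonneg.2 (𝓜.value_le_optValue π _ y))
      (fun y => by linarith [hs.low_le y, hs.le_up y])
      fun y => (hs.gap_le y).trans hjH
    have h4 : mean (T.phat 𝓜.H k x a) vl ≤ mean (T.phat 𝓜.H k x a) (𝓜.value π (h + 1)) :=
      mean_mono (T.phat_nonneg _ _ _ _) hs.low_le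
    rw [mean_sub, mean_sub] at h3
    linarith

end Confident

lemma Transcript.vUp_pred (T : Transcript S A) {H j : ℕ} (hj : j + 1 ≤ H) (δ : ℝ) (k : ℕ) :
    T.vUp H δ k (H - j + 1) = (T.values H δ k j).1 := by
  funext y; rw [Transcript.vUp, show H + 1 - (H - j + 1) = j by omega]

lemma Transcript.vLow_pred (T : Transcript S A) {H j : ℕ} (hj : j + 1 ≤ H) (δ : ℝ) (k : ℕ) :
    T.vLow H δ k (H - j + 1) = (T.values H δ k j).2 := by
  funext y; rw [Transcript.vLow, show H + 1 - (H - j + 1) = j by omega]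

/-- The upper and lower values of StrongEuler enclose the true values. -/
lemma sandwich_values [Nonempty A] (hc : ∀ x a, Confident 𝓜 δ T k x a)
    (hT : T.IsStrongEuler 𝓜.H δ) (hk : 1 ≤ k) {j : ℕ} (hj : j ≤ 𝓜.H) :
    Sandwich 𝓜 (T.pol k) (𝓜.H + 1 - j) j (T.values 𝓜.H δ k j).1 (T.values 𝓜.H δ k j).2 := by
  induction j with
  | zero =>
    refine ⟨fun y => le_rfl, fun y => 𝓜.value_nonneg _ _ _, fun y => ?_, fun y => by
      simp [Transcript.values]⟩
    exact 𝓜.optValue_le fun π => (𝓜.value_of_lt π (by omega) y).le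
  | succ j ih =>
    have hs := ih (by omega)
    rw [show 𝓜.H + 1 - j = 𝓜.H - j + 1 by omega] at hs
    rw [show 𝓜.H + 1 - (j + 1) = 𝓜.H - j by omega]
    have hh : 𝓜.H - j ∈ Finset.Icc 1 𝓜.H := Finset.mem_Icc.2 ⟨by omega, by omega⟩
    refine ⟨fun y => le_max_left _ _, fun y => ?_, fun y => ?_, fun y => ?_⟩
    · rw [𝓜.value_eq _ (Finset.mem_Icc.1 hh).2]
      exact (hc _ _).vLowStep_le_backup (by omega) hs hh
    -- Each policy is bounded separately: its backup is below the optimistic `Q` at its own action,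
    -- and the played action maximises that `Q`.
    · refine 𝓜.optValue_le fun π => ?_
      rw [𝓜.value_eq _ (Finset.mem_Icc.1 hh).2]
      have h1 : mean (𝓜.p y (π (𝓜.H - j) y)) (𝓜.value π (𝓜.H - j + 1))
          ≤ mean (𝓜.p y (π (𝓜.H - j) y)) (T.values 𝓜.H δ k j).1 :=
        mean_mono (𝓜.p_mem _ _).1 fun z => (𝓜.value_le_optValue π _ z).trans (hs.le_up z)
      have h2 := (hc y (π (𝓜.H - j) y)).backup_le_qStep (by omega) hs hh
      have h3 := hT k hk _ hh y (π (𝓜.H - j) y)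
      rw [Transcript.qUp, Transcript.qUp, T.vUp_pred hj, T.vLow_pred hj,
        show 𝓜.H - (𝓜.H - j) = j by omega] at h3
      exact (add_le_add le_rfl h1).trans (h2.trans h3)
    · exact (min_le_left _ _).trans (by push_cast; exact le_rfl)

end Optimism

/-! ### Upper bounds on bonuses, surplus and gap growth -/

section UpperBounds

lemma linear_bonus_le {n c : ℝ} (hn : 2 ≤ n) (hc : 0 ≤ c) :
    8 * c / (3 * (n - 1)) ≤ 16 / 3 * (c / n) := by
  have h1 : 8 * c / (3 * (n - 1)) ≤ 8 * c / (3 * (n / 2)) :=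
    div_le_div_of_nonneg_left (by positivity) (by linarith) (by linarith)
  refine h1.trans (le_of_eq ?_)
  field_simp
  ring

lemma MDP.rewardVar_le_one {S A : Type*} [Fintype S] (𝓜 : MDP S A) (x : S) (a : A) : 𝓜.rewardVar x a ≤ 1 := by
  have := 𝓜.rewardLaw_prob x a
  have h := variance_le_sq_of_bounded (μ := 𝓜.rewardLaw x a) (X := fun u : ℝ => u)
    (𝓜.rewardLaw_supp x a) aemeasurable_id'
  unfold MDP.rewardVar
  norm_num at h ⊢
  linarith

variable {S A : Type*} [Fintype S] [Fintype A] [DecidableEq S] [DecidableEq A]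
  {𝓜 : MDP S A} {T : Transcript S A} {k : ℕ} {x : S} {a : A} {δ : ℝ}

lemma bonusProb_le_add (hn : 2 ≤ T.n 𝓜.H k x a) (vu vl : S → ℝ) :
    T.bonusProb 𝓜.H δ k vu vl x a
      ≤ √(2 * var (T.phat 𝓜.H k x a) vu * (T.L 𝓜.H δ k x a / T.n 𝓜.H k x a))
        + 8 * (𝓜.H * T.L 𝓜.H δ k x a) / (3 * ((T.n 𝓜.H k x a : ℝ) - 1))
        + √(2 * mean (T.phat 𝓜.H k x a) (fun y => (vu y - vl y) ^ 2)
          * (T.L 𝓜.H δ k x a / T.n 𝓜.H k x a)) := by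
  have hnorm : norm2 (T.phat 𝓜.H k x a) (vl - vu) ^ 2
      = mean (T.phat 𝓜.H k x a) (fun y => (vu y - vl y) ^ 2) := by
    rw [norm2_sub_comm, norm2_sq (T.phat_nonneg _ _ _ _)]; rfl
  unfold Transcript.bonusProb
  rw [if_neg (by omega), hnorm]
  refine (min_le_right _ _).trans (le_of_eq ?_)
  congr 1
  · congr 2 <;> ring
  · congr 1; ring

namespace Confident

variable {π : ℕ → S → A} {h : ℕ} {b : ℝ} {vu vl : S → ℝ}

lemma bonusRew_le (hc : Confident 𝓜 δ T k x a) (hn : 2 ≤ T.n 𝓜.H k x a) :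
    T.bonusRew 𝓜.H δ k x a ≤ 2 * √(𝓜.rewardVar x a * (T.L 𝓜.H δ k x a / T.n 𝓜.H k x a))
      + 8 * (T.L 𝓜.H δ k x a / T.n 𝓜.H k x a) := by
  have hL := hc.log_pos.le
  have hn2 : (2 : ℝ) ≤ T.n 𝓜.H k x a := by exact_mod_cast hn
  have hv := 𝓜.rewardVar_nonneg x a
  unfold Transcript.bonusRew
  rw [if_neg (by omega)]
  refine (min_le_right _ _).trans ?_
  have h1 := linear_bonus_le hn2 hL
  have hvar := hc.varHat_le (by omega)
  rw [mul_div_assoc]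
  set u := T.L 𝓜.H δ k x a / T.n 𝓜.H k x a
  have hu : 0 ≤ u := by positivity
  have hs := Real.sq_sqrt (mul_nonneg hv hu)
  have hs0 := Real.sqrt_nonneg (𝓜.rewardVar x a * u)
  have h2 : √(2 * T.varHat 𝓜.H k x a * u) ≤ 2 * √(𝓜.rewardVar x a * u) + 2 * u := by
    refine Real.sqrt_le_iff.2 ⟨by positivity, ?_⟩
    nlinarith [mul_le_mul_of_nonneg_right hvar hu, mul_nonneg hs0 hu, sq_nonneg u]
  linarith

lemma log_div_le (hc : Confident 𝓜 δ T k x a) :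
    T.L 𝓜.H δ k x a / T.n 𝓜.H k x a
      ≤ Fintype.card S * T.L 𝓜.H δ k x a / T.n 𝓜.H k x a := by
  have hS : (1 : ℝ) ≤ Fintype.card S := by exact_mod_cast Fintype.card_pos_iff.2 ⟨x⟩
  exact div_le_div_of_nonneg_right (le_mul_of_one_le_left hc.log_pos.le hS) (Nat.cast_nonneg _)

lemma mean_gap_sq_le (hc : Confident 𝓜 δ T k x a) (hs : Sandwich 𝓜 π h b vu vl)
    (hn : 1 ≤ T.n 𝓜.H k x a) (hH : 1 ≤ 𝓜.H) (hb : b ≤ 𝓜.H) :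
    mean (T.phat 𝓜.H k x a) (fun y => (vu y - vl y) ^ 2)
      ≤ 2 * mean (𝓜.p x a) (fun y => (vu y - vl y) ^ 2)
        + (𝓜.H : ℝ) ^ 2 * (Fintype.card S * T.L 𝓜.H δ k x a / T.n 𝓜.H k x a / 2) := by
  have hpos : (0 : ℝ) < 𝓜.H := by exact_mod_cast hH
  exact mean_le_two_mul_mean_add (𝓜.p_mem x a) (hc.change_of_measure hn) (by positivity)
    (fun y => sq_nonneg _) fun y => pow_le_pow_left₀ (hs.gap_nonneg y) ((hs.gap_le y).trans hb) 2

/-- The transition bonus in terms of the true variance of any function between `vl` and `vu`. -/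
lemma bonusProb_le (hc : Confident 𝓜 δ T k x a) (hs : Sandwich 𝓜 π h b vu vl)
    (hn : 2 ≤ T.n 𝓜.H k x a) (hH : 1 ≤ 𝓜.H) (hb : b ≤ 𝓜.H) {f : S → ℝ}
    (hf1 : ∀ y, vl y ≤ f y) (hf2 : ∀ y, f y ≤ vu y) :
    T.bonusProb 𝓜.H δ k vu vl x a
      ≤ 3 * √(var (𝓜.p x a) f * (T.L 𝓜.H δ k x a / T.n 𝓜.H k x a))
        + 2 * mean (𝓜.p x a) (fun y => (vu y - vl y) ^ 2)
        + 12 * (𝓜.H * (Fintype.card S * T.L 𝓜.H δ k x a / T.n 𝓜.H k x a)) := by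
  have hL := hc.log_pos.le
  have hn2 : (2 : ℝ) ≤ T.n 𝓜.H k x a := by exact_mod_cast hn
  have hH1 : (1 : ℝ) ≤ 𝓜.H := by exact_mod_cast hH
  have hq := Transcript.phat_mem (show T.n 𝓜.H k x a ≠ 0 by omega)
  have hp := 𝓜.p_mem x a
  have hgap := hc.mean_gap_sq_le hs (by omega) hH hb
  have hlin := linear_bonus_le hn2 (mul_nonneg (Nat.cast_nonneg 𝓜.H) hL)
  have hε := hc.log_div_le
  have hfm : ∀ y, |f y - mean (𝓜.p x a) f| ≤ 𝓜.H := fun y => by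
    have h0 : ∀ z, 0 ≤ f z ∧ f z ≤ 𝓜.H := fun z =>
      ⟨(hs.low_nonneg z).trans (hf1 z), (hf2 z).trans ((hs.up_le z).trans hb)⟩
    have h1 := le_mean hp fun z => (h0 z).1
    have h2 := mean_le hp fun z => (h0 z).2
    exact abs_le.2 ⟨by linarith [(h0 y).1], by linarith [(h0 y).2]⟩
  have hvar1 : var (T.phat 𝓜.H k x a) vu ≤ 2 * var (T.phat 𝓜.H k x a) f
      + 2 * mean (T.phat 𝓜.H k x a) (fun y => (vu y - vl y) ^ 2) := by
    refine (var_le_two_mul_add hq vu f).trans ?_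
    have : mean (T.phat 𝓜.H k x a) (fun y => (vu y - f y) ^ 2)
        ≤ mean (T.phat 𝓜.H k x a) (fun y => (vu y - vl y) ^ 2) :=
      mean_mono hq.1 fun y => pow_le_pow_left₀ (sub_nonneg.2 (hf2 y)) (by linarith [hf1 y]) 2
    linarith
  have hvar2 : var (T.phat 𝓜.H k x a) f ≤ 2 * var (𝓜.p x a) f
      + (𝓜.H : ℝ) ^ 2 * (Fintype.card S * T.L 𝓜.H δ k x a / T.n 𝓜.H k x a / 2) :=
    (var_le_mean_sq_sub hq f (mean (𝓜.p x a) f)).trans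
      (mean_le_two_mul_mean_add hp (hc.change_of_measure (by omega)) (by positivity)
        (fun y => sq_nonneg _) fun y => by
          rw [← sq_abs]; exact pow_le_pow_left₀ (abs_nonneg _) (hfm y) 2)
  have hX : 0 ≤ mean (𝓜.p x a) (fun y => (vu y - vl y) ^ 2) :=
    mean_nonneg hp.1 fun y => sq_nonneg _
  have hv := var_nonneg hp.1 f
  refine (bonusProb_le_add hn vu vl).trans ?_
  rw [mul_div_assoc (𝓜.H : ℝ)] at hlin
  set u := T.L 𝓜.H δ k x a / T.n 𝓜.H k x a
  set ε := Fintype.card S * T.L 𝓜.H δ k x a / T.n 𝓜.H k x a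
  set X := mean (𝓜.p x a) (fun y => (vu y - vl y) ^ 2)
  set Y := mean (T.phat 𝓜.H k x a) (fun y => (vu y - vl y) ^ 2)
  set v := var (𝓜.p x a) f
  have hu : 0 ≤ u := by positivity
  have hε0 : 0 ≤ ε := by positivity
  have hHε : 0 ≤ 𝓜.H * ε := by positivity
  have huH : u ≤ 𝓜.H * ε := hε.trans (le_mul_of_one_le_left hε0 hH1)
  have hHu : 𝓜.H * u ≤ 𝓜.H * ε := mul_le_mul_of_nonneg_left hε (Nat.cast_nonneg _)
  have hsq := Real.sq_sqrt (mul_nonneg hv hu)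
  have hs0 := Real.sqrt_nonneg (v * u)
  have hHε2 : (𝓜.H : ℝ) ^ 2 * ε * u ≤ (𝓜.H * ε) ^ 2 := by
    rw [mul_pow, sq ε, ← mul_assoc]
    exact mul_le_mul_of_nonneg_left hε (by positivity)
  -- As `u ≤ H ε`, AM–GM trades `√(X u)` for a combination of `X` and `H ε`; thus the gap enters
  -- only through its mean square.
  have h1 : √(2 * var (T.phat 𝓜.H k x a) vu * u) ≤ 3 * √(v * u) + X + 4 * (𝓜.H * ε) := by
    refine Real.sqrt_le_iff.2 ⟨by positivity, ?_⟩
    have hZ : 2 * var (T.phat 𝓜.H k x a) vu * u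
        ≤ 8 * (v * u) + 8 * (X * u) + 4 * ((𝓜.H : ℝ) ^ 2 * ε * u) := by
      have : 2 * var (T.phat 𝓜.H k x a) vu ≤ 8 * v + 8 * X + 4 * ((𝓜.H : ℝ) ^ 2 * ε) := by
        linarith
      nlinarith [mul_le_mul_of_nonneg_right this hu]
    have hXu : X * u ≤ X * (𝓜.H * ε) := mul_le_mul_of_nonneg_left huH hX
    nlinarith [mul_nonneg hs0 hX, mul_nonneg hs0 hHε, mul_nonneg hX hHε, sq_nonneg X]
  have h2 : √(2 * Y * u) ≤ X + 2 * (𝓜.H * ε) := by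
    refine Real.sqrt_le_iff.2 ⟨by positivity, ?_⟩
    have hZ : 2 * Y * u ≤ 4 * (X * u) + (𝓜.H : ℝ) ^ 2 * ε * u := by
      nlinarith [mul_le_mul_of_nonneg_right hgap hu]
    have hXu : X * u ≤ X * (𝓜.H * ε) := mul_le_mul_of_nonneg_left huH hX
    nlinarith [mul_nonneg hX hHε, sq_nonneg X]
  linarith

lemma bonusStr_le (hc : Confident 𝓜 δ T k x a) (hs : Sandwich 𝓜 π h b vu vl)
    (hn : 1 ≤ T.n 𝓜.H k x a) (hH : 1 ≤ 𝓜.H) (hb : b ≤ 𝓜.H) :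
    T.bonusStr 𝓜.H δ k vu vl x a ≤ mean (𝓜.p x a) (fun y => (vu y - vl y) ^ 2)
      + 5 * (𝓜.H * (Fintype.card S * T.L 𝓜.H δ k x a / T.n 𝓜.H k x a)) := by
  have hL := hc.log_pos.le
  have hH1 : (1 : ℝ) ≤ 𝓜.H := by exact_mod_cast hH
  have hgap := hc.mean_gap_sq_le hs hn hH hb
  have hX : 0 ≤ mean (𝓜.p x a) (fun y => (vu y - vl y) ^ 2) :=
    mean_nonneg (𝓜.p_mem x a).1 fun y => sq_nonneg _
  have hY : 0 ≤ mean (T.phat 𝓜.H k x a) (fun y => (vu y - vl y) ^ 2) :=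
    mean_nonneg (T.phat_nonneg _ _ _ _) fun y => sq_nonneg _
  unfold Transcript.bonusStr
  have e1 : (Fintype.card S : ℝ) * 𝓜.H * T.L 𝓜.H δ k x a / T.n 𝓜.H k x a
      = 𝓜.H * (Fintype.card S * T.L 𝓜.H δ k x a / T.n 𝓜.H k x a) := by ring
  rw [e1, norm2_eq]
  simp only [Pi.sub_apply]
  rw [← Real.sqrt_mul hY]
  set ε := Fintype.card S * T.L 𝓜.H δ k x a / T.n 𝓜.H k x a
  set X := mean (𝓜.p x a) (fun y => (vu y - vl y) ^ 2)
  set Y := mean (T.phat 𝓜.H k x a) (fun y => (vu y - vl y) ^ 2)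
  have hε0 : 0 ≤ ε := by positivity
  have hHε : 0 ≤ 𝓜.H * ε := by positivity
  have h2 : √(Y * ε) ≤ X + 2 * (𝓜.H * ε) := by
    refine Real.sqrt_le_iff.2 ⟨by positivity, ?_⟩
    have h3 := mul_le_mul_of_nonneg_right hgap hε0
    have hXu : X * ε ≤ X * (𝓜.H * ε) :=
      mul_le_mul_of_nonneg_left (le_mul_of_one_le_left hε0 hH1) hX
    nlinarith [mul_nonneg hX hHε, sq_nonneg X, sq_nonneg (𝓜.H * ε)]
  linarith

/-- Upper bound on the surplus after at least two visits. -/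
lemma qStep_sub_le [Nonempty A] (hc : Confident 𝓜 δ T k x a) {j : ℕ} (hj : j ≤ 𝓜.H)
    (hs : Sandwich 𝓜 π (h + 1) j vu vl) (hh : h ∈ Finset.Icc 1 𝓜.H) (hn : 2 ≤ T.n 𝓜.H k x a)
    {f : S → ℝ} (hf1 : ∀ y, vl y ≤ f y) (hf2 : ∀ y, f y ≤ vu y) :
    T.qStep 𝓜.H δ k j vu vl x a - 𝓜.r x a - mean (𝓜.p x a) vu
      ≤ 10 * √((𝓜.rewardVar x a + var (𝓜.p x a) f) * (T.L 𝓜.H δ k x a / T.n 𝓜.H k x a))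
        + 6 * mean (𝓜.p x a) (fun y => (vu y - vl y) ^ 2)
        + 46 * (𝓜.H * (Fintype.card S * T.L 𝓜.H δ k x a / T.n 𝓜.H k x a)) := by
  have hL := hc.log_pos.le
  obtain ⟨hh1, hh2⟩ := Finset.mem_Icc.1 hh
  have hH : 1 ≤ 𝓜.H := hh1.trans hh2
  have hjH : (j : ℝ) ≤ 𝓜.H := by exact_mod_cast hj
  have hH1 : (1 : ℝ) ≤ 𝓜.H := by exact_mod_cast hH
  have hp := 𝓜.p_mem x a
  have hr := (abs_le.1 hc.abs_rhat_sub_le_bonusRew).2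
  have hm := (abs_le.1 (hc.abs_mean_sub_le_bonusProb hs hn hh)).2
  have hbr := hc.bonusRew_le hn
  have hbp := hc.bonusProb_le hs hn hH hjH hf1 hf2
  have hbs := hc.bonusStr_le hs (by omega) hH hjH
  have hε := hc.log_div_le
  -- The choice `lam = 1 / H` keeps `lam * Y ≤ 1` and makes the bound second order in the gap.
  have hdev : mean (T.phat 𝓜.H k x a) (fun y => vu y - 𝓜.optValue (h + 1) y)
      - mean (𝓜.p x a) (fun y => vu y - 𝓜.optValue (h + 1) y)
      ≤ mean (𝓜.p x a) (fun y => (vu y - vl y) ^ 2)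
        + 𝓜.H * (Fintype.card S * T.L 𝓜.H δ k x a / T.n 𝓜.H k x a) := by
    have hpos : (0 : ℝ) < 𝓜.H := by linarith
    have h1 := mul_mean_sub_mean_le hp (hc.change_of_measure (by omega)) (inv_nonneg.2 hpos.le)
      (Y := fun y => vu y - 𝓜.optValue (h + 1) y) (fun y => sub_nonneg.2 (hs.le_up y))
      fun y => by
        rw [inv_mul_le_iff₀ hpos]
        linarith [hs.low_le_opt y, hs.gap_le y]
    have h2 := mul_le_mul_of_nonneg_left h1 hpos.le
    rw [mul_inv_cancel_left₀ hpos.ne', mul_add, ← mul_assoc, inv_pow, sq (𝓜.H : ℝ), mul_inv,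
      mul_inv_cancel_left₀ hpos.ne'] at h2
    have h3 : mean (𝓜.p x a) (fun y => (vu y - 𝓜.optValue (h + 1) y) ^ 2)
        ≤ mean (𝓜.p x a) (fun y => (vu y - vl y) ^ 2) :=
      mean_mono hp.1 fun y => pow_le_pow_left₀ (sub_nonneg.2 (hs.le_up y))
        (by linarith [hs.low_le_opt y]) 2
    have h4 : (𝓜.H : ℝ)⁻¹ * mean (𝓜.p x a) (fun y => (vu y - 𝓜.optValue (h + 1) y) ^ 2)
        ≤ mean (𝓜.p x a) (fun y => (vu y - 𝓜.optValue (h + 1) y) ^ 2) :=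
      mul_le_of_le_one_left (mean_nonneg hp.1 fun y => sq_nonneg _) (inv_le_one_of_one_le₀ hH1)
    have h5 : 0 ≤ (𝓜.H : ℝ) * (Fintype.card S * T.L 𝓜.H δ k x a / T.n 𝓜.H k x a) := by positivity
    linarith
  rw [mean_sub, mean_sub] at hdev
  have hq : T.qStep 𝓜.H δ k j vu vl x a ≤ _ := min_le_right _ _
  have hsr : √(𝓜.rewardVar x a * (T.L 𝓜.H δ k x a / T.n 𝓜.H k x a))
      ≤ √((𝓜.rewardVar x a + var (𝓜.p x a) f) * (T.L 𝓜.H δ k x a / T.n 𝓜.H k x a)) :=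
    Real.sqrt_le_sqrt (mul_le_mul_of_nonneg_right (by linarith [var_nonneg hp.1 f])
      (by positivity))
  have hsv : √(var (𝓜.p x a) f * (T.L 𝓜.H δ k x a / T.n 𝓜.H k x a))
      ≤ √((𝓜.rewardVar x a + var (𝓜.p x a) f) * (T.L 𝓜.H δ k x a / T.n 𝓜.H k x a)) :=
    Real.sqrt_le_sqrt (mul_le_mul_of_nonneg_right (by linarith [𝓜.rewardVar_nonneg x a])
      (by positivity))
  have huH : T.L 𝓜.H δ k x a / T.n 𝓜.H k x a
      ≤ 𝓜.H * (Fintype.card S * T.L 𝓜.H δ k x a / T.n 𝓜.H k x a) :=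
    hε.trans (le_mul_of_one_le_left (by positivity) hH1)
  -- Deviation and bonus count `bonusRew` and `bonusProb` twice: `2·2 + 2·3 = 10`, `2·2 + 1 + 1 = 6`
  -- and `2·8 + 2·12 + 5 + 1 = 46`.
  linarith

/-- For `ε ≤ 1`, `lam = √ε / B` balances the two terms of the entropy bound; for `ε ≥ 1` the trivial
bound `B` suffices. -/
lemma mean_phat_le_mean_add (hc : Confident 𝓜 δ T k x a) (hn : 1 ≤ T.n 𝓜.H k x a) {B : ℝ}
    (hB : 0 < B) {Y : S → ℝ} (h0 : ∀ y, 0 ≤ Y y) (h1 : ∀ y, Y y ≤ B) :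
    mean (T.phat 𝓜.H k x a) Y ≤ mean (𝓜.p x a) Y
      + B * (2 * √(Fintype.card S * T.L 𝓜.H δ k x a / T.n 𝓜.H k x a)
        + Fintype.card S * T.L 𝓜.H δ k x a / T.n 𝓜.H k x a) := by
  have hS : (0 : ℝ) < Fintype.card S := by exact_mod_cast Fintype.card_pos_iff.2 ⟨x⟩
  have hnpos : (0 : ℝ) < T.n 𝓜.H k x a := by exact_mod_cast hn
  have hL := hc.log_pos
  have hp := 𝓜.p_mem x a
  have hkl := hc.change_of_measure hn
  set ε := Fintype.card S * T.L 𝓜.H δ k x a / T.n 𝓜.H k x a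
  have hε : 0 < ε := by positivity
  have hY := mean_nonneg hp.1 h0
  have hsq := Real.sq_sqrt hε.le
  have hspos := Real.sqrt_pos.2 hε
  obtain h2 | h2 := le_total 1 ε
  · have := mean_le (Transcript.phat_mem (show T.n 𝓜.H k x a ≠ 0 by omega)) h1
    nlinarith [mul_pos hB hspos]
  · have hs1 : √ε ≤ 1 := Real.sqrt_le_one.2 h2
    have h3 := mul_mean_sub_mean_le hp hkl (lam := √ε / B) (by positivity) h0 fun y => by
      rw [div_mul_eq_mul_div, div_le_one hB]
      nlinarith [h0 y, h1 y]
    have h4 : mean (𝓜.p x a) (fun y => Y y ^ 2) ≤ B ^ 2 :=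
      mean_le hp fun y => pow_le_pow_left₀ (h0 y) (h1 y) 2
    have h5 : (√ε / B) ^ 2 * mean (𝓜.p x a) (fun y => Y y ^ 2) ≤ ε := by
      rw [div_pow, hsq, div_mul_eq_mul_div, div_le_iff₀ (by positivity)]
      exact mul_le_mul_of_nonneg_left h4 hε.le
    have h6 : √ε / B * (mean (T.phat 𝓜.H k x a) Y - mean (𝓜.p x a) Y) ≤ 2 * ε := by linarith
    rw [div_mul_eq_mul_div, div_le_iff₀ hB] at h6
    have h7 : √ε * (mean (T.phat 𝓜.H k x a) Y - mean (𝓜.p x a) Y) ≤ √ε * (2 * √ε * B) := by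
      nlinarith
    have h8 := le_of_mul_le_mul_left h7 hspos
    nlinarith [mul_pos hB hε]

/-- One-step growth of the gap between upper and lower values after at least two visits. -/
lemma qStep_sub_vLowStep_le (hc : Confident 𝓜 δ T k x a) {j : ℕ} (hj : j ≤ 𝓜.H)
    (hs : Sandwich 𝓜 π h j vu vl) (hH : 1 ≤ 𝓜.H) (hn : 2 ≤ T.n 𝓜.H k x a) :
    T.qStep 𝓜.H δ k j vu vl x a - T.vLowStep 𝓜.H δ k vu vl x a
      ≤ mean (𝓜.p x a) (fun y => vu y - vl y)
        + 𝓜.H * (16 * √(Fintype.card S * T.L 𝓜.H δ k x a / T.n 𝓜.H k x a)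
          + 36 * (Fintype.card S * T.L 𝓜.H δ k x a / T.n 𝓜.H k x a)) := by
  have hL := hc.log_pos.le
  have hn2 : (2 : ℝ) ≤ T.n 𝓜.H k x a := by exact_mod_cast hn
  have hjH : (j : ℝ) ≤ 𝓜.H := by exact_mod_cast hj
  have hH1 : (1 : ℝ) ≤ 𝓜.H := by exact_mod_cast hH
  have hq := Transcript.phat_mem (show T.n 𝓜.H k x a ≠ 0 by omega)
  have hε := hc.log_div_le
  have hbr := hc.bonusRew_le hn
  have hdev := hc.mean_phat_le_mean_add (by omega) (by linarith : (0 : ℝ) < 𝓜.H) hs.gap_nonneg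
    fun y => (hs.gap_le y).trans hjH
  have hu1 : T.qStep 𝓜.H δ k j vu vl x a ≤ _ := min_le_right _ _
  have hl1 : _ ≤ T.vLowStep 𝓜.H δ k vu vl x a := le_max_right _ _
  have hlin := linear_bonus_le hn2 (mul_nonneg (Nat.cast_nonneg 𝓜.H) hL)
  -- Crude variance bounds suffice, since these increments enter only the future term.
  have hvar : var (T.phat 𝓜.H k x a) vu ≤ (𝓜.H : ℝ) ^ 2 :=
    (var_le_mean_sq_sub hq vu 0).trans (mean_le hq fun y => by
      rw [sub_zero]; exact pow_le_pow_left₀ (hs.up_nonneg y) ((hs.up_le y).trans hjH) 2)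
  have hgap : mean (T.phat 𝓜.H k x a) (fun y => (vu y - vl y) ^ 2) ≤ (𝓜.H : ℝ) ^ 2 :=
    mean_le hq fun y => pow_le_pow_left₀ (hs.gap_nonneg y) ((hs.gap_le y).trans hjH) 2
  have hnorm : norm2 (T.phat 𝓜.H k x a) (vl - vu) ^ 2
      = mean (T.phat 𝓜.H k x a) (fun y => (vu y - vl y) ^ 2) := by
    rw [norm2_sub_comm, norm2_sq hq.1]; rfl
  have hnorm' : norm2 (T.phat 𝓜.H k x a) (vu - vl) ≤ 𝓜.H := by
    rw [norm2_sub_comm]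
    exact abs_le_of_sq_le_sq' (hnorm.trans_le hgap) (by linarith) |>.2
  have hbs : T.bonusStr 𝓜.H δ k vu vl x a
      ≤ 𝓜.H * √(Fintype.card S * T.L 𝓜.H δ k x a / T.n 𝓜.H k x a)
        + 8 / 3 * (𝓜.H * (Fintype.card S * T.L 𝓜.H δ k x a / T.n 𝓜.H k x a)) := by
    have e1 : (Fintype.card S : ℝ) * 𝓜.H * T.L 𝓜.H δ k x a / T.n 𝓜.H k x a
        = 𝓜.H * (Fintype.card S * T.L 𝓜.H δ k x a / T.n 𝓜.H k x a) := by ring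
    unfold Transcript.bonusStr
    rw [e1]
    exact add_le_add (mul_le_mul_of_nonneg_right hnorm' (Real.sqrt_nonneg _)) le_rfl
  have hbp : T.bonusProb 𝓜.H δ k vu vl x a
      ≤ 4 * (𝓜.H * √(Fintype.card S * T.L 𝓜.H δ k x a / T.n 𝓜.H k x a))
        + 16 / 3 * (𝓜.H * (T.L 𝓜.H δ k x a / T.n 𝓜.H k x a)) := by
    have hsqrt : ∀ v : ℝ, v ≤ (𝓜.H : ℝ) ^ 2 →
        √(2 * v * (T.L 𝓜.H δ k x a / T.n 𝓜.H k x a))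
          ≤ 2 * (𝓜.H * √(Fintype.card S * T.L 𝓜.H δ k x a / T.n 𝓜.H k x a)) := by
      intro v hv
      refine Real.sqrt_le_iff.2 ⟨by positivity, ?_⟩
      rw [mul_pow, mul_pow, Real.sq_sqrt (by positivity)]
      have hu0 : 0 ≤ T.L 𝓜.H δ k x a / T.n 𝓜.H k x a := by positivity
      have h1 := mul_le_mul_of_nonneg_right hv hu0
      have h2 := mul_le_mul_of_nonneg_left hε (sq_nonneg (𝓜.H : ℝ))
      have h3 := mul_nonneg (sq_nonneg (𝓜.H : ℝ)) hu0
      linarith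
    refine (bonusProb_le_add hn vu vl).trans ?_
    rw [mul_div_assoc (𝓜.H : ℝ)] at hlin
    linarith [hsqrt _ hvar, hsqrt _ hgap]
  have hsr : √(𝓜.rewardVar x a * (T.L 𝓜.H δ k x a / T.n 𝓜.H k x a))
      ≤ √(Fintype.card S * T.L 𝓜.H δ k x a / T.n 𝓜.H k x a) := by
    refine Real.sqrt_le_sqrt (le_trans ?_ hε)
    exact mul_le_of_le_one_left (by positivity) (𝓜.rewardVar_le_one x a)
  rw [mean_sub] at hdev ⊢
  rw [mean_sub] at hdev
  set ε := Fintype.card S * T.L 𝓜.H δ k x a / T.n 𝓜.H k x a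
  have hε0 : 0 ≤ ε := by positivity
  have h1 : √ε ≤ 𝓜.H * √ε := le_mul_of_one_le_left (Real.sqrt_nonneg _) hH1
  have h2 : ε ≤ 𝓜.H * ε := le_mul_of_one_le_left hε0 hH1
  have h3 := mul_le_mul_of_nonneg_left hε (by linarith : (0 : ℝ) ≤ 𝓜.H)
  nlinarith

end Confident

end UpperBounds

/-! ### Accumulation of the gap and the surplus bound -/

section Surplus

variable {S A : Type*} [Fintype S] [Fintype A] [DecidableEq S] [DecidableEq A]
  {𝓜 : MDP S A} {T : Transcript S A} {H k : ℕ} {x : S} {a : A} {δ : ℝ}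

namespace Transcript

lemma two_le_size_mul_div (hδ0 : 0 < δ) (hδ1 : δ < 1) (hM : 2 ≤ size S A H)
    (hn : 1 ≤ T.n H k x a) : 2 ≤ (size S A H : ℝ) * T.n H k x a / δ := by
  have h1 : (2 : ℝ) ≤ size S A H := by exact_mod_cast hM
  have h2 : (1 : ℝ) ≤ T.n H k x a := by exact_mod_cast hn
  rw [le_div_iff₀ hδ0]
  nlinarith

lemma log_two_le_logTerm (hδ0 : 0 < δ) (hδ1 : δ < 1) (hM : 2 ≤ size S A H)
    (hn : 1 ≤ T.n H k x a) : Real.log 2 ≤ T.logTerm H δ k x a :=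
  Real.log_le_log zero_lt_two (two_le_size_mul_div hδ0 hδ1 hM hn)

/-- Use `M² n / δ ≤ (M n / δ)²` and `log 10 ≤ 10/3 log 2 ≤ 10/3 log (M n / δ)`; the factor is `2 (2
+ 10/3) ≤ 11`. -/
lemma L_le (hδ0 : 0 < δ) (hδ1 : δ < 1) (hM : 2 ≤ size S A H) (hn : 1 ≤ T.n H k x a) :
    T.L H δ k x a ≤ 11 * T.logTerm H δ k x a := by
  have h1 : (2 : ℝ) ≤ size S A H := by exact_mod_cast hM
  have h2 : (1 : ℝ) ≤ T.n H k x a := by exact_mod_cast hn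
  have h3 := two_le_size_mul_div hδ0 hδ1 hM hn
  have h4 : Real.log (10 * (size S A H : ℝ) ^ 2 * T.n H k x a / δ)
      ≤ Real.log 10 + 2 * T.logTerm H δ k x a := by
    have e : 2 * T.logTerm H δ k x a = Real.log (((size S A H : ℝ) * T.n H k x a / δ) ^ 2) := by
      rw [Real.log_pow, logTerm]; push_cast; ring
    rw [e, ← Real.log_mul (by norm_num) (by positivity)]
    refine Real.log_le_log (by positivity) ?_
    rw [mul_assoc 10, mul_div_assoc, div_pow, mul_pow]
    refine mul_le_mul_of_nonneg_left ?_ (by norm_num)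
    rw [div_le_div_iff₀ hδ0 (by positivity)]
    have h5 : (T.n H k x a : ℝ) * δ ^ 2 ≤ (T.n H k x a : ℝ) ^ 2 * δ := by
      have : (T.n H k x a : ℝ) * δ ≤ (T.n H k x a : ℝ) ^ 2 := by nlinarith
      nlinarith
    nlinarith [mul_le_mul_of_nonneg_left h5 (sq_nonneg (size S A H : ℝ))]
  have h6 : Real.log 10 ≤ 10 / 3 * Real.log 2 := by
    have : Real.log ((10 : ℝ) ^ 3) ≤ Real.log ((2 : ℝ) ^ 10) :=
      Real.log_le_log (by norm_num) (by norm_num)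
    rw [Real.log_pow, Real.log_pow] at this
    push_cast at this
    linarith
  have h7 := log_two_le_logTerm (T := T) hδ0 hδ1 hM hn
  rw [L, max_eq_left h2]
  linarith [Real.log_two_gt_d9]

lemma bFut_nonneg (T : Transcript S A) (H : ℕ) (δ : ℝ) (k : ℕ) (x : S) (a : A) :
    0 ≤ T.bFut H δ k x a := by
  unfold bFut
  split_ifs <;> positivity

/-- At `n = 1`, `w ≥ log 2` already forces `√w + w ≥ 1`. So the future term is saturated wherever
the bonuses take their default values. -/
lemma bFut_of_le_one (hδ0 : 0 < δ) (hδ1 : δ < 1) (hM : 2 ≤ size S A H)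
    (hn : T.n H k x a ≤ 1) : T.bFut H δ k x a = (H : ℝ) ^ 3 := by
  unfold bFut
  split_ifs with h0
  · rfl
  · have hn1 : T.n H k x a = 1 := by omega
    have hlog := log_two_le_logTerm (T := T) hδ0 hδ1 hM hn1.ge
    have hS : (1 : ℝ) ≤ Fintype.card S := by exact_mod_cast Fintype.card_pos_iff.2 ⟨x⟩
    rw [hn1, Nat.cast_one, div_one]
    set w := (Fintype.card S : ℝ) * T.logTerm H δ k x a
    have hw : 0.69 ≤ w := by nlinarith [Real.log_two_gt_d9]
    have hsw : 0.8 ≤ √w := Real.le_sqrt_of_sq_le (by norm_num at hw ⊢; linarith)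
    refine min_eq_left (le_mul_of_one_le_right (by positivity) (one_le_pow₀ ?_))
    norm_num at hw hsw ⊢
    linarith

/-- Either the future term is saturated, or there are at least two visits. -/
lemma bFut_cases (hδ0 : 0 < δ) (hδ1 : δ < 1) (hM : 2 ≤ size S A H) :
    T.bFut H δ k x a = (H : ℝ) ^ 3 ∨ (2 ≤ T.n H k x a ∧ T.bFut H δ k x a = (H : ℝ) ^ 3 *
      (√((Fintype.card S : ℝ) * T.logTerm H δ k x a / T.n H k x a)
        + (Fintype.card S : ℝ) * T.logTerm H δ k x a / T.n H k x a) ^ 2) := by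
  obtain hn | hn := Nat.lt_or_ge (T.n H k x a) 2
  · exact Or.inl (bFut_of_le_one hδ0 hδ1 hM (by omega))
  · unfold bFut
    rw [if_neg (by omega)]
    exact (min_choice _ _).imp id fun h => ⟨hn, h⟩

end Transcript

lemma one_le_horizon (hM : 2 ≤ size S A H) : 1 ≤ H := by
  by_contra h
  have : H = 0 := by omega
  subst this
  simp [size] at hM

lemma size_div_le (hδ0 : 0 < δ) (hδ1 : δ < 1) (hM : 2 ≤ size S A H) (hn : 1 ≤ T.n H k x a) :
    (Fintype.card S : ℝ) * T.L H δ k x a / T.n H k x a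
      ≤ 11 * ((Fintype.card S : ℝ) * T.logTerm H δ k x a / T.n H k x a) := by
  rw [← mul_div_assoc]
  refine div_le_div_of_nonneg_right ?_ (Nat.cast_nonneg _)
  linarith [mul_le_mul_of_nonneg_left (Transcript.L_le (T := T) hδ0 hδ1 hM hn)
    (Nat.cast_nonneg (α := ℝ) (Fintype.card S))]

/-- Young's inequality `2αe ≤ α²/j + j e²`. Iterated, it is Cauchy–Schwarz over the stages in
recursive form. -/
lemma sq_add_le {α e Y : ℝ} {j : ℕ} (hY : 0 ≤ Y) (h : α ^ 2 ≤ j * Y) :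
    (α + e) ^ 2 ≤ (j + 1) * (e ^ 2 + Y) := by
  obtain rfl | hj := Nat.eq_zero_or_pos j
  · have h0 : α = 0 := by
      have : α ^ 2 ≤ 0 := by simpa using h
      exact pow_eq_zero_iff two_ne_zero |>.1 (le_antisymm this (sq_nonneg _))
    simp [h0, hY]
  · have hj' : (0 : ℝ) < j := by exact_mod_cast hj
    have h1 : 2 * (α * e) ≤ α ^ 2 / j + j * e ^ 2 := by
      have h2 : α ^ 2 / j + j * e ^ 2 - 2 * (α * e) = (α - j * e) ^ 2 / j := by
        field_simp; ring
      have h3 : 0 ≤ (α - j * e) ^ 2 / j := by positivity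
      linarith
    have h4 : α ^ 2 / j ≤ Y := by rw [div_le_iff₀ hj']; linarith
    nlinarith

/-- One step of the gap recursion: the increment of the gap is controlled by the future term. -/
lemma exists_gap_step [Nonempty A] (hc : Confident 𝓜 δ T k x a) (hδ0 : 0 < δ) (hδ1 : δ < 1)
    (hM : 2 ≤ size S A 𝓜.H) {j : ℕ} (hj : j + 1 ≤ 𝓜.H) {π : ℕ → S → A} {h : ℕ} {vu vl : S → ℝ}
    (hs : Sandwich 𝓜 π h j vu vl) :
    ∃ e, T.qStep 𝓜.H δ k j vu vl x a - T.vLowStep 𝓜.H δ k vu vl x a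
        ≤ mean (𝓜.p x a) (fun y => vu y - vl y) + e ∧
      e ^ 2 ≤ 160000 * T.bFut 𝓜.H δ k x a / 𝓜.H := by
  have hH := one_le_horizon hM
  have hpos : (0 : ℝ) < 𝓜.H := by exact_mod_cast hH
  have hjH : (j : ℝ) + 1 ≤ 𝓜.H := by exact_mod_cast hj
  obtain hB | ⟨hn, hB⟩ := Transcript.bFut_cases (T := T) (k := k) (x := x) (a := a) hδ0 hδ1 hM
  -- Saturated case: the new gap is at most `j + 1 ≤ H`, and `H² = bFut / H`.
  · refine ⟨𝓜.H, ?_, ?_⟩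
    · have h1 : T.qStep 𝓜.H δ k j vu vl x a ≤ j + 1 := min_le_left _ _
      have h2 : 0 ≤ T.vLowStep 𝓜.H δ k vu vl x a := le_max_left _ _
      have h3 := mean_nonneg (𝓜.p_mem x a).1 hs.gap_nonneg
      linarith
    · rw [hB, le_div_iff₀ hpos]
      nlinarith [pow_pos hpos 3]
  · have hw0 : 0 ≤ (Fintype.card S : ℝ) * T.logTerm 𝓜.H δ k x a / T.n 𝓜.H k x a := by
      have := Transcript.log_two_le_logTerm (T := T) (k := k) (x := x) (a := a) hδ0 hδ1 hM
        (by omega)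
      have : 0 ≤ T.logTerm 𝓜.H δ k x a := by linarith [Real.log_two_gt_d9]
      positivity
    have hε := size_div_le (T := T) (k := k) (x := x) (a := a) hδ0 hδ1 hM (by omega)
    have hstep := hc.qStep_sub_vLowStep_le (by omega) hs hH hn
    rw [hB]
    set w := (Fintype.card S : ℝ) * T.logTerm 𝓜.H δ k x a / T.n 𝓜.H k x a
    set ε := (Fintype.card S : ℝ) * T.L 𝓜.H δ k x a / T.n 𝓜.H k x a
    have hsw := Real.sqrt_nonneg w
    -- From `ε ≤ 11 w`: `16·4 √w + 36·11 w ≤ 400 (√w + w)`, and `160000 = 400²`.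
    refine ⟨𝓜.H * (400 * (√w + w)), hstep.trans (add_le_add le_rfl ?_), le_of_eq ?_⟩
    · refine mul_le_mul_of_nonneg_left ?_ hpos.le
      have h1 : √ε ≤ 4 * √w := by
        refine Real.sqrt_le_iff.2 ⟨by positivity, ?_⟩
        rw [mul_pow, Real.sq_sqrt hw0]; linarith
      linarith
    · field_simp
      ring

/-- The squared gap between upper and lower values is controlled by the future terms. -/
lemma gap_sq_le [Nonempty A] (hc : ∀ x a, Confident 𝓜 δ T k x a) (hδ0 : 0 < δ) (hδ1 : δ < 1)
    (hM : 2 ≤ size S A 𝓜.H) (hT : T.IsStrongEuler 𝓜.H δ) (hk : 1 ≤ k) {j : ℕ} (hj : j ≤ 𝓜.H)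
    (x : S) :
    ((T.values 𝓜.H δ k j).1 x - (T.values 𝓜.H δ k j).2 x) ^ 2
      ≤ j * (160000 / 𝓜.H * 𝓜.rolloutSum (T.pol k) (T.bFut 𝓜.H δ k) (𝓜.H + 1 - j) x
          (T.pol k (𝓜.H + 1 - j) x)) := by
  have hH := one_le_horizon hM
  have hpos : (0 : ℝ) < 𝓜.H := by exact_mod_cast hH
  induction j generalizing x with
  | zero => simp [Transcript.values]
  | succ j ih =>
    have hs := sandwich_values hc hT hk (show j ≤ 𝓜.H by omega)
    have hs' := sandwich_values hc hT hk hj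
    obtain ⟨e, he1, he2⟩ := exists_gap_step (hc x (T.pol k (𝓜.H - j) x)) hδ0 hδ1 hM hj hs
    rw [show 𝓜.H + 1 - (j + 1) = 𝓜.H - j by omega, 𝓜.rolloutSum_eq _ _ (by omega : 𝓜.H - j ≤ 𝓜.H)]
    set G : S → ℝ := fun y => 𝓜.rolloutSum (T.pol k) (T.bFut 𝓜.H δ k) (𝓜.H - j + 1) y
      (T.pol k (𝓜.H - j + 1) y) with hG
    set p := 𝓜.p x (T.pol k (𝓜.H - j) x)
    have hp : p ∈ stdSimplex ℝ S := 𝓜.p_mem _ _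
    have hG0 : 0 ≤ mean p G := mean_nonneg hp.1 fun y =>
      𝓜.rolloutSum_nonneg _ (T.bFut_nonneg 𝓜.H δ k) _ _ _
    -- Jensen moves the square inside the expectation, where the induction hypothesis applies at
    -- each next state.
    have hα : mean p (fun y => (T.values 𝓜.H δ k j).1 y - (T.values 𝓜.H δ k j).2 y) ^ 2
        ≤ j * (160000 / 𝓜.H * mean p G) := by
      refine (sq_mean_le hp _).trans ?_
      rw [← mean_const_mul, ← mean_const_mul]
      refine mean_mono hp.1 fun y => ?_
      have := ih (by omega) y
      rwa [show 𝓜.H + 1 - j = 𝓜.H - j + 1 by omega] at this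
    have h1 := sq_add_le (e := e) (by positivity) hα
    have h2 : (T.values 𝓜.H δ k (j + 1)).1 x - (T.values 𝓜.H δ k (j + 1)).2 x
        ≤ mean p (fun y => (T.values 𝓜.H δ k j).1 y - (T.values 𝓜.H δ k j).2 y) + e := he1
    have h3 := pow_le_pow_left₀ (hs'.gap_nonneg x) h2 2
    refine h3.trans (h1.trans ?_)
    push_cast
    refine mul_le_mul_of_nonneg_left ?_ (by positivity)
    rw [mul_add, div_mul_eq_mul_div 160000 (𝓜.H : ℝ) (T.bFut _ _ _ _ _)]
    exact add_le_add he2 le_rfl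

lemma surplus_nonneg [Nonempty A] (hc : ∀ x a, Confident 𝓜 δ T k x a)
    (hT : T.IsStrongEuler 𝓜.H δ) (hk : 1 ≤ k) {h : ℕ} (hh : h ∈ Finset.Icc 1 𝓜.H) (x : S)
    (a : A) : 0 ≤ T.surplus 𝓜 δ k h x a := by
  obtain ⟨hh1, hh2⟩ := Finset.mem_Icc.1 hh
  have hs := sandwich_values hc hT hk (show 𝓜.H - h ≤ 𝓜.H by omega)
  rw [show 𝓜.H + 1 - (𝓜.H - h) = h + 1 by omega] at hs
  have h1 := (hc x a).backup_le_qStep (by omega) hs hh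
  have e1 : T.vUp 𝓜.H δ k (h + 1) = (T.values 𝓜.H δ k (𝓜.H - h)).1 := by
    funext y; rw [Transcript.vUp, Nat.add_sub_add_right]
  have e2 : T.vLow 𝓜.H δ k (h + 1) = (T.values 𝓜.H δ k (𝓜.H - h)).2 := by
    funext y; rw [Transcript.vLow, Nat.add_sub_add_right]
  rw [Transcript.surplus, Transcript.qUp, e1, e2]
  linarith

/-- The at most `H` remaining stages cancel the `1 / H` of `gap_sq_le`. The dominant constant is `6
· 160000` for the gap; the others are `10 · 4` for the lead term and `46 · 11` for the local future
term. -/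
lemma surplus_le [Nonempty A] (hc : ∀ x a, Confident 𝓜 δ T k x a) (hδ0 : 0 < δ) (hδ1 : δ < 1)
    (hM : 2 ≤ size S A 𝓜.H) (hT : T.IsStrongEuler 𝓜.H δ) (hk : 1 ≤ k) {h : ℕ}
    (hh : h ∈ Finset.Icc 1 𝓜.H) (x : S) (a : A) :
    T.surplus 𝓜 δ k h x a ≤ 1000000 * (T.bLead 𝓜 δ k h x a +
      𝓜.rolloutSum (T.pol k) (T.bFut 𝓜.H δ k) h x a) := by
  have hH := one_le_horizon hM
  have hpos : (0 : ℝ) < 𝓜.H := by exact_mod_cast hH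
  have hH1 : (1 : ℝ) ≤ 𝓜.H := by exact_mod_cast hH
  obtain ⟨hh1, hh2⟩ := Finset.mem_Icc.1 hh
  have hs := sandwich_values hc hT hk (show 𝓜.H - h ≤ 𝓜.H by omega)
  rw [show 𝓜.H + 1 - (𝓜.H - h) = h + 1 by omega] at hs
  have hgap := gap_sq_le hc hδ0 hδ1 hM hT hk (show 𝓜.H - h ≤ 𝓜.H by omega)
  rw [show 𝓜.H + 1 - (𝓜.H - h) = h + 1 by omega] at hgap
  have e1 : T.vUp 𝓜.H δ k (h + 1) = (T.values 𝓜.H δ k (𝓜.H - h)).1 := by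
    funext y; rw [Transcript.vUp, Nat.add_sub_add_right]
  have e2 : T.vLow 𝓜.H δ k (h + 1) = (T.values 𝓜.H δ k (𝓜.H - h)).2 := by
    funext y; rw [Transcript.vLow, Nat.add_sub_add_right]
  rw [Transcript.surplus, Transcript.qUp, e1, e2]
  set vu := (T.values 𝓜.H δ k (𝓜.H - h)).1
  set vl := (T.values 𝓜.H δ k (𝓜.H - h)).2
  set B := T.bFut 𝓜.H δ k x a with hBdef
  have hB0 : 0 ≤ B := T.bFut_nonneg _ _ _ _ _
  have hp := 𝓜.p_mem x a
  rw [𝓜.rolloutSum_eq _ _ hh2, ← hBdef]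
  set G := mean (𝓜.p x a) fun y => 𝓜.rolloutSum (T.pol k) (T.bFut 𝓜.H δ k) (h + 1) y
    (T.pol k (h + 1) y) with hGdef
  have hG0 : 0 ≤ G := mean_nonneg hp.1 fun y =>
    𝓜.rolloutSum_nonneg _ (T.bFut_nonneg 𝓜.H δ k) _ _ _
  have hX : mean (𝓜.p x a) (fun y => (vu y - vl y) ^ 2) ≤ 160000 * G := by
    rw [hGdef, ← mean_const_mul]
    refine mean_mono hp.1 fun y => (hgap y).trans ?_
    rw [← mul_assoc]
    refine mul_le_mul_of_nonneg_right ?_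
      (𝓜.rolloutSum_nonneg _ (T.bFut_nonneg 𝓜.H δ k) _ _ _)
    rw [mul_div_assoc', div_le_iff₀ hpos, mul_comm]
    exact mul_le_mul_of_nonneg_left (by exact_mod_cast (by omega : 𝓜.H - h ≤ 𝓜.H)) (by norm_num)
  have hEH : T.qStep 𝓜.H δ k (𝓜.H - h) vu vl x a - 𝓜.r x a - mean (𝓜.p x a) vu ≤ 𝓜.H := by
    have h1 : T.qStep 𝓜.H δ k (𝓜.H - h) vu vl x a ≤ ((𝓜.H - h : ℕ) : ℝ) + 1 := min_le_left _ _
    have h2 := mean_nonneg hp.1 hs.up_nonneg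
    have h3 : ((𝓜.H - h : ℕ) : ℝ) + 1 ≤ 𝓜.H := by exact_mod_cast (by omega : 𝓜.H - h + 1 ≤ 𝓜.H)
    linarith [(𝓜.r_mem x a).1]
  have hH3 : (𝓜.H : ℝ) ≤ (𝓜.H : ℝ) ^ 3 := le_self_pow₀ hH1 (by norm_num)
  have hlead0 : 0 ≤ T.bLead 𝓜 δ k h x a := by
    unfold Transcript.bLead
    split_ifs <;> positivity
  obtain hB | ⟨hn, hB⟩ := Transcript.bFut_cases (T := T) (k := k) (x := x) (a := a) hδ0 hδ1 hM
  · rw [← hBdef] at hB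
    linarith
  · have hlog : 0 ≤ T.logTerm 𝓜.H δ k x a := by
      have := Transcript.log_two_le_logTerm (T := T) (k := k) (x := x) (a := a) hδ0 hδ1 hM
        (by omega)
      linarith [Real.log_two_gt_d9]
    have hw0 : 0 ≤ (Fintype.card S : ℝ) * T.logTerm 𝓜.H δ k x a / T.n 𝓜.H k x a := by
      positivity
    have hε := size_div_le (T := T) (k := k) (x := x) (a := a) hδ0 hδ1 hM (by omega)
    have hu : T.L 𝓜.H δ k x a / T.n 𝓜.H k x a
        ≤ 11 * (T.logTerm 𝓜.H δ k x a / T.n 𝓜.H k x a) := by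
      rw [← mul_div_assoc]
      exact div_le_div_of_nonneg_right (Transcript.L_le hδ0 hδ1 hM (by omega)) (Nat.cast_nonneg _)
    have hmin : T.qStep 𝓜.H δ k (𝓜.H - h) vu vl x a - 𝓜.r x a - mean (𝓜.p x a) vu
        ≤ 10 * √(𝓜.minVar (T.pol k) h x a * (T.L 𝓜.H δ k x a / T.n 𝓜.H k x a))
          + 6 * mean (𝓜.p x a) (fun y => (vu y - vl y) ^ 2)
          + 46 * (𝓜.H * (Fintype.card S * T.L 𝓜.H δ k x a / T.n 𝓜.H k x a)) := by
      -- `V⋆` and `V^π` both lie between `vl` and `vu`, so `qStep_sub_le` applies to whichever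
      -- attains the minimum.
      unfold MDP.minVar
      obtain h1 | h1 := min_choice (𝓜.rewardVar x a + var (𝓜.p x a) (𝓜.optValue (h + 1)))
        (𝓜.rewardVar x a + var (𝓜.p x a) (𝓜.value (T.pol k) (h + 1)))
      · rw [h1]
        exact (hc x a).qStep_sub_le (by omega) hs hh hn hs.low_le_opt hs.le_up
      · rw [h1]
        exact (hc x a).qStep_sub_le (by omega) hs hh hn hs.low_le
          fun y => (𝓜.value_le_optValue _ _ y).trans (hs.le_up y)
    have hv0 : 0 ≤ 𝓜.minVar (T.pol k) h x a :=
      le_min (add_nonneg (𝓜.rewardVar_nonneg x a) (var_nonneg hp.1 _))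
        (add_nonneg (𝓜.rewardVar_nonneg x a) (var_nonneg hp.1 _))
    have hsqrt : √(𝓜.minVar (T.pol k) h x a * (T.L 𝓜.H δ k x a / T.n 𝓜.H k x a))
        ≤ 4 * √(𝓜.minVar (T.pol k) h x a * T.logTerm 𝓜.H δ k x a / T.n 𝓜.H k x a) := by
      have h1 : 0 ≤ 𝓜.minVar (T.pol k) h x a * T.logTerm 𝓜.H δ k x a / T.n 𝓜.H k x a := by
        positivity
      refine Real.sqrt_le_iff.2 ⟨by positivity, ?_⟩
      rw [mul_pow, Real.sq_sqrt h1]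
      have h2 := mul_le_mul_of_nonneg_left hu hv0
      have h3 : 𝓜.minVar (T.pol k) h x a * (11 * (T.logTerm 𝓜.H δ k x a / T.n 𝓜.H k x a))
          = 11 * (𝓜.minVar (T.pol k) h x a * T.logTerm 𝓜.H δ k x a / T.n 𝓜.H k x a) := by ring
      linarith
    have hHw : 𝓜.H * ((Fintype.card S : ℝ) * T.logTerm 𝓜.H δ k x a / T.n 𝓜.H k x a) ≤ B := by
      rw [hBdef, hB]
      set w := (Fintype.card S : ℝ) * T.logTerm 𝓜.H δ k x a / T.n 𝓜.H k x a
      have h1 : w ≤ (√w + w) ^ 2 := by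
        nlinarith [Real.sq_sqrt hw0, Real.sqrt_nonneg w, mul_nonneg (Real.sqrt_nonneg w) hw0,
          sq_nonneg w]
      exact mul_le_mul hH3 h1 hw0 (by positivity)
    have hHε := mul_le_mul_of_nonneg_left hε hpos.le
    unfold Transcript.bLead
    rw [if_neg (by omega)]
    obtain h1 | h1 := min_choice (𝓜.H : ℝ)
      (√(𝓜.minVar (T.pol k) h x a * T.logTerm 𝓜.H δ k x a / T.n 𝓜.H k x a))
    · rw [h1]; linarith
    · rw [h1]
      have hs0 := Real.sqrt_nonneg
        (𝓜.minVar (T.pol k) h x a * T.logTerm 𝓜.H δ k x a / T.n 𝓜.H k x a)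
      linarith

end Surplus

end StrongEuler

end

/-! ### The proposition -/

theorem mainTheorem6 :
    ∃ c : ℝ, 1 ≤ c ∧
      ∀ (S A Ω : Type*) [Fintype S] [Fintype A] [DecidableEq S] [DecidableEq A]
        [MeasurableSpace Ω] (μ : MeasureTheory.Measure Ω) [MeasureTheory.IsProbabilityMeasure μ]
        (𝓜 : StrongEuler.MDP S A) (δ : ℝ) (D : Ω → StrongEuler.Transcript S A),
        0 < δ → δ < 1 → 2 ≤ StrongEuler.size S A 𝓜.H →
        StrongEuler.IsInteraction 𝓜 μ D → (∀ ω, (D ω).IsStrongEuler 𝓜.H δ) →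
        ∃ E : Set Ω, MeasurableSet E ∧ ENNReal.ofReal (1 - δ / 2) ≤ μ E ∧
          ∀ ω ∈ E, ∀ x a, ∀ h ∈ Finset.Icc 1 𝓜.H, ∀ k, 1 ≤ k →
            0 ≤ 1 / c * (D ω).surplus 𝓜 δ k h x a ∧
            1 / c * (D ω).surplus 𝓜 δ k h x a ≤
              (D ω).bLead 𝓜 δ k h x a +
                𝓜.rolloutSum ((D ω).pol k) ((D ω).bFut 𝓜.H δ k) h x a := by
  refine ⟨1000000, by norm_num, ?_⟩
  intro S A Ω _ _ _ _ _ μ _ 𝓜 δ D hδ0 hδ1 hM hI hSE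
  have hH := StrongEuler.one_le_horizon hM
  have hA : Nonempty A := by
    by_contra h
    rw [not_nonempty_iff] at h
    simp [StrongEuler.size] at hM
  set K := 10 * (StrongEuler.size S A 𝓜.H : ℝ) ^ 2 / δ with hK
  have hK4 : 4 ≤ K := StrongEuler.four_le_confidence hδ0 hδ1 hM
  set bad : Set Ω := {ω | ¬ StrongEuler.Regular 𝓜 K (D ω)}
  have hbad : μ bad ≤ ENNReal.ofReal (δ / 2) := by
    refine (hI.measure_not_regular_le hH (by linarith)).trans (ENNReal.ofReal_le_ofReal ?_)
    have hM2 : (2 : ℝ) ≤ StrongEuler.size S A 𝓜.H := by exact_mod_cast hM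
    have hH1 : (1 : ℝ) ≤ 𝓜.H := by exact_mod_cast hH
    have hsize : (Fintype.card S : ℝ) * Fintype.card A * 𝓜.H = StrongEuler.size S A 𝓜.H := by
      simp [StrongEuler.size]
    -- Since `2H + 4 ≤ 6H`, the failure probability is at most `6M / K = 6δ / (10M)`, below `δ / 2`
    -- for `M ≥ 2`.
    have h1 : (Fintype.card S : ℝ) * Fintype.card A * ((2 * 𝓜.H + 4) * K⁻¹)
        ≤ 6 * (StrongEuler.size S A 𝓜.H) * K⁻¹ := by
      rw [← hsize, ← mul_assoc]
      refine mul_le_mul_of_nonneg_right ?_ (inv_nonneg.2 (by linarith))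
      have h2 : (0 : ℝ) ≤ (Fintype.card S : ℝ) * Fintype.card A := by positivity
      nlinarith [mul_le_mul_of_nonneg_left hH1 h2]
    refine h1.trans ?_
    rw [hK, inv_div, mul_div_assoc', div_le_div_iff₀ (by positivity) two_pos]
    nlinarith [mul_pos hδ0 (by linarith : (0 : ℝ) < StrongEuler.size S A 𝓜.H)]
  -- A measurable hull has the same measure as `bad`, whose own measurability is thus not required.
  refine ⟨(toMeasurable μ bad)ᶜ, (measurableSet_toMeasurable μ bad).compl, ?_, ?_⟩
  · rw [prob_compl_eq_one_sub (measurableSet_toMeasurable μ bad), measure_toMeasurable,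
      ENNReal.ofReal_sub _ (by linarith), ENNReal.ofReal_one]
    exact tsub_le_tsub_left hbad 1
  · intro ω hω x a h hh k hk
    have hreg : StrongEuler.Regular 𝓜 K (D ω) := by
      by_contra hcon
      exact hω (subset_toMeasurable μ bad hcon)
    have hc : ∀ x a, StrongEuler.Confident 𝓜 δ (D ω) k x a := fun x a =>
      hreg.confident hH hδ0 hδ1 hM k x a
    refine ⟨mul_nonneg (by norm_num) (StrongEuler.surplus_nonneg hc (hSE ω) hk hh x a), ?_⟩
    have := StrongEuler.surplus_le hc hδ0 hδ1 hM (hSE ω) hk hh x a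
    linarith
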